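/- **Conventions.** Manifolds are smooth, real, finite-dimensional, Hausdorff, second countable and without boundary. A *singular semi-Riemannian manifold* $(M,g)$ is a manifold with a smooth symmetric $(0,2)$-tensor field $g$, whose rank and signature may vary; it is *nondegenerate* if every $g_x$ is. Its *Koszul form* is $$\mathcal K(X,Y,Z)=\tfrac12\{X g(Y,Z)+Y g(Z,X)-Z g(X,Y)-g(X,[Y,Z])+g(Y,[Z,X])+g(Z,[X,Y])\},$$ and, for $P\in\Gamma(TM)$, its *semi-symmetric non-metric Koszul form* is $\widehat{\mathcal K}(X,Y,Z)=\mathcal K(X,Y,Z)+g(Y,P)g(X,Z)$. Put $\nabla^\flat_XY=\mathcal K(X,Y,\cdot)$ and $\widehat\nabla^\flat_XY=\widehat{\mathcal K}(X,Y,\cdot)$. Let $\mathcal A^\bullet(M)$ be the set of smooth $1$-forms $\omega$ such that at every $x\in M$ one has $\omega_x=g_x(u,\cdot)$ for some $u\in T_xM$, and for $\omega,\tau\in\mathcal A^\bullet(M)$ let $\langle\langle\omega,\tau\rangle\rangle_\bullet(x)=g_x(u,v)$ where $\omega_x=g_x(u,\cdot)$, $\tau_x=g_x(v,\cdot)$ (for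 nondegenerate $g$ this is $g^*(\omega,\tau)$). For $\omega\in\mathcal A^\bullet(M)$ put $$(\nabla_X\omega)(Y)=X(\omega(Y))-\langle\langle\nabla^\flat_XY,\omega\rangle\rangle_\bullet,\qquad (\widehat\nabla_X\omega)(Y)=X(\omega(Y))-\langle\langle\widehat\nabla^\flat_XY,\omega\rangle\rangle_\bullet ;$$ these formulas are used on the open dense set of points near which the signature of $g$ is constant, and the values at the remaining points are the limits from that set (when they exist). $(M,g)$ is *semi-regular* if $\nabla^\flat_XY\in\mathcal A^\bullet(M)$ and $\nabla_Z\nabla^\flat_XY\in\mathcal A^\bullet(M)$ for all $X,Y,Z\in\Gamma(TM)$, and *semi-symmetric non-metric semi-regular* (with respect to $P$) if the same holds for $\widehat\nabla^\flat,\widehat\nabla$. In these cases one defines, respectively, $$R(X,Y,Z,T)=(\nabla_X\nabla^\flat_YZ)(T)-(\nabla_Y\nabla^\flat_XZ)(T)-(\nabla^\flat_{[X,Y]}Z)(T),$$ $$\widehat R(X,Y,Z,T)=(\widehat\nabla_X\widehat\nabla^\flat_YZ)(T)-(\widehat\nabla_Y\widehat\nabla^\flat_XZ)(T)-(\widehat\nabla^\flat_{[X,Y]}Z)(T).$$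 For $f\in C^\infty(B)$ (zeros allowed) the *warped product* $B\times_fF$ is $B\times F$ with the tensor $\pi_B^*g_B+(f\circ\pi_B)^2\pi_F^*g_F$. Objects on $B$ and $F$ are identified with their lifts to $B\times F$; a subscript $B$ or $F$ marks objects of the factors. **Theorem.** Let $(B,g_B)$ be a nondegenerate manifold, $(F,g_F)$ a semi-regular manifold, $f\in C^\infty(B)$ and $P\in\Gamma(TB)$. Then $B\times_fF$ is semi-regular, and it is semi-symmetric non-metric semi-regular with respect to $P$, so that its curvature $\widehat R$ is defined. Let $H^f(X,T)=(\nabla_Xdf)(T)$ be the Hessian of $f$ on $B$. For all $X,Y,Z,T\in\Gamma(TB)$ and $U,V,W,Q\in\Gamma(TF)$: 1. $\widehat R(X,Y,Z,T)=\widehat R_B(X,Y,Z,T)$; 2. $\widehat R(X,Y,Z,Q)=\widehat R(Z,Q,X,Y)=\widehat R(X,Y,Q,Z)=0$; 3. $\widehat R(X,Y,W,Q)=\widehat R(W,Q,X,Y)=0$; 4. $\widehat R(X,V,W,T)=-fH^f(X,T)g_F(V,W)+2fX(f)g_F(V,W)g_B(P,T)$; 5. $\widehat R(X,V,T,W)=fH^f(X,T)g_F(V,W)+f^2g_F(V,W)X(g_B(P,T))$;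 6. $\widehat R(U,V,Z,Q)=\widehat R(Z,Q,U,V)=0$; 7. $\widehat R(U,V,Q,Z)=f^2g_B(P,Z)[\mathcal K_F(U,Q,V)-\mathcal K_F(V,Q,U)]$; 8. $\widehat R(U,V,W,Q)=f^2R_F(U,V,W,Q)+f^2g_B^*(df,df)[g_F(U,W)g_F(V,Q)-g_F(V,W)g_F(U,Q)]$. -/

import Mathlib

open scoped Manifold ContDiff Topology

noncomputable section

namespace SingularGeometry

section General

variable {E : Type*} [NormedAddCommGroup E] [NormedSpace ℝ E]
  {H : Type*} [TopologicalSpace H] (I : ModelWithCorners ℝ E H)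
  {M : Type*} [TopologicalSpace M] [ChartedSpace H M]

/-- Vector fields on `M` (not necessarily smooth). -/
abbrev VField (M : Type*) [TopologicalSpace M] [ChartedSpace H M] :=
  (x : M) → TangentSpace I x

/-- `X ∈ Γ(TM)`: the vector field `X` is smooth. -/
def IsSmoothField [IsManifold I ∞ M] (X : VField I M) : Prop :=
  ContMDiff I I.tangent ∞ (fun x => (⟨x, X x⟩ : TangentBundle I M))

/-- Fields of bilinear forms on the tangent spaces. -/
abbrev MetricField (M : Type*) [TopologicalSpace M] [ChartedSpace H M] :=
  (x : M) → LinearMap.BilinForm ℝ (TangentSpace I x)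

/-- Differential `1`-forms, given by their values `θ(Z)` on vector fields `Z`. -/
abbrev OneForm (M : Type*) [TopologicalSpace M] [ChartedSpace H M] :=
  VField I M → M → ℝ

/-- Maps `Γ(TM)³ → C^∞(M)`, such as the Koszul form. -/
abbrev TernaryForm (M : Type*) [TopologicalSpace M] [ChartedSpace H M] :=
  VField I M → VField I M → VField I M → M → ℝ

variable {I}

/-- The derivative `X(h)` of a function `h` along a vector field `X`. -/
def dirDeriv (X : VField I M) (h : M → ℝ) : M → ℝ :=
  fun x => mfderiv I 𝓘(ℝ, ℝ) h x (X x)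

/-- The function `g(X, Y)`. -/
def pairing (g : MetricField I M) (X Y : VField I M) : M → ℝ :=
  fun x => g x (X x) (Y x)

/-- The differential `df` of a function. -/
def differential (f : M → ℝ) : OneForm I M := fun X => dirDeriv X f

/-- `(M, g)` is a singular semi-Riemannian manifold: `g` is a smooth symmetric `(0,2)`-tensor field
(of any rank and signature, possibly varying from point to point), smoothness being tested on
smooth vector fields. -/
structure IsSingularMetric [IsManifold I ∞ M] (g : MetricField I M) : Prop where
  symm : ∀ x u v, g x u v = g x v u
  smooth : ∀ X Y : VField I M, IsSmoothField I X → IsSmoothField I Y →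
    ContMDiff I 𝓘(ℝ, ℝ) ∞ (pairing g X Y)

/-- `(M, g)` is non-degenerate, that is, a semi-Riemannian manifold in the usual sense. -/
structure IsNondegenerateMetric [IsManifold I ∞ M] (g : MetricField I M) : Prop
    extends IsSingularMetric g where
  nondegenerate : ∀ x, (g x).Nondegenerate

/-- The rank of `g` at a point: the dimension of the tangent space minus that of its radical. -/
def metricRank (g : MetricField I M) (x : M) : ℕ :=
  Module.finrank ℝ (LinearMap.range (g x))

/-- The region of (locally) constant signature. For a continuous family of symmetric bilinear forms
the signature is locally constant at a point exactly when the rank is. This set is open and dense. -/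
def regularSet (g : MetricField I M) : Set M :=
  {x | ∀ᶠ y in 𝓝 x, metricRank g y = metricRank g x}

/-- The Koszul form `𝒦(X, Y, Z)` of `g`. -/
def koszul (g : MetricField I M) : TernaryForm I M := fun X Y Z x =>
  (1 / 2 : ℝ) *
    (dirDeriv X (pairing g Y Z) x + dirDeriv Y (pairing g Z X) x - dirDeriv Z (pairing g X Y) x
      - pairing g X (VectorField.mlieBracket I Y Z) x
      + pairing g Y (VectorField.mlieBracket I Z X) x
      + pairing g Z (VectorField.mlieBracket I X Y) x)

/-- The semi-symmetric non-metric Koszul form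
`𝒦̂_P(X, Y, Z) = 𝒦(X, Y, Z) + g(Y, P) g(X, Z)`. -/
def snmKoszul (g : MetricField I M) (P : VField I M) : TernaryForm I M := fun X Y Z x =>
  koszul g X Y Z x + pairing g Y P x * pairing g X Z x

/-- `θ_x = g_x(u, ·)`, i.e. the covector `θ_x` is the image of `u ∈ T_xM` under the flat map. -/
def IsFlatAt [IsManifold I ∞ M] (g : MetricField I M) (θ : OneForm I M) (x : M)
    (u : TangentSpace I x) : Prop :=
  ∀ Z : VField I M, IsSmoothField I Z → θ Z x = g x u (Z x)

/-- `θ ∈ 𝒜^•(M)`: `θ` is a smooth `1`-form, and at every point `θ_x` lies in the image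
`T^•_xM` of the flat map `T_xM → T_x^*M`, `u ↦ g_x(u, ·)` (the radical-annihilator). -/
def IsRadicalAnnihilator [IsManifold I ∞ M] (g : MetricField I M) (θ : OneForm I M) : Prop :=
  (∀ Z : VField I M, IsSmoothField I Z → ContMDiff I 𝓘(ℝ, ℝ) ∞ (θ Z)) ∧
    ∀ x, ∃ u : TangentSpace I x, IsFlatAt g θ x u

open Classical in
/-- The inner product `⟪⟪θ, τ⟫⟫_•` at `x` of two `1`-forms with values in `T^•_xM`:
it is `g_x(u, v)` where `θ_x = g_x(u, ·)` and `τ_x = g_x(v, ·)`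
(for symmetric `g_x` this does not depend on `u` and `v`; the value is `0` if there are none). -/
def coInner [IsManifold I ∞ M] (g : MetricField I M) (θ τ : OneForm I M) (x : M) : ℝ :=
  if h : ∃ uv : TangentSpace I x × TangentSpace I x, IsFlatAt g θ x uv.1 ∧ IsFlatAt g τ x uv.2 then
    g x h.choose.1 h.choose.2
  else 0

/-- The covariant derivative `(∇_X θ)(Y) = X(θ(Y)) - ⟪⟪∇^♭_X Y, θ⟫⟫_•` of `θ ∈ 𝒜^•(M)`, where
`(∇^♭_X Y)(Z) = κ(X, Y, Z)` and `κ` is the Koszul form or one of its modifications.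
The formula is read on the region of constant signature, where `⟪⟪ , ⟫⟫_•` is smooth;
at the remaining points the value is the limit from this dense open region. In this way the
covariant derivative is smooth on `M` exactly when it extends smoothly from that region. -/
def covDeriv [IsManifold I ∞ M] (g : MetricField I M) (κ : TernaryForm I M) (X : VField I M)
    (θ : OneForm I M) : OneForm I M := fun Y =>
  extendFrom (regularSet g) (fun x => dirDeriv X (θ Y) x - coInner g (κ X Y) θ x)

/-- Semi-regularity with respect to the Koszul-type form `κ`: `∇^♭_X Y = κ(X, Y, ·)` and
`∇_Z ∇^♭_X Y` belong to `𝒜^•(M)` for all `X, Y, Z ∈ Γ(TM)`. -/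
structure IsSemiRegularFor [IsManifold I ∞ M] (g : MetricField I M) (κ : TernaryForm I M) : Prop
    extends IsSingularMetric g where
  lower : ∀ X Y : VField I M, IsSmoothField I X → IsSmoothField I Y →
    IsRadicalAnnihilator g (κ X Y)
  second : ∀ X Y Z : VField I M, IsSmoothField I X → IsSmoothField I Y → IsSmoothField I Z →
    IsRadicalAnnihilator g (covDeriv g κ Z (κ X Y))

/-- `(M, g)` is a semi-regular semi-Riemannian manifold. -/
def IsSemiRegular [IsManifold I ∞ M] (g : MetricField I M) : Prop := IsSemiRegularFor g (koszul g)

/-- `(M, g)` is a semi-symmetric non-metric semi-regular semi-Riemannian manifold. -/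
def IsSNMSemiRegular [IsManifold I ∞ M] (g : MetricField I M) (P : VField I M) : Prop :=
  IsSemiRegularFor g (snmKoszul g P)

/-- `(∇_X ∇^♭_Y Z)(T) - (∇_Y ∇^♭_X Z)(T) - (∇^♭_{[X,Y]} Z)(T)`. -/
def curvatureOf [IsManifold I ∞ M] (g : MetricField I M) (κ : TernaryForm I M)
    (X Y Z T : VField I M) (x : M) : ℝ :=
  covDeriv g κ X (κ Y Z) T x - covDeriv g κ Y (κ X Z) T x
    - κ (VectorField.mlieBracket I X Y) Z T x

/-- The Riemann curvature tensor `R` of `(M, g)`. -/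
def curvature [IsManifold I ∞ M] (g : MetricField I M) (X Y Z T : VField I M) (x : M) : ℝ :=
  curvatureOf g (koszul g) X Y Z T x

/-- The curvature `R̂` of the semi-symmetric non-metric covariant derivative. -/
def snmCurvature [IsManifold I ∞ M] (g : MetricField I M) (P X Y Z T : VField I M) (x : M) : ℝ :=
  curvatureOf g (snmKoszul g P) X Y Z T x

/-- The Hessian `H^f(X, Y) = (∇_X df)(Y)`. -/
def hessian [IsManifold I ∞ M] (g : MetricField I M) (f : M → ℝ) (X Y : VField I M) : M → ℝ :=
  covDeriv g (koszul g) X (differential f) Y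

end General

section Product

variable {EB : Type*} [NormedAddCommGroup EB] [NormedSpace ℝ EB]
  {HB : Type*} [TopologicalSpace HB] {IB : ModelWithCorners ℝ EB HB}
  {B : Type*} [TopologicalSpace B] [ChartedSpace HB B]
  {EF : Type*} [NormedAddCommGroup EF] [NormedSpace ℝ EF]
  {HF : Type*} [TopologicalSpace HF] {IF : ModelWithCorners ℝ EF HF}
  {F : Type*} [TopologicalSpace F] [ChartedSpace HF F]

/-- The metric `π_B^* g_B + (f ∘ π_B)² π_F^* g_F` of the warped product `B ×_f F`. -/
def warpedMetric (gB : MetricField IB B) (gF : MetricField IF F) (f : B → ℝ) :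
    MetricField (IB.prod IF) (B × F) := fun p =>
  (gB p.1).compl₁₂
      (mfderiv (IB.prod IF) IB (Prod.fst : B × F → B) p).toLinearMap
      (mfderiv (IB.prod IF) IB (Prod.fst : B × F → B) p).toLinearMap
    + (f p.1) ^ 2 •
      (gF p.2).compl₁₂
        (mfderiv (IB.prod IF) IF (Prod.snd : B × F → F) p).toLinearMap
        (mfderiv (IB.prod IF) IF (Prod.snd : B × F → F) p).toLinearMap

/-- The lift to `B × F` of a vector field on `B`: tangent to the leaves `B × {t}`. -/
def liftBase (IF : ModelWithCorners ℝ EF HF) (F : Type*) [TopologicalSpace F] [ChartedSpace HF F]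
    (X : VField IB B) : VField (IB.prod IF) (B × F) := fun p =>
  mfderiv IB (IB.prod IF) (fun b : B => (b, p.2)) p.1 (X p.1)

/-- The lift to `B × F` of a vector field on `F`: tangent to the fibers `{b} × F`. -/
def liftFiber (IB : ModelWithCorners ℝ EB HB) (B : Type*) [TopologicalSpace B] [ChartedSpace HB B]
    (V : VField IF F) : VField (IB.prod IF) (B × F) := fun p =>
  mfderiv IF (IB.prod IF) (fun t : F => (p.1, t)) p.2 (V p.2)

end Product

end SingularGeometry

end

open scoped Manifold ContDiff Topology

noncomputable section

namespace SingularGeometry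

set_option linter.unusedSectionVars false

/-! ### Smooth dependence of determinants and inverse matrices. -/

section MatrixSmooth

variable {E : Type*} [NormedAddCommGroup E] [NormedSpace ℝ E]
  {H : Type*} [TopologicalSpace H] {I : ModelWithCorners ℝ E H}
  {M : Type*} [TopologicalSpace M] [ChartedSpace H M]
  {ι : Type*} [Fintype ι] [DecidableEq ι] {n : ℕ∞ω} {s : Set M} {x : M}

/-! The field `P` is eliminated first. The inner product of a covector with g(Y,·) is its value at
Y. Hence, if ⟨⟨∇^♭_Z T, ∇^♭_X Y⟩⟩ extends smoothly from the region of constant signature, so does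
its hatted analogue, and the two covariant derivatives differ by explicit smooth terms. So a
semi-regular manifold is semi-symmetric non-metric semi-regular for every smooth P, and R̂(X,Y,Z,T)
equals R(X,Y,Z,T) + X(g(Z,P)) g(Y,T) - Y(g(Z,P)) g(X,T) + g(T,P) [K(X,Z,Y) - K(Y,Z,X)]: see
`IsSemiRegular.isSNMSemiRegular` and `IsSemiRegular.snmCurvature_eq`.

It remains to treat the ordinary Koszul form of the warped product. On lifts the covectors ∇^♭_A C
have explicit representatives: a base vector for two base fields, (Xf/f)V for a base field X and a
fiber field V, and the sum of -f g_F(V,W) grad f and a fiber vector for two fiber fields. Fiber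
vectors are measured by f² g_F, so the factors 1/f cancel and the inner products are restrictions of
smooth functions. Two of these claims hold only on the regular set. A regular point with f = 0 has
either g_F = 0 or f = 0 nearby, which gives ⟨⟨∇^♭_Z Q, ∇^♭_X V⟩⟩ = Z(f) X(f) g_F(V,Q)
(`dirDeriv_mul_pairing_eq_zero`). A regular point with f ≠ 0 lies over a regular point of F, where
semi-regularity of F supplies the extension (`mem_regularSet_fiber`).

The rank is lower semicontinuous, so the regular set is dense and the extended values are forced
(`IsSingularMetric.covDeriv_eq`). The resulting values of (∇_Z ∇^♭_X Y)(T) are collected in the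
`HasCovDeriv` lemmas. The Koszul form is tensorial up to Leibniz terms, so semi-regularity need only
be tested on a frame of lifts (`IsSingularMetric.isSemiRegular_of_frame`). The curvature identities
follow by substitution, with metricity, torsion-freeness and the vanishing of mixed brackets. -/

theorem ofNat_le_infty (k : ℕ) [k.AtLeastTwo] : (OfNat.ofNat k : ℕ∞ω) ≤ ∞ :=
  WithTop.coe_le_coe.2 (le_top : (OfNat.ofNat k : ℕ∞) ≤ ⊤)

theorem contMDiffWithinAt_det {A : M → Matrix ι ι ℝ}
    (hA : ∀ i j, ContMDiffWithinAt I 𝓘(ℝ, ℝ) n (fun y => A y i j) s x) :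
    ContMDiffWithinAt I 𝓘(ℝ, ℝ) n (fun y => (A y).det) s x := by
  simp only [Matrix.det_apply']
  exact contMDiffWithinAt_finsetSum fun σ _ =>
    contMDiffWithinAt_const.mul (contMDiffWithinAt_finsetProd fun i _ => hA (σ i) i)

theorem contMDiffWithinAt_adjugate {A : M → Matrix ι ι ℝ}
    (hA : ∀ i j, ContMDiffWithinAt I 𝓘(ℝ, ℝ) n (fun y => A y i j) s x) (i j : ι) :
    ContMDiffWithinAt I 𝓘(ℝ, ℝ) n (fun y => (A y).adjugate i j) s x := by
  simp only [Matrix.adjugate_apply]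
  refine contMDiffWithinAt_det fun k l => ?_
  simp only [Matrix.updateRow_apply]
  split_ifs
  · exact contMDiffWithinAt_const
  · exact hA k l

theorem contMDiffWithinAt_matrix_inv {A : M → Matrix ι ι ℝ}
    (hA : ∀ i j, ContMDiffWithinAt I 𝓘(ℝ, ℝ) n (fun y => A y i j) s x)
    (hdet : (A x).det ≠ 0) (i j : ι) :
    ContMDiffWithinAt I 𝓘(ℝ, ℝ) n (fun y => (A y)⁻¹ i j) s x := by
  simp only [Matrix.inv_def, Ring.inverse_eq_inv', Matrix.smul_apply, smul_eq_mul]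
  exact ((contMDiffWithinAt_det hA).inv₀ hdet).mul (contMDiffWithinAt_adjugate hA i j)

end MatrixSmooth

/-! ### Directional derivatives, smooth fields, brackets and local frames. -/

section Calculus

variable {E : Type*} [NormedAddCommGroup E] [NormedSpace ℝ E]
  {H : Type*} [TopologicalSpace H] {I : ModelWithCorners ℝ E H}
  {M : Type*} [TopologicalSpace M] [ChartedSpace H M]

theorem _root_.ContMDiff.mdiffAt {h : M → ℝ} (hh : ContMDiff I 𝓘(ℝ, ℝ) ∞ h) (x : M) :
    MDifferentiableAt I 𝓘(ℝ, ℝ) h x :=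
  (hh x).mdifferentiableAt (by simp)

theorem dirDeriv_add (X : VField I M) {h k : M → ℝ} {x : M}
    (hh : MDifferentiableAt I 𝓘(ℝ, ℝ) h x) (hk : MDifferentiableAt I 𝓘(ℝ, ℝ) k x) :
    dirDeriv X (fun y => h y + k y) x = dirDeriv X h x + dirDeriv X k x :=
  congr($(mvfderiv_add hh hk) (X x))

theorem dirDeriv_mul (X : VField I M) {h k : M → ℝ} {x : M}
    (hh : MDifferentiableAt I 𝓘(ℝ, ℝ) h x) (hk : MDifferentiableAt I 𝓘(ℝ, ℝ) k x) :
    dirDeriv X (fun y => h y * k y) x = h x * dirDeriv X k x + k x * dirDeriv X h x :=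
  congr($(mvfderiv_mul hh hk) (X x))

theorem dirDeriv_neg (X : VField I M) {h : M → ℝ} {x : M} :
    dirDeriv X (fun y => - h y) x = - dirDeriv X h x :=
  congr($(mvfderiv_neg (I := I) (g := h) (x := x)) (X x))

theorem dirDeriv_const (X : VField I M) (c : ℝ) (x : M) :
    dirDeriv X (fun _ => c) x = 0 :=
  congr($(mvfderiv_const (I := I) (M := M) c (x := x)) (X x))

theorem dirDeriv_congr {X X' : VField I M} {h k : M → ℝ} {x : M} (hX : X x = X' x)
    (hh : h =ᶠ[𝓝 x] k) : dirDeriv X h x = dirDeriv X' k x := by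
  simp only [dirDeriv, hX]
  exact congr($(hh.mfderiv_eq (I := I) (I' := 𝓘(ℝ, ℝ))) (X' x))

theorem dirDeriv_add_field (X X' : VField I M) (h : M → ℝ) (x : M) :
    dirDeriv (X + X') h x = dirDeriv X h x + dirDeriv X' h x :=
  map_add (mfderiv I 𝓘(ℝ, ℝ) h x) _ _

theorem dirDeriv_smul_field (a : M → ℝ) (X : VField I M) (h : M → ℝ) (x : M) :
    dirDeriv (a • X) h x = a x * dirDeriv X h x :=
  map_smul (mfderiv I 𝓘(ℝ, ℝ) h x) _ _

variable [IsManifold I ∞ M]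

theorem IsSmoothField.mdiffAt {X : VField I M} (hX : IsSmoothField I X) (x : M) :
    MDifferentiableAt I I.tangent (fun x => (⟨x, X x⟩ : TangentBundle I M)) x :=
  (hX x).mdifferentiableAt (by simp)

theorem IsSmoothField.add {X Y : VField I M} (hX : IsSmoothField I X) (hY : IsSmoothField I Y) :
    IsSmoothField I (X + Y) := ContMDiff.add_section hX hY

theorem IsSmoothField.smul {a : M → ℝ} {X : VField I M} (ha : ContMDiff I 𝓘(ℝ, ℝ) ∞ a)
    (hX : IsSmoothField I X) : IsSmoothField I (a • X) := ContMDiff.smul_section ha hX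

theorem isSmoothField_zero : IsSmoothField I (0 : VField I M) :=
  Bundle.contMDiff_zeroSection ℝ (TangentSpace I : M → Type _)

theorem IsSmoothField.sum {ι : Type*} {s : Finset ι} {X : ι → VField I M}
    (hX : ∀ i ∈ s, IsSmoothField I (X i)) : IsSmoothField I (∑ i ∈ s, X i) := by
  classical
  induction s using Finset.induction_on with
  | empty => simpa using isSmoothField_zero
  | insert i s hi ih =>
    rw [Finset.sum_insert hi]
    exact (hX i (by simp)).add (ih fun j hj => hX j (by simp [hj]))

theorem IsSmoothField.contMDiff_dirDeriv {X : VField I M} (hX : IsSmoothField I X) {h : M → ℝ}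
    (hh : ContMDiff I 𝓘(ℝ, ℝ) ∞ h) : ContMDiff I 𝓘(ℝ, ℝ) ∞ (dirDeriv X h) := by
  have h1 : ContMDiff I 𝓘(ℝ, ℝ).tangent ∞
      (fun x => tangentMap I 𝓘(ℝ, ℝ) h (⟨x, X x⟩ : TangentBundle I M)) :=
    (hh.contMDiff_tangentMap (m := ∞) le_rfl).comp hX
  exact (contMDiff_snd_tangentBundle_modelSpace ℝ 𝓘(ℝ, ℝ)).comp h1

variable [FiniteDimensional ℝ E]

theorem IsSmoothField.mlieBracket {X Y : VField I M} (hX : IsSmoothField I X)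
    (hY : IsSmoothField I Y) : IsSmoothField I (VectorField.mlieBracket I X Y) := by
  have : CompleteSpace E := FiniteDimensional.complete ℝ E
  have : IsManifold I (((⊤ : ℕ∞) : ℕ∞ω) + 1) M := ‹IsManifold I ∞ M›
  have : IsManifold I (minSmoothness ℝ 2) M := by
    simpa using IsManifold.of_le (I := I) (M := M) (m := 2) (n := ∞) (ofNat_le_infty _)
  exact ContDiff.mlieBracket_vectorField (m := ⊤) (n := ⊤) hX hY (by simp)

variable [T2Space M]

theorem exists_smooth_bump {x : M} {s : Set M} (hs : s ∈ 𝓝 x) :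
    ∃ χ : M → ℝ, ContMDiff I 𝓘(ℝ, ℝ) ∞ χ ∧ χ =ᶠ[𝓝 x] 1 ∧ tsupport χ ⊆ s := by
  obtain ⟨f, -, hf⟩ := (SmoothBumpFunction.nhds_basis_tsupport (I := I) x).mem_iff.1 hs
  exact ⟨f, f.contMDiff, f.eventuallyEq_one, hf⟩

/-- A bump function supported in U makes a local function global without changing it near x. Local
coefficients can thus be used where globally smooth ones are required. -/
theorem exists_contMDiff_eventuallyEq {x : M} {U : Set M} (hU : IsOpen U) (hx : x ∈ U) {h : M → ℝ}
    (hh : ContMDiffOn I 𝓘(ℝ, ℝ) ∞ h U) :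
    ∃ k : M → ℝ, ContMDiff I 𝓘(ℝ, ℝ) ∞ k ∧ k =ᶠ[𝓝 x] h := by
  obtain ⟨χ, hχ, hχ1, hχs⟩ := exists_smooth_bump (I := I) (hU.mem_nhds hx)
  refine ⟨fun y => χ y * h y, contMDiff_of_tsupport fun y hy => ?_, ?_⟩
  · have hyU : y ∈ U := hχs (tsupport_mul_subset_left hy)
    exact (hχ y).mul (hh.contMDiffAt (hU.mem_nhds hyU))
  · filter_upwards [hχ1] with y hy
    simp [hy]

theorem exists_isSmoothField_apply_eq (x : M) (v : TangentSpace I x) :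
    ∃ X : VField I M, IsSmoothField I X ∧ X x = v := by
  obtain ⟨s, hs, hsm⟩ := FiberBundle.exists_contMDiffOn_extend I E (k := ∞)
    (V := (TangentSpace I : M → Type _)) v
  obtain ⟨t, hts, hto, hxt⟩ := mem_nhds_iff.1 hs
  obtain ⟨χ, hχ, hχ1, hχs⟩ := exists_smooth_bump (I := I) (hto.mem_nhds hxt)
  refine ⟨χ • FiberBundle.extend E v,
    ContMDiffOn.smul_section_of_tsupport hχ.contMDiffOn hto hχs (hsm.mono hts), ?_⟩
  simp [hχ1.self_of_nhds]

/-- The derivative of a chart is injective and linear functionals separate points of E. Each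
functional of the chart is globalized by a bump function. -/
theorem eq_of_forall_mfderiv_eq {x : M} {v w : TangentSpace I x}
    (h : ∀ k : M → ℝ, ContMDiff I 𝓘(ℝ, ℝ) ∞ k →
      mfderiv I 𝓘(ℝ, ℝ) k x v = mfderiv I 𝓘(ℝ, ℝ) k x w) : v = w := by
  have hinj : Function.Injective (mfderiv I 𝓘(ℝ, E) (extChartAt I x) x) := by
    have := isInvertible_mfderiv_extChartAt (I := I) (mem_extChartAt_source (I := I) x)
    exact this.injective
  apply hinj
  apply (SeparatingDual.eq_iff_forall_dual_eq (R := ℝ) (V := E)).2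
  intro φ
  have hsm : ContMDiffOn I 𝓘(ℝ, ℝ) ∞ (fun y => φ (extChartAt I x y)) (extChartAt I x).source := by
    rw [extChartAt_source]
    exact φ.contMDiff.comp_contMDiffOn contMDiffOn_extChartAt
  obtain ⟨k, hk, hke⟩ := exists_contMDiff_eventuallyEq (isOpen_extChartAt_source x)
    (mem_extChartAt_source (I := I) x) hsm
  have key : mfderiv I 𝓘(ℝ, ℝ) k x = (mfderiv 𝓘(ℝ, E) 𝓘(ℝ, ℝ) φ (extChartAt I x x)).comp
      (mfderiv I 𝓘(ℝ, E) (extChartAt I x) x) := by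
    rw [hke.mfderiv_eq]
    exact mfderiv_comp x φ.mdifferentiableAt (mdifferentiableAt_extChartAt (mem_chart_source H x))
  have := h k hk
  rw [key] at this
  simpa using! this

/-- This is read off from the Jacobi identity for X, Y and hZ, with Z a field not vanishing at x:
after Leibniz expansion and subtraction of h times the identity for X, Y, Z, only a multiple of Z(x)
is left, whose coefficient is the difference of the two sides. -/
theorem dirDeriv_mlieBracket {X Y : VField I M} (hX : IsSmoothField I X) (hY : IsSmoothField I Y)
    {h : M → ℝ} (hh : ContMDiff I 𝓘(ℝ, ℝ) ∞ h) (x : M) :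
    dirDeriv (VectorField.mlieBracket I X Y) h x =
      dirDeriv X (dirDeriv Y h) x - dirDeriv Y (dirDeriv X h) x := by
  have : CompleteSpace E := FiniteDimensional.complete ℝ E
  have h2 : IsManifold I 2 M :=
    IsManifold.of_le (I := I) (M := M) (m := 2) (n := ∞) (ofNat_le_infty _)
  have h3 : IsManifold I (minSmoothness ℝ 3) M := by
    simpa using IsManifold.of_le (I := I) (M := M) (m := 3) (n := ∞) (ofNat_le_infty _)
  -- In dimension zero there is no nonvanishing Z, but every derivative is zero.
  rcases subsingleton_or_nontrivial E with hE | hE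
  · have : ∀ v : TangentSpace I x, v = 0 := fun v => Subsingleton.elim (α := E) v 0
    simp only [dirDeriv]
    rw [this (VectorField.mlieBracket I X Y x), this (X x), this (Y x)]
    exact ((sub_self (0 : ℝ)).symm.trans (congrArg₂ (· - ·)
      (map_zero (mfderiv I 𝓘(ℝ, ℝ) (dirDeriv Y h) x)).symm
      (map_zero (mfderiv I 𝓘(ℝ, ℝ) (dirDeriv X h) x)).symm)) ▸ map_zero (mfderiv I 𝓘(ℝ, ℝ) h x)
  obtain ⟨v, hv⟩ : ∃ v : TangentSpace I x, v ≠ 0 := exists_ne (α := E) 0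
  obtain ⟨Z, hZ, hZx⟩ := exists_isSmoothField_apply_eq x v
  have two : ∀ {A : VField I M}, IsSmoothField I A → ContMDiffAt I I.tangent (minSmoothness ℝ 2)
      (fun x => (⟨x, A x⟩ : TangentBundle I M)) x := fun hA => by
    simpa using! (hA x).of_le (n := ∞) (m := 2) (ofNat_le_infty _)
  have jac := VectorField.leibniz_identity_mlieBracket_apply (two hX) (two hY) (two (hZ.smul hh))
  have jac' := VectorField.leibniz_identity_mlieBracket_apply (two hX) (two hY) (two hZ)
  have rule : ∀ {A C : VField I M} (_ : IsSmoothField I C) {k : M → ℝ}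
      (_ : ContMDiff I 𝓘(ℝ, ℝ) ∞ k), VectorField.mlieBracket I A (k • C) =
        dirDeriv A k • C + k • VectorField.mlieBracket I A C := by
    intro A C hC k hk
    funext y
    exact VectorField.mlieBracket_smul_right (hk.mdiffAt y) (hC.mdiffAt y)
  have addr : ∀ {A C D : VField I M} (_ : IsSmoothField I C) (_ : IsSmoothField I D),
      VectorField.mlieBracket I A (C + D) =
        VectorField.mlieBracket I A C + VectorField.mlieBracket I A D := by
    intro A C D hC hD
    funext y
    exact VectorField.mlieBracket_add_right (hC.mdiffAt y) (hD.mdiffAt y)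
  have hXh := hX.contMDiff_dirDeriv hh
  have hYh := hY.contMDiff_dirDeriv hh
  rw [rule hZ hh, rule hZ hh, rule hZ hh, addr (hZ.smul hYh) ((hY.mlieBracket hZ).smul hh),
    addr (hZ.smul hXh) ((hX.mlieBracket hZ).smul hh), rule hZ hYh, rule hZ hXh,
    rule (hY.mlieBracket hZ) hh, rule (hX.mlieBracket hZ) hh] at jac
  simp only [Pi.add_apply, Pi.smul_apply', jac', hZx] at jac
  have key : (dirDeriv (VectorField.mlieBracket I X Y) h x -
      (dirDeriv X (dirDeriv Y h) x - dirDeriv Y (dirDeriv X h) x)) • v = 0 := by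
    rw [← sub_eq_zero] at jac
    rw [← neg_eq_zero, ← jac]
    module
  exact sub_eq_zero.1 ((smul_eq_zero.1 key).resolve_right hv)

theorem exists_isSmoothField_linearIndependent (x : M) :
    ∃ e : Fin (Module.finrank ℝ E) → VField I M, (∀ i, IsSmoothField I (e i)) ∧
      LinearIndependent ℝ (fun i => e i x) := by
  let b : Module.Basis (Fin (Module.finrank ℝ E)) ℝ (TangentSpace I x) := Module.finBasis ℝ E
  choose e he hex using fun i => exists_isSmoothField_apply_eq x (b i)
  refine ⟨e, he, ?_⟩
  simp only [hex]
  exact b.linearIndependent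

/-- Smooth fields that form a basis at a point generate the smooth fields near this point. -/
theorem exists_smooth_coeff {ι : Type*} [Fintype ι] {e : ι → VField I M} {x : M}
    (he : ∀ i, IsSmoothField I (e i)) (hli : LinearIndependent ℝ (fun i => e i x))
    (hcard : Fintype.card ι = Module.finrank ℝ E) {X : VField I M} (hX : IsSmoothField I X) :
    ∃ a : ι → M → ℝ, (∀ i, ContMDiff I 𝓘(ℝ, ℝ) ∞ (a i)) ∧ X =ᶠ[𝓝 x] (∑ i, a i • e i : VField I M) := by
  classical
  rcases isEmpty_or_nonempty ι with hι | hι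
  · have : Subsingleton E := by
      rw [← Module.finrank_zero_iff (R := ℝ), ← hcard, Fintype.card_eq_zero]
    exact ⟨fun _ _ => 0, fun i => contMDiff_const,
      Filter.Eventually.of_forall fun y => Subsingleton.elim (α := E) _ _⟩
  have : FiniteDimensional ℝ (TangentSpace I x) := ‹FiniteDimensional ℝ E›
  let t := trivializationAt E (TangentSpace I : M → Type _) x
  have hxt : x ∈ t.baseSet := FiberBundle.mem_baseSet_trivializationAt' x
  let b₀ : Module.Basis ι ℝ (TangentSpace I x) :=
    basisOfLinearIndependentOfCardEqFinrank hli hcard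
  -- The basis of the model space is transported from e(x), so that the matrix `A` of e in the local
  -- frame is the identity at x.
  let b : Module.Basis ι ℝ E := b₀.map (t.linearEquivAt ℝ x hxt)
  have hone : IsManifold I (∞ + 1) M := ‹IsManifold I ∞ M›
  have hbun : ContMDiffVectorBundle ∞ E (TangentSpace I : M → Type _) I := inferInstance
  let c : ι → (y : M) → TangentSpace I y →ₗ[ℝ] ℝ := t.localFrameCoeff I b
  have hc : ∀ {Z : VField I M}, IsSmoothField I Z → ∀ i,
      ContMDiffOn I 𝓘(ℝ, ℝ) ∞ (fun y => c i y (Z y)) t.baseSet := fun hZ i =>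
    contMDiffOn_baseSet_localFrameCoeff b (ContMDiff.contMDiffOn hZ) i
  let A : M → Matrix ι ι ℝ := fun y => Matrix.of fun k i => c k y (e i y)
  have hA : ∀ k i, ContMDiffOn I 𝓘(ℝ, ℝ) ∞ (fun y => A y k i) t.baseSet := fun k i => hc (he i) k
  have hAx : A x = 1 := by
    ext k i
    have h1 : e i x = b₀ i := congrFun
      (coe_basisOfLinearIndependentOfCardEqFinrank hli hcard).symm i
    have h2 : c k x (e i x) = (t.basisAt b hxt).repr (e i x) k :=
      t.localFrameCoeff_apply_of_mem_baseSet b hxt (e i) k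
    have h3 : t.basisAt b hxt = b₀ := by
      ext j
      exact (t.linearEquivAt ℝ x hxt).symm_apply_apply (b₀ j)
    have h4 : A x k i = b₀.repr (b₀ i) k := by rw [← h1, ← h3]; exact h2
    rw [h4, Module.Basis.repr_self, Matrix.one_apply, Finsupp.single_apply]
    simp only [eq_comm]
  have hdet : ContMDiffOn I 𝓘(ℝ, ℝ) ∞ (fun y => (A y).det) t.baseSet := fun y hy =>
    contMDiffWithinAt_det fun i j => hA i j y hy
  let U : Set M := t.baseSet ∩ (fun y => (A y).det) ⁻¹' {0}ᶜ
  have hU : IsOpen U := hdet.continuousOn.isOpen_inter_preimage t.open_baseSet isOpen_compl_singleton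
  have hxU : x ∈ U := ⟨hxt, by simp [hAx]⟩
  -- The coefficients solve the linear system with matrix `A` and right-hand side the local
  -- components of X. On `U` the inverse matrix is smooth.
  have hcoef : ∀ i, ContMDiffOn I 𝓘(ℝ, ℝ) ∞ (fun y => ∑ k, (A y)⁻¹ i k * c k y (X y)) U := by
    intro i y hy
    refine contMDiffWithinAt_finsetSum fun k _ => ?_
    exact (contMDiffWithinAt_matrix_inv (fun i j => (hA i j y hy.1).mono Set.inter_subset_left)
      hy.2 i k).mul ((hc hX k y hy.1).mono Set.inter_subset_left)
  choose a ha hae using fun i => exists_contMDiff_eventuallyEq hU hxU (hcoef i)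
  refine ⟨a, ha, ?_⟩
  filter_upwards [Filter.eventually_all.2 hae, hU.mem_nhds hxU] with y hy hyU
  have hdet' : IsUnit (A y).det := isUnit_iff_ne_zero.2 hyU.2
  have hsum : ∀ Z : VField I M, Z y = ∑ i, c i y (Z y) • t.localFrame b i y := fun Z =>
    t.eq_sum_localFrameCoeff_smul (I := I) (b := b) hyU.1
  refine (hsum X).trans (Eq.trans ?_ (hsum (∑ i, a i • e i)).symm)
  refine Finset.sum_congr rfl fun k _ => ?_
  congr 1
  have h1 : c k y ((∑ i, a i • e i) y) = (A y).mulVec (fun i => a i y) k := by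
    simp [Matrix.mulVec, dotProduct, A, Finset.sum_apply, mul_comm]
  have h2 : (fun i => a i y) = (A y)⁻¹.mulVec (fun k => c k y (X y)) := by
    funext i
    rw [hy i]
    simp [Matrix.mulVec, dotProduct]
  rw [h1, h2, Matrix.mulVec_mulVec, Matrix.mul_nonsing_inv _ hdet', Matrix.one_mulVec]

end Calculus

/-! ### Algebra of the Koszul form. -/

section Koszul

variable {E : Type*} [NormedAddCommGroup E] [NormedSpace ℝ E]
  {H : Type*} [TopologicalSpace H] {I : ModelWithCorners ℝ E H}
  {M : Type*} [TopologicalSpace M] [ChartedSpace H M]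
  {g : MetricField I M}

theorem pairing_add_left (X X' Y : VField I M) :
    pairing g (X + X') Y = fun x => pairing g X Y x + pairing g X' Y x := by
  funext x
  simp [pairing]

theorem pairing_add_right (X Y Y' : VField I M) :
    pairing g X (Y + Y') = fun x => pairing g X Y x + pairing g X Y' x := by
  funext x
  simp [pairing]

theorem pairing_smul_left (a : M → ℝ) (X Y : VField I M) :
    pairing g (a • X) Y = fun x => a x * pairing g X Y x := by
  funext x
  simp [pairing]

theorem pairing_smul_right (a : M → ℝ) (X Y : VField I M) :
    pairing g X (a • Y) = fun x => a x * pairing g X Y x := by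
  funext x
  simp [pairing]

theorem pairing_congr {X X' Y Y' : VField I M} {x : M} (hX : X x = X' x) (hY : Y x = Y' x) :
    pairing g X Y x = pairing g X' Y' x := by
  simp [pairing, hX, hY]

theorem pairing_eventuallyEq {X X' Y Y' : VField I M} {x : M} (hX : X =ᶠ[𝓝 x] X')
    (hY : Y =ᶠ[𝓝 x] Y') : pairing g X Y =ᶠ[𝓝 x] pairing g X' Y' := by
  filter_upwards [hX, hY] with y h1 h2 using pairing_congr h1 h2

theorem koszul_congr {X X' Y Y' Z Z' : VField I M} {x : M} (hX : X =ᶠ[𝓝 x] X')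
    (hY : Y =ᶠ[𝓝 x] Y') (hZ : Z =ᶠ[𝓝 x] Z') : koszul g X Y Z x = koszul g X' Y' Z' x := by
  have hX' := hX.self_of_nhds
  have hY' := hY.self_of_nhds
  have hZ' := hZ.self_of_nhds
  simp only [koszul]
  rw [dirDeriv_congr hX' (pairing_eventuallyEq hY hZ),
    dirDeriv_congr hY' (pairing_eventuallyEq hZ hX),
    dirDeriv_congr hZ' (pairing_eventuallyEq hX hY),
    pairing_congr hX' (hY.mlieBracket_vectorField_eq hZ),
    pairing_congr hY' (hZ.mlieBracket_vectorField_eq hX),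
    pairing_congr hZ' (hX.mlieBracket_vectorField_eq hY)]

variable [IsManifold I ∞ M]

theorem IsSingularMetric.pairing_comm (hg : IsSingularMetric g) (X Y : VField I M) :
    pairing g X Y = pairing g Y X :=
  funext fun x => hg.symm x _ _

theorem IsSingularMetric.mdiffAt (hg : IsSingularMetric g) {X Y : VField I M}
    (hX : IsSmoothField I X) (hY : IsSmoothField I Y) (x : M) :
    MDifferentiableAt I 𝓘(ℝ, ℝ) (pairing g X Y) x :=
  (hg.smooth X Y hX hY).mdiffAt x

/-- The Koszul form is metric. -/
theorem IsSingularMetric.dirDeriv_pairing (hg : IsSingularMetric g) (X Y Z : VField I M) (x : M) :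
    dirDeriv X (pairing g Y Z) x = koszul g X Y Z x + koszul g X Z Y x := by
  simp only [koszul]
  rw [hg.pairing_comm Z X, hg.pairing_comm Y X, hg.pairing_comm Z Y]
  have h : ∀ A B C : VField I M, pairing g A (VectorField.mlieBracket I B C) x =
      - pairing g A (VectorField.mlieBracket I C B) x := by
    intro A B C
    simp only [pairing]
    rw [VectorField.mlieBracket_swap_apply, map_neg]
  rw [h X Z Y, h Z Y X, h Y X Z]
  ring

/-- The Koszul form is torsion-free. -/
theorem IsSingularMetric.koszul_swap (hg : IsSingularMetric g) (X Y Z : VField I M) (x : M) :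
    koszul g X Y Z x = koszul g Y X Z x + pairing g (VectorField.mlieBracket I X Y) Z x := by
  simp only [koszul]
  rw [hg.pairing_comm Z X, hg.pairing_comm Y X, hg.pairing_comm Z Y,
    hg.pairing_comm (VectorField.mlieBracket I X Y)]
  have h : ∀ A B C : VField I M, pairing g A (VectorField.mlieBracket I B C) x =
      - pairing g A (VectorField.mlieBracket I C B) x := by
    intro A B C
    simp only [pairing]
    rw [VectorField.mlieBracket_swap_apply, map_neg]
  rw [h X Z Y, h Z Y X, h Y X Z]
  ring

variable [FiniteDimensional ℝ E]

theorem IsSingularMetric.contMDiff_koszul (hg : IsSingularMetric g) {X Y Z : VField I M}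
    (hX : IsSmoothField I X) (hY : IsSmoothField I Y) (hZ : IsSmoothField I Z) :
    ContMDiff I 𝓘(ℝ, ℝ) ∞ (koszul g X Y Z) :=
  contMDiff_const.mul ((((((hX.contMDiff_dirDeriv (hg.smooth Y Z hY hZ)).add
    (hY.contMDiff_dirDeriv (hg.smooth Z X hZ hX))).sub
    (hZ.contMDiff_dirDeriv (hg.smooth X Y hX hY))).sub
    (hg.smooth _ _ hX (hY.mlieBracket hZ))).add
    (hg.smooth _ _ hY (hZ.mlieBracket hX))).add
    (hg.smooth _ _ hZ (hX.mlieBracket hY)))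

/-- The Z(a) terms from Z(g(X,aY)) and from [aY,Z] cancel, while the two X(a) terms add up. This is
the only Leibniz rule expanded from the definition; the other two slots reduce to it. -/
theorem IsSingularMetric.koszul_smul_middle (hg : IsSingularMetric g) {X Y Z : VField I M}
    (hX : IsSmoothField I X) (hY : IsSmoothField I Y) (hZ : IsSmoothField I Z) {a : M → ℝ}
    (ha : ContMDiff I 𝓘(ℝ, ℝ) ∞ a) (x : M) :
    koszul g X (a • Y) Z x = a x * koszul g X Y Z x + dirDeriv X a x * pairing g Y Z x := by
  have : CompleteSpace E := FiniteDimensional.complete ℝ E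
  have h2 : IsManifold I 2 M := IsManifold.of_le (I := I) (M := M) (n := ∞) (ofNat_le_infty _)
  have b1 : VectorField.mlieBracket I (a • Y) Z x =
      - dirDeriv Z a x • Y x + a x • VectorField.mlieBracket I Y Z x :=
    VectorField.mlieBracket_smul_left (ha.mdiffAt x) (hY.mdiffAt x)
  have b2 : VectorField.mlieBracket I X (a • Y) x =
      dirDeriv X a x • Y x + a x • VectorField.mlieBracket I X Y x :=
    VectorField.mlieBracket_smul_right (ha.mdiffAt x) (hY.mdiffAt x)
  have p1 : pairing g X (VectorField.mlieBracket I (a • Y) Z) x =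
      - dirDeriv Z a x * pairing g X Y x +
        a x * pairing g X (VectorField.mlieBracket I Y Z) x := by
    simp only [pairing, b1, map_add, map_smul, smul_eq_mul]
  have p2 : pairing g Z (VectorField.mlieBracket I X (a • Y)) x =
      dirDeriv X a x * pairing g Z Y x +
        a x * pairing g Z (VectorField.mlieBracket I X Y) x := by
    simp only [pairing, b2, map_add, map_smul, smul_eq_mul]
  simp only [koszul]
  rw [p1, p2, pairing_smul_left, pairing_smul_left, pairing_smul_right, dirDeriv_smul_field,
    dirDeriv_mul X (ha.mdiffAt x) (hg.mdiffAt hY hZ x),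
    dirDeriv_mul Z (ha.mdiffAt x) (hg.mdiffAt hX hY x), hg.pairing_comm Z Y]
  ring

theorem IsSingularMetric.koszul_add_middle (hg : IsSingularMetric g) {X Y Y' Z : VField I M}
    (hX : IsSmoothField I X) (hY : IsSmoothField I Y) (hY' : IsSmoothField I Y')
    (hZ : IsSmoothField I Z) (x : M) :
    koszul g X (Y + Y') Z x = koszul g X Y Z x + koszul g X Y' Z x := by
  have : CompleteSpace E := FiniteDimensional.complete ℝ E
  have h2 : IsManifold I 2 M := IsManifold.of_le (I := I) (M := M) (n := ∞) (ofNat_le_infty _)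
  have p1 : pairing g X (VectorField.mlieBracket I (Y + Y') Z) x =
      pairing g X (VectorField.mlieBracket I Y Z) x +
        pairing g X (VectorField.mlieBracket I Y' Z) x := by
    simp only [pairing]
    rw [VectorField.mlieBracket_add_left (hY.mdiffAt x) (hY'.mdiffAt x), map_add]
  have p2 : pairing g Z (VectorField.mlieBracket I X (Y + Y')) x =
      pairing g Z (VectorField.mlieBracket I X Y) x +
        pairing g Z (VectorField.mlieBracket I X Y') x := by
    simp only [pairing]
    rw [VectorField.mlieBracket_add_right (hY.mdiffAt x) (hY'.mdiffAt x), map_add]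
  simp only [koszul]
  rw [p1, p2, pairing_add_left, pairing_add_left, pairing_add_right, dirDeriv_add_field,
    dirDeriv_add X (hg.mdiffAt hY hZ x) (hg.mdiffAt hY' hZ x),
    dirDeriv_add Z (hg.mdiffAt hX hY x) (hg.mdiffAt hX hY' x)]
  ring

/-- Metricity exchanges the last two slots, and the term X(a) g(Y,Z) of the middle slot is absorbed
by the derivative of g(Y,aZ). -/
theorem IsSingularMetric.koszul_smul_right (hg : IsSingularMetric g) {X Y Z : VField I M}
    (hX : IsSmoothField I X) (hY : IsSmoothField I Y) (hZ : IsSmoothField I Z) {a : M → ℝ}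
    (ha : ContMDiff I 𝓘(ℝ, ℝ) ∞ a) (x : M) :
    koszul g X Y (a • Z) x = a x * koszul g X Y Z x := by
  have h1 := hg.dirDeriv_pairing X Y (a • Z) x
  have h2 := hg.dirDeriv_pairing X Y Z x
  rw [pairing_smul_right, dirDeriv_mul X (ha.mdiffAt x) (hg.mdiffAt hY hZ x),
    hg.koszul_smul_middle hX hZ hY ha, hg.pairing_comm Z Y] at h1
  linear_combination -h1 + a x * h2

theorem IsSingularMetric.koszul_add_right (hg : IsSingularMetric g) {X Y Z Z' : VField I M}
    (hX : IsSmoothField I X) (hY : IsSmoothField I Y) (hZ : IsSmoothField I Z)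
    (hZ' : IsSmoothField I Z') (x : M) :
    koszul g X Y (Z + Z') x = koszul g X Y Z x + koszul g X Y Z' x := by
  have h1 := hg.dirDeriv_pairing X Y (Z + Z') x
  have h2 := hg.dirDeriv_pairing X Y Z x
  have h3 := hg.dirDeriv_pairing X Y Z' x
  rw [pairing_add_right, dirDeriv_add X (hg.mdiffAt hY hZ x) (hg.mdiffAt hY hZ' x),
    hg.koszul_add_middle hX hZ hZ' hY] at h1
  linear_combination -h1 + h2 + h3

/-- Torsion-freeness exchanges the first two slots, and the Y(a) term of the middle slot cancels the
one in [aX,Y]. -/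
theorem IsSingularMetric.koszul_smul_left (hg : IsSingularMetric g) {X Y Z : VField I M}
    (hX : IsSmoothField I X) (hY : IsSmoothField I Y) (hZ : IsSmoothField I Z) {a : M → ℝ}
    (ha : ContMDiff I 𝓘(ℝ, ℝ) ∞ a) (x : M) :
    koszul g (a • X) Y Z x = a x * koszul g X Y Z x := by
  have : CompleteSpace E := FiniteDimensional.complete ℝ E
  have h2 : IsManifold I 2 M := IsManifold.of_le (I := I) (M := M) (n := ∞) (ofNat_le_infty _)
  have b1 : VectorField.mlieBracket I (a • X) Y x =
      - dirDeriv Y a x • X x + a x • VectorField.mlieBracket I X Y x :=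
    VectorField.mlieBracket_smul_left (ha.mdiffAt x) (hX.mdiffAt x)
  have p1 : pairing g (VectorField.mlieBracket I (a • X) Y) Z x =
      - dirDeriv Y a x * pairing g X Z x +
        a x * pairing g (VectorField.mlieBracket I X Y) Z x := by
    simp only [pairing, b1, map_add, map_smul, smul_eq_mul, LinearMap.add_apply,
      LinearMap.smul_apply]
  rw [hg.koszul_swap (a • X), p1, hg.koszul_smul_middle hY hX hZ ha, hg.koszul_swap X]
  ring

theorem IsSingularMetric.koszul_add_left (hg : IsSingularMetric g) {X X' Y Z : VField I M}
    (hX : IsSmoothField I X) (hX' : IsSmoothField I X') (hY : IsSmoothField I Y)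
    (hZ : IsSmoothField I Z) (x : M) :
    koszul g (X + X') Y Z x = koszul g X Y Z x + koszul g X' Y Z x := by
  have : CompleteSpace E := FiniteDimensional.complete ℝ E
  have h2 : IsManifold I 2 M := IsManifold.of_le (I := I) (M := M) (n := ∞) (ofNat_le_infty _)
  have p1 : pairing g (VectorField.mlieBracket I (X + X') Y) Z x =
      pairing g (VectorField.mlieBracket I X Y) Z x +
        pairing g (VectorField.mlieBracket I X' Y) Z x := by
    simp only [pairing]
    rw [VectorField.mlieBracket_add_left (hX.mdiffAt x) (hX'.mdiffAt x), map_add,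
      LinearMap.add_apply]
  rw [hg.koszul_swap (X + X'), p1, hg.koszul_add_middle hY hX hX' hZ, hg.koszul_swap X,
    hg.koszul_swap X']
  ring

theorem IsSingularMetric.koszul_zero_left (hg : IsSingularMetric g) {Y W : VField I M}
    (hY : IsSmoothField I Y) (hW : IsSmoothField I W) (x : M) : koszul g 0 Y W x = 0 := by
  have := hg.koszul_smul_left (X := 0) isSmoothField_zero hY hW (a := 0) contMDiff_const x
  simpa using this

theorem IsSingularMetric.koszul_zero_middle (hg : IsSingularMetric g) {X W : VField I M}
    (hX : IsSmoothField I X) (hW : IsSmoothField I W) (x : M) : koszul g X 0 W x = 0 := by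
  have := hg.koszul_smul_middle (Y := 0) hX isSmoothField_zero hW (a := 0) contMDiff_const x
  simpa [pairing] using this

theorem IsSingularMetric.koszul_lin_left (hg : IsSingularMetric g) {X X₁ X₂ Y W : VField I M}
    (hX₁ : IsSmoothField I X₁) (hX₂ : IsSmoothField I X₂) (hY : IsSmoothField I Y)
    (hW : IsSmoothField I W) {a₁ a₂ : M → ℝ} (ha₁ : ContMDiff I 𝓘(ℝ, ℝ) ∞ a₁)
    (ha₂ : ContMDiff I 𝓘(ℝ, ℝ) ∞ a₂) {x : M} (hX : X =ᶠ[𝓝 x] (a₁ • X₁ + a₂ • X₂ : VField I M)) :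
    koszul g X Y W x = a₁ x * koszul g X₁ Y W x + a₂ x * koszul g X₂ Y W x := by
  have h : koszul g X Y W x = koszul g (a₁ • X₁ + a₂ • X₂) Y W x :=
    koszul_congr hX (Filter.EventuallyEq.refl _ _) (Filter.EventuallyEq.refl _ _)
  rw [h, hg.koszul_add_left (hX₁.smul ha₁) (hX₂.smul ha₂) hY hW, hg.koszul_smul_left hX₁ hY hW ha₁,
    hg.koszul_smul_left hX₂ hY hW ha₂]

end Koszul

/-! ### Representatives of covectors and the inner product on the image of the flat map. -/

section Flat

variable {E : Type*} [NormedAddCommGroup E] [NormedSpace ℝ E]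
  {H : Type*} [TopologicalSpace H] {I : ModelWithCorners ℝ E H}
  {M : Type*} [TopologicalSpace M] [ChartedSpace H M] [IsManifold I ∞ M]
  {g : MetricField I M} {θ θ' θ₁ θ₂ τ : OneForm I M} {x : M} {u v : TangentSpace I x}

theorem isFlatAt_pairing (g : MetricField I M) (Y : VField I M) (x : M) :
    IsFlatAt g (pairing g Y) x (Y x) := fun _ _ => rfl

theorem IsFlatAt.lin {x : M} {u₁ u₂ : TangentSpace I x} (h₁ : IsFlatAt g θ₁ x u₁)
    (h₂ : IsFlatAt g θ₂ x u₂) {a b : ℝ}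
    (hθ : ∀ W : VField I M, IsSmoothField I W → θ W x = a * θ₁ W x + b * θ₂ W x) :
    IsFlatAt g θ x (a • u₁ + b • u₂) := fun W hW => by
  simp [hθ W hW, h₁ W hW, h₂ W hW]

theorem IsSingularMetric.isRadicalAnnihilator_pairing (hg : IsSingularMetric g) {Y : VField I M}
    (hY : IsSmoothField I Y) : IsRadicalAnnihilator g (pairing g Y) :=
  ⟨fun Z hZ => hg.smooth Y Z hY hZ, fun x => ⟨_, isFlatAt_pairing g Y x⟩⟩

theorem IsRadicalAnnihilator.apply_lin (hθ : IsRadicalAnnihilator g θ) {X X₁ X₂ : VField I M}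
    (hX : IsSmoothField I X) (hX₁ : IsSmoothField I X₁) (hX₂ : IsSmoothField I X₂) {x : M}
    {a b : ℝ} (h : X x = a • X₁ x + b • X₂ x) : θ X x = a * θ X₁ x + b * θ X₂ x := by
  obtain ⟨u, hu⟩ := hθ.2 x
  rw [hu X hX, hu X₁ hX₁, hu X₂ hX₂, h]
  simp

theorem IsRadicalAnnihilator.apply_zero (hθ : IsRadicalAnnihilator g θ) (x : M) :
    θ 0 x = 0 := by
  obtain ⟨u, hu⟩ := hθ.2 x
  simp [hu 0 isSmoothField_zero]

variable [FiniteDimensional ℝ E] [T2Space M]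

theorem IsFlatAt.eq_of_isFlatAt (h : IsFlatAt g θ x u) (h' : IsFlatAt g θ x v) : g x u = g x v := by
  ext w
  obtain ⟨Z, hZ, rfl⟩ := exists_isSmoothField_apply_eq x w
  rw [← h Z hZ, ← h' Z hZ]

/-- Two representatives of a covector have the same image under the flat map; symmetry of g carries
this to the second argument, so the chosen pair may be replaced by any other. -/
theorem IsSingularMetric.coInner_eq (hg : IsSingularMetric g) (hu : IsFlatAt g θ x u)
    (hv : IsFlatAt g τ x v) : coInner g θ τ x = g x u v := by
  have h : ∃ uv : TangentSpace I x × TangentSpace I x,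
      IsFlatAt g θ x uv.1 ∧ IsFlatAt g τ x uv.2 := ⟨(u, v), hu, hv⟩
  rw [coInner, dif_pos h, h.choose_spec.1.eq_of_isFlatAt hu, hg.symm,
    h.choose_spec.2.eq_of_isFlatAt hv, hg.symm]

end Flat

/-! ### Bases of the range of a linear map. -/

section LinearMapRange

variable {V W : Type*} [AddCommGroup V] [Module ℝ V] [FiniteDimensional ℝ V]
  [AddCommGroup W] [Module ℝ W]

theorem exists_linearIndependent_comp (φ : V →ₗ[ℝ] W) :
    ∃ e : Fin (Module.finrank ℝ (LinearMap.range φ)) → V,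
      LinearIndependent ℝ (fun i => φ (e i)) ∧
        ∀ u, ∃ c : Fin (Module.finrank ℝ (LinearMap.range φ)) → ℝ, φ u = ∑ i, c i • φ (e i) := by
  let b := Module.finBasis ℝ (LinearMap.range φ)
  choose e he using fun i => (b i).2
  refine ⟨e, ?_, fun u => ⟨b.repr ⟨φ u, u, rfl⟩, ?_⟩⟩
  · simp only [he]
    exact b.linearIndependent.map' (LinearMap.range φ).subtype (Submodule.ker_subtype _)
  · have := congrArg Subtype.val (b.sum_repr ⟨φ u, u, rfl⟩)
    rw [Submodule.coe_sum] at this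
    simp only [he]
    exact this.symm

theorem card_le_finrank_range {ι : Type*} [Fintype ι] {φ : V →ₗ[ℝ] W} {e : ι → V}
    (h : LinearIndependent ℝ (fun i => φ (e i))) :
    Fintype.card ι ≤ Module.finrank ℝ (LinearMap.range φ) := by
  have h' : LinearIndependent ℝ (fun i => (⟨φ (e i), e i, rfl⟩ : LinearMap.range φ)) :=
    LinearIndependent.of_comp (LinearMap.range φ).subtype h
  exact h'.fintype_card_le_finrank

theorem exists_eq_sum_of_card_eq_finrank_range {ι : Type*} [Fintype ι] {φ : V →ₗ[ℝ] W} {e : ι → V}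
    (h : LinearIndependent ℝ (fun i => φ (e i)))
    (hcard : Fintype.card ι = Module.finrank ℝ (LinearMap.range φ)) (u : V) :
    ∃ c : ι → ℝ, ∑ i, c i • φ (e i) = φ u := by
  have h' : LinearIndependent ℝ (fun i => (⟨φ (e i), e i, rfl⟩ : LinearMap.range φ)) :=
    LinearIndependent.of_comp (LinearMap.range φ).subtype h
  have hu : (⟨φ u, u, rfl⟩ : LinearMap.range φ) ∈ Submodule.span ℝ
      (Set.range (fun i => (⟨φ (e i), e i, rfl⟩ : LinearMap.range φ))) := by
    rw [h'.span_eq_top_of_card_eq_finrank' hcard]; trivial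
  obtain ⟨c, hc⟩ := (Submodule.mem_span_range_iff_exists_fun ℝ).1 hu
  exact ⟨c, by simpa using congrArg Subtype.val hc⟩

end LinearMapRange

/-! ### Gram matrices of degenerate symmetric forms. -/

section Gram

variable {V : Type*} [AddCommGroup V] [Module ℝ V] {ι : Type*}

/-- The Gram matrix of a family of vectors. -/
def gramMatrix (β : LinearMap.BilinForm ℝ V) (e : ι → V) : Matrix ι ι ℝ :=
  Matrix.of fun i j => β (e i) (e j)

theorem linearIndependent_of_gramMatrix [Fintype ι] [DecidableEq ι] {β : LinearMap.BilinForm ℝ V}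
    {e : ι → V} (hdet : (gramMatrix β e).det ≠ 0) : LinearIndependent ℝ (fun i => β (e i)) := by
  rw [Fintype.linearIndependent_iff]
  intro c hc
  refine congrFun (Matrix.eq_zero_of_vecMul_eq_zero hdet ?_)
  funext j
  have := congrArg (fun φ => φ (e j)) hc
  simpa [Matrix.vecMul, dotProduct, gramMatrix] using this

variable [FiniteDimensional ℝ V]

/-- The vectors are chosen so that their flat images form a basis of the range of β. A combination
killed by the Gram matrix is orthogonal to all of them, hence by symmetry lies in the radical, and
independence of the flat images makes it trivial. -/
theorem exists_gramMatrix_det_ne_zero {β : LinearMap.BilinForm ℝ V} (hβ : ∀ u v, β u v = β v u) :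
    ∃ e : Fin (Module.finrank ℝ (LinearMap.range β)) → V, (gramMatrix β e).det ≠ 0 := by
  obtain ⟨e, hli, hspan⟩ := exists_linearIndependent_comp β
  refine ⟨e, fun hdet => ?_⟩
  obtain ⟨c, hc, hc0⟩ := Matrix.exists_mulVec_eq_zero_iff.2 hdet
  set w := ∑ j, c j • e j with hw
  have h1 : ∀ i, β (e i) w = 0 := fun i => by
    have := congrFun hc0 i
    simpa [hw, Matrix.mulVec, dotProduct, gramMatrix, mul_comm] using this
  have h3 : β w = 0 := by
    ext u
    obtain ⟨d, hd⟩ := hspan u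
    rw [hβ, hd]
    simp [h1]
  have h4 : ∑ j, c j • β (e j) = 0 := by
    rw [← h3, hw]
    simp
  exact hc (funext fun j => Fintype.linearIndependent_iff.1 hli c h4 j)

/-- The flat images of e span the range because there are as many as the rank. Expanding β(u,·) in
them and testing on e determines the coefficients through the inverse Gram matrix. Only the values
of β(u,·) and β(v,·) on e enter, so the formula depends smoothly on covectors. -/
theorem apply_eq_sum_gramMatrix_inv [Fintype ι] [DecidableEq ι] {β : LinearMap.BilinForm ℝ V}
    {e : ι → V} (hβ : ∀ u v, β u v = β v u) (hdet : (gramMatrix β e).det ≠ 0)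
    (hcard : Fintype.card ι = Module.finrank ℝ (LinearMap.range β)) (u v : V) :
    β u v = ∑ i, ∑ j, β u (e j) * (gramMatrix β e)⁻¹ j i * β v (e i) := by
  obtain ⟨c, hc⟩ := exists_eq_sum_of_card_eq_finrank_range
    (linearIndependent_of_gramMatrix hdet) hcard u
  have hc' : ∀ w, β u w = ∑ i, c i * β (e i) w := fun w => by
    rw [← hc]
    simp
  have hcv : c = Matrix.vecMul (fun j => β u (e j)) (gramMatrix β e)⁻¹ := by
    have h1 : (fun j => β u (e j)) = Matrix.vecMul c (gramMatrix β e) := by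
      funext j
      rw [hc' (e j)]
      simp [Matrix.vecMul, dotProduct, gramMatrix]
    rw [h1, Matrix.vecMul_vecMul, Matrix.mul_nonsing_inv _ (isUnit_iff_ne_zero.2 hdet),
      Matrix.vecMul_one]
  rw [hc' v]
  refine Finset.sum_congr rfl fun i _ => ?_
  rw [hβ (e i) v, ← Finset.sum_mul]
  congr 1
  rw [congrFun hcv i]
  simp [Matrix.vecMul, dotProduct]

end Gram

/-! ### The region of constant signature: density and smoothness of the inner product. -/

section Regular

variable {E : Type*} [NormedAddCommGroup E] [NormedSpace ℝ E] [FiniteDimensional ℝ E]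
  {H : Type*} [TopologicalSpace H] {I : ModelWithCorners ℝ E H}
  {M : Type*} [TopologicalSpace M] [ChartedSpace H M]

theorem metricRank_le (g : MetricField I M) (x : M) : metricRank g x ≤ Module.finrank ℝ E := by
  have : FiniteDimensional ℝ (TangentSpace I x) := ‹FiniteDimensional ℝ E›
  exact LinearMap.finrank_range_le (g x)

variable [IsManifold I ∞ M] [T2Space M] {g : MetricField I M} {θ τ : OneForm I M}

/-- Near a point, `g` has a nonsingular Gram matrix of size its rank at that point. -/
theorem IsSingularMetric.exists_gramMatrix (hg : IsSingularMetric g) (x : M) :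
    ∃ e : Fin (metricRank g x) → VField I M, (∀ i, IsSmoothField I (e i)) ∧
      (∀ i j, ContMDiff I 𝓘(ℝ, ℝ) ∞ (fun y => gramMatrix (g y) (fun k => e k y) i j)) ∧
      ∀ᶠ y in 𝓝 x, (gramMatrix (g y) (fun k => e k y)).det ≠ 0 := by
  have : FiniteDimensional ℝ (TangentSpace I x) := ‹FiniteDimensional ℝ E›
  obtain ⟨v, hv⟩ := exists_gramMatrix_det_ne_zero (hg.symm x)
  choose e he hex using fun i => exists_isSmoothField_apply_eq x (v i)
  have hsm : ∀ i j, ContMDiff I 𝓘(ℝ, ℝ) ∞ (fun y => gramMatrix (g y) (fun k => e k y) i j) :=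
    fun i j => hg.smooth _ _ (he i) (he j)
  refine ⟨e, he, hsm, ?_⟩
  have hc : ContinuousAt (fun y => (gramMatrix (g y) (fun k => e k y)).det) x := by
    have : ContMDiffWithinAt I 𝓘(ℝ, ℝ) ∞
        (fun y => (gramMatrix (g y) (fun k => e k y)).det) Set.univ x :=
      contMDiffWithinAt_det fun i j => (hsm i j).contMDiffAt.contMDiffWithinAt
    exact (contMDiffWithinAt_univ.1 this).continuousAt
  apply hc.eventually_ne
  simpa only [hex] using! hv

/-- A nonzero Gram determinant persists nearby and bounds the rank from below. -/
theorem IsSingularMetric.eventually_metricRank_le (hg : IsSingularMetric g) (x : M) :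
    ∀ᶠ y in 𝓝 x, metricRank g x ≤ metricRank g y := by
  obtain ⟨e, -, -, h⟩ := hg.exists_gramMatrix x
  filter_upwards [h] with y hy
  have : FiniteDimensional ℝ (TangentSpace I y) := ‹FiniteDimensional ℝ E›
  simpa using! card_le_finrank_range (linearIndependent_of_gramMatrix hy)

/-- The rank is bounded, so it attains a maximum on each nonempty open set; by lower semicontinuity
it is constant near a point where the maximum is attained. -/
theorem IsSingularMetric.dense_regularSet (hg : IsSingularMetric g) : Dense (regularSet g) := by
  rw [dense_iff_inter_open]
  intro U hU ⟨x, hx⟩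
  have hne : (metricRank g '' U).Nonempty := ⟨_, x, hx, rfl⟩
  have hbdd : BddAbove (metricRank g '' U) :=
    ⟨Module.finrank ℝ E, by rintro _ ⟨y, -, rfl⟩; exact metricRank_le g y⟩
  obtain ⟨y, hyU, hy⟩ := Nat.sSup_mem hne hbdd
  refine ⟨y, hyU, ?_⟩
  filter_upwards [hg.eventually_metricRank_le y, hU.mem_nhds hyU] with z hz hzU
  exact le_antisymm (hy ▸ le_csSup hbdd ⟨z, hzU, rfl⟩) hz

/-- Near a regular point the rank keeps the size of the Gram matrix, so the inverse Gram matrix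
expresses the inner product through smooth functions. -/
theorem IsSingularMetric.contMDiffAt_coInner (hg : IsSingularMetric g)
    (hθ : IsRadicalAnnihilator g θ) (hτ : IsRadicalAnnihilator g τ) {x : M}
    (hx : x ∈ regularSet g) : ContMDiffAt I 𝓘(ℝ, ℝ) ∞ (coInner g θ τ) x := by
  obtain ⟨e, he, hsm, h⟩ := hg.exists_gramMatrix x
  have key : coInner g θ τ =ᶠ[𝓝 x] fun y => ∑ i, ∑ j,
      θ (e j) y * (gramMatrix (g y) (fun k => e k y))⁻¹ j i * τ (e i) y := by
    filter_upwards [h, hx] with y hy hxy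
    have : FiniteDimensional ℝ (TangentSpace I y) := ‹FiniteDimensional ℝ E›
    obtain ⟨u, hu⟩ := hθ.2 y
    obtain ⟨v, hv⟩ := hτ.2 y
    rw [hg.coInner_eq hu hv, apply_eq_sum_gramMatrix_inv (hg.symm y) hy (by simpa using! hxy.symm)]
    simp only [hu _ (he _), hv _ (he _)]
  refine ContMDiffAt.congr_of_eventuallyEq ?_ key
  rw [← contMDiffWithinAt_univ]
  refine contMDiffWithinAt_finsetSum fun i _ => contMDiffWithinAt_finsetSum fun j _ => ?_
  exact ((hθ.1 _ (he j) x).contMDiffWithinAt.mul (contMDiffWithinAt_matrix_inv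
    (fun i j => (hsm i j x).contMDiffWithinAt) h.self_of_nhds j i)).mul
    (hτ.1 _ (he i) x).contMDiffWithinAt

/-- The covariant derivative, computed from a continuous extension of the inner product. -/
theorem IsSingularMetric.covDeriv_eq (hg : IsSingularMetric g) {κ : TernaryForm I M}
    {Z T : VField I M} {S : M → ℝ} {x : M}
    (hc : ContinuousAt (dirDeriv Z (θ T)) x) (hS : ContinuousAt S x)
    (h : ∀ᶠ y in 𝓝 x, y ∈ regularSet g → coInner g (κ Z T) θ y = S y) :
    covDeriv g κ Z θ T x = dirDeriv Z (θ T) x - S x := by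
  refine extendFrom_eq (hg.dense_regularSet x) ?_
  refine Filter.Tendsto.congr' ?_ ((hc.sub hS).tendsto.mono_left nhdsWithin_le_nhds)
  filter_upwards [nhdsWithin_le_nhds h, self_mem_nhdsWithin] with y hy hyr
  rw [hy hyr, Pi.sub_apply]

end Regular

/-! ### Testing semi-regularity on a local frame. -/

section Regularity

variable {E : Type*} [NormedAddCommGroup E] [NormedSpace ℝ E] [FiniteDimensional ℝ E]
  {H : Type*} [TopologicalSpace H] {I : ModelWithCorners ℝ E H}
  {M : Type*} [TopologicalSpace M] [ChartedSpace H M] [IsManifold I ∞ M] [T2Space M]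

/-- A property of smooth fields that is stable under local linear combinations with smooth
coefficients holds for all smooth fields if it holds for a local frame. -/
theorem smoothField_induction {ι : Type*} [Fintype ι] {e : ι → VField I M} {p : M}
    (he : ∀ i, IsSmoothField I (e i)) (hli : LinearIndependent ℝ (fun i => e i p))
    (hcard : Fintype.card ι = Module.finrank ℝ E) {Pr : VField I M → Prop}
    (hlin : ∀ (X X₁ X₂ : VField I M) (a₁ a₂ : M → ℝ), IsSmoothField I X → IsSmoothField I X₁ →
      IsSmoothField I X₂ → ContMDiff I 𝓘(ℝ, ℝ) ∞ a₁ → ContMDiff I 𝓘(ℝ, ℝ) ∞ a₂ →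
      X =ᶠ[𝓝 p] (a₁ • X₁ + a₂ • X₂ : VField I M) → Pr X₁ → Pr X₂ → Pr X)
    (h0 : Pr 0) (hbase : ∀ i, Pr (e i)) {X : VField I M} (hX : IsSmoothField I X) : Pr X := by
  classical
  obtain ⟨a, ha, hXe⟩ := exists_smooth_coeff he hli hcard hX
  have hone : ContMDiff I 𝓘(ℝ, ℝ) ∞ (1 : M → ℝ) := contMDiff_const
  have hzero : ContMDiff I 𝓘(ℝ, ℝ) ∞ (0 : M → ℝ) := contMDiff_const
  have hsum : ∀ s : Finset ι, IsSmoothField I (∑ i ∈ s, a i • e i) := fun s =>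
    IsSmoothField.sum fun i _ => (he i).smul (ha i)
  have key : ∀ s : Finset ι, Pr (∑ i ∈ s, a i • e i) := by
    intro s
    induction s using Finset.induction_on with
    | empty => simpa using h0
    | insert i s hi ih =>
      refine hlin _ (e i) (∑ i ∈ s, a i • e i) (a i) 1 (hsum _) (he i) (hsum _) (ha i) hone ?_
        (hbase i) ih
      rw [Finset.sum_insert hi, one_smul]
      exact Filter.EventuallyEq.refl _ _
  -- X agrees with the sum only near p, so stability is used once more, with coefficients 1 and 0.
  refine hlin _ _ 0 1 0 hX (hsum Finset.univ) isSmoothField_zero hone hzero ?_ (key _) h0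
  simpa using! hXe

variable {g : MetricField I M} {θ θ₁ θ₂ τ : OneForm I M}

theorem IsSingularMetric.coInner_comm (hg : IsSingularMetric g) {x : M}
    (hθ : ∃ u, IsFlatAt g θ x u) (hτ : ∃ v, IsFlatAt g τ x v) :
    coInner g θ τ x = coInner g τ θ x := by
  obtain ⟨u, hu⟩ := hθ
  obtain ⟨v, hv⟩ := hτ
  rw [hg.coInner_eq hu hv, hg.coInner_eq hv hu, hg.symm]

theorem IsSingularMetric.coInner_lin_left (hg : IsSingularMetric g) {x : M}
    (h₁ : ∃ u, IsFlatAt g θ₁ x u) (h₂ : ∃ u, IsFlatAt g θ₂ x u) (hτ : ∃ v, IsFlatAt g τ x v)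
    {a b : ℝ} (hθ : ∀ W : VField I M, IsSmoothField I W → θ W x = a * θ₁ W x + b * θ₂ W x) :
    coInner g θ τ x = a * coInner g θ₁ τ x + b * coInner g θ₂ τ x := by
  obtain ⟨u₁, h₁⟩ := h₁
  obtain ⟨u₂, h₂⟩ := h₂
  obtain ⟨v, hv⟩ := hτ
  rw [hg.coInner_eq (h₁.lin h₂ hθ) hv, hg.coInner_eq h₁ hv, hg.coInner_eq h₂ hv]
  simp

theorem IsSingularMetric.coInner_lin_right (hg : IsSingularMetric g) {x : M}
    (h₁ : ∃ u, IsFlatAt g θ₁ x u) (h₂ : ∃ u, IsFlatAt g θ₂ x u) (hτ : ∃ v, IsFlatAt g τ x v)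
    {a b : ℝ} (hθ : ∀ W : VField I M, IsSmoothField I W → θ W x = a * θ₁ W x + b * θ₂ W x) :
    coInner g τ θ x = a * coInner g τ θ₁ x + b * coInner g τ θ₂ x := by
  have hθ' : ∃ u, IsFlatAt g θ x u := by
    obtain ⟨u₁, h₁⟩ := h₁
    obtain ⟨u₂, h₂⟩ := h₂
    exact ⟨_, h₁.lin h₂ hθ⟩
  rw [hg.coInner_comm hτ hθ', hg.coInner_comm hτ h₁, hg.coInner_comm hτ h₂,
    hg.coInner_lin_left h₁ h₂ hτ hθ]

/-- The covector g(Y,·) is represented by Y itself. This evaluation rule makes every correction by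
`P` and every Leibniz term smooth. -/
theorem IsSingularMetric.coInner_pairing_left (hg : IsSingularMetric g) {x : M} {Y : VField I M}
    (hY : IsSmoothField I Y) (hτ : ∃ v, IsFlatAt g τ x v) :
    coInner g (pairing g Y) τ x = τ Y x := by
  obtain ⟨v, hv⟩ := hτ
  rw [hg.coInner_eq (isFlatAt_pairing g Y x) hv, hv Y hY, hg.symm]

theorem IsSingularMetric.coInner_pairing_right (hg : IsSingularMetric g) {x : M} {Y : VField I M}
    (hY : IsSmoothField I Y) (hτ : ∃ v, IsFlatAt g τ x v) :
    coInner g τ (pairing g Y) x = τ Y x := by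
  rw [hg.coInner_comm hτ ⟨_, isFlatAt_pairing g Y x⟩, hg.coInner_pairing_left hY hτ]

theorem IsSingularMetric.koszul_lin_right (hg : IsSingularMetric g) {X Y W W₁ W₂ : VField I M}
    (hX : IsSmoothField I X) (hY : IsSmoothField I Y) (hW₁ : IsSmoothField I W₁)
    (hW₂ : IsSmoothField I W₂) {a₁ a₂ : M → ℝ} (ha₁ : ContMDiff I 𝓘(ℝ, ℝ) ∞ a₁)
    (ha₂ : ContMDiff I 𝓘(ℝ, ℝ) ∞ a₂) {x : M}
    (hW : W =ᶠ[𝓝 x] (a₁ • W₁ + a₂ • W₂ : VField I M)) :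
    koszul g X Y W x = a₁ x * koszul g X Y W₁ x + a₂ x * koszul g X Y W₂ x := by
  have h : koszul g X Y W x = koszul g X Y (a₁ • W₁ + a₂ • W₂) x :=
    koszul_congr (Filter.EventuallyEq.refl _ _) (Filter.EventuallyEq.refl _ _) hW
  rw [h, hg.koszul_add_right hX hY (hW₁.smul ha₁) (hW₂.smul ha₂),
    hg.koszul_smul_right hX hY hW₁ ha₁, hg.koszul_smul_right hX hY hW₂ ha₂]

theorem IsSingularMetric.isFlatAt_koszul_of_frame (hg : IsSingularMetric g) {ι : Type*} [Fintype ι]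
    {e : ι → VField I M} {p : M} (he : ∀ i, IsSmoothField I (e i))
    (hli : LinearIndependent ℝ (fun i => e i p)) (hcard : Fintype.card ι = Module.finrank ℝ E)
    {X Y : VField I M} (hX : IsSmoothField I X) (hY : IsSmoothField I Y) {u : TangentSpace I p}
    (h : ∀ i, koszul g X Y (e i) p = g p u (e i p)) : IsFlatAt g (koszul g X Y) p u := by
  intro W hW
  refine smoothField_induction he hli hcard (Pr := fun W => koszul g X Y W p = g p u (W p))
    ?_ ?_ h hW
  · intro W W₁ W₂ a₁ a₂ _ hW₁ hW₂ ha₁ ha₂ hWe h₁ h₂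
    have hWp : W p = a₁ p • W₁ p + a₂ p • W₂ p := hWe.self_of_nhds
    rw [hg.koszul_lin_right hX hY hW₁ hW₂ ha₁ ha₂ hWe, h₁, h₂, hWp]
    simp
  · have := hg.koszul_smul_right (Z := 0) hX hY isSmoothField_zero (a := 0) contMDiff_const p
    simpa using this

/-- Near `p`, the inner product `⟪⟪∇^♭_Z T, θ⟫⟫` extends smoothly from the regular set, and the
resulting value of `(∇_Z θ)(T)` at `p` is `g(u, T)`. -/
def HasCovDerivAt (g : MetricField I M) (Z : VField I M) (θ : OneForm I M) (p : M)
    (u : TangentSpace I p) (T : VField I M) : Prop :=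
  ∃ S : M → ℝ, ContMDiff I 𝓘(ℝ, ℝ) ∞ S ∧
    (∀ᶠ x in 𝓝 p, x ∈ regularSet g → coInner g (koszul g Z T) θ x = S x) ∧
    dirDeriv Z (θ T) p - S p = g p u (T p)

variable {p : M}

/-- Replacing T by aT adds Z(a) θ(T) both to Z(θ(T)) and to the inner product, so the difference is
tensorial in T and the representative u is unchanged. -/
theorem HasCovDerivAt.lin_right (hg : IsSingularMetric g)
    (hlow : ∀ X Y : VField I M, IsSmoothField I X → IsSmoothField I Y →
      IsRadicalAnnihilator g (koszul g X Y))
    (hθ : IsRadicalAnnihilator g θ) {Z : VField I M} (hZ : IsSmoothField I Z)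
    {u : TangentSpace I p} {T T₁ T₂ : VField I M} {a₁ a₂ : M → ℝ}
    (hT : IsSmoothField I T) (hT₁ : IsSmoothField I T₁) (hT₂ : IsSmoothField I T₂)
    (ha₁ : ContMDiff I 𝓘(ℝ, ℝ) ∞ a₁) (ha₂ : ContMDiff I 𝓘(ℝ, ℝ) ∞ a₂)
    (hTe : T =ᶠ[𝓝 p] (a₁ • T₁ + a₂ • T₂ : VField I M)) (h₁ : HasCovDerivAt g Z θ p u T₁)
    (h₂ : HasCovDerivAt g Z θ p u T₂) : HasCovDerivAt g Z θ p u T := by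
  obtain ⟨S₁, hS₁, hc₁, hu₁⟩ := h₁
  obtain ⟨S₂, hS₂, hc₂, hu₂⟩ := h₂
  have hZa₁ := hZ.contMDiff_dirDeriv ha₁
  have hZa₂ := hZ.contMDiff_dirDeriv ha₂
  refine ⟨fun x => (a₁ x * S₁ x + dirDeriv Z a₁ x * θ T₁ x) +
    (a₂ x * S₂ x + dirDeriv Z a₂ x * θ T₂ x), ?_, ?_, ?_⟩
  · exact ((ha₁.mul hS₁).add (hZa₁.mul (hθ.1 _ hT₁))).add
      ((ha₂.mul hS₂).add (hZa₂.mul (hθ.1 _ hT₂)))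
  · filter_upwards [hc₁, hc₂, hTe.eventuallyEq_nhds] with x h1 h2 hx hxr
    have e₁ : coInner g (koszul g Z (a₁ • T₁)) θ x = a₁ x * S₁ x + dirDeriv Z a₁ x * θ T₁ x := by
      rw [hg.coInner_lin_left ((hlow Z T₁ hZ hT₁).2 x) ⟨_, isFlatAt_pairing g T₁ x⟩ (hθ.2 x)
        (fun W hW => hg.koszul_smul_middle hZ hT₁ hW ha₁ x), h1 hxr,
        hg.coInner_pairing_left hT₁ (hθ.2 x)]
    have e₂ : coInner g (koszul g Z (a₂ • T₂)) θ x = a₂ x * S₂ x + dirDeriv Z a₂ x * θ T₂ x := by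
      rw [hg.coInner_lin_left ((hlow Z T₂ hZ hT₂).2 x) ⟨_, isFlatAt_pairing g T₂ x⟩ (hθ.2 x)
        (fun W hW => hg.koszul_smul_middle hZ hT₂ hW ha₂ x), h2 hxr,
        hg.coInner_pairing_left hT₂ (hθ.2 x)]
    rw [← e₁, ← e₂]
    have := hg.coInner_lin_left (θ := koszul g Z T) (a := 1) (b := 1)
      ((hlow Z _ hZ (hT₁.smul ha₁)).2 x) ((hlow Z _ hZ (hT₂.smul ha₂)).2 x) (hθ.2 x)
      (fun W hW => by
        have h : koszul g Z T W x = koszul g Z (a₁ • T₁ + a₂ • T₂) W x :=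
          koszul_congr (Filter.EventuallyEq.refl _ _) hx (Filter.EventuallyEq.refl _ _)
        rw [h, hg.koszul_add_middle hZ (hT₁.smul ha₁) (hT₂.smul ha₂) hW, one_mul, one_mul])
    rw [this, one_mul, one_mul]
  · have hθT : θ T =ᶠ[𝓝 p] fun x => a₁ x * θ T₁ x + a₂ x * θ T₂ x := by
      filter_upwards [hTe] with x hx
      exact hθ.apply_lin hT hT₁ hT₂ hx
    have hd₁ := (hθ.1 _ hT₁).mdiffAt p
    have hd₂ := (hθ.1 _ hT₂).mdiffAt p
    have hm₁ : MDifferentiableAt I 𝓘(ℝ, ℝ) (fun x => a₁ x * θ T₁ x) p := (ha₁.mdiffAt p).mul hd₁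
    have hm₂ : MDifferentiableAt I 𝓘(ℝ, ℝ) (fun x => a₂ x * θ T₂ x) p := (ha₂.mdiffAt p).mul hd₂
    rw [dirDeriv_congr rfl hθT, dirDeriv_add Z hm₁ hm₂,
      dirDeriv_mul Z (ha₁.mdiffAt p) hd₁, dirDeriv_mul Z (ha₂.mdiffAt p) hd₂]
    have hTp : T p = a₁ p • T₁ p + a₂ p • T₂ p := hTe.self_of_nhds
    rw [hTp, map_add, map_smul, map_smul, ← hu₁, ← hu₂]
    simp only [smul_eq_mul]
    ring

theorem HasCovDerivAt.zero_right (hg : IsSingularMetric g)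
    (hθ : IsRadicalAnnihilator g θ) {Z : VField I M} (hZ : IsSmoothField I Z)
    (u : TangentSpace I p) : HasCovDerivAt g Z θ p u 0 := by
  refine ⟨fun _ => 0, contMDiff_const, Filter.Eventually.of_forall fun x _ => ?_, ?_⟩
  · have := hg.coInner_lin_left (θ := koszul g Z 0) (a := 0) (b := 0)
      ⟨_, isFlatAt_pairing g 0 x⟩ ⟨_, isFlatAt_pairing g 0 x⟩ (hθ.2 x)
      (fun W hW => by simp [hg.koszul_zero_middle hZ hW])
    simpa using this
  · have h0 : θ 0 = fun _ => 0 := funext fun x => hθ.apply_zero x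
    rw [h0, dirDeriv_const]
    simp

/-- `∇_Z θ` is defined at `p`, and its value there lies in the image of the flat map. -/
def IsCovRegularAt (g : MetricField I M) (Z : VField I M) (θ : OneForm I M) (p : M) : Prop :=
  ∃ u : TangentSpace I p, ∀ T : VField I M, IsSmoothField I T → HasCovDerivAt g Z θ p u T

/-- Leibniz rule in the form: aθ contributes a u + Z(a) w, where u represents ∇_Z θ and w represents
θ. -/
theorem IsCovRegularAt.lin_form (hg : IsSingularMetric g)
    (hlow : ∀ X Y : VField I M, IsSmoothField I X → IsSmoothField I Y →
      IsRadicalAnnihilator g (koszul g X Y))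
    (hθ₁ : IsRadicalAnnihilator g θ₁) (hθ₂ : IsRadicalAnnihilator g θ₂) {Z : VField I M}
    (hZ : IsSmoothField I Z) {a₁ a₂ : M → ℝ} (ha₁ : ContMDiff I 𝓘(ℝ, ℝ) ∞ a₁)
    (ha₂ : ContMDiff I 𝓘(ℝ, ℝ) ∞ a₂)
    (hθ : ∀ᶠ x in 𝓝 p, ∀ W : VField I M, IsSmoothField I W →
      θ W x = a₁ x * θ₁ W x + a₂ x * θ₂ W x)
    (h₁ : IsCovRegularAt g Z θ₁ p) (h₂ : IsCovRegularAt g Z θ₂ p) : IsCovRegularAt g Z θ p := by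
  obtain ⟨u₁, h₁⟩ := h₁
  obtain ⟨u₂, h₂⟩ := h₂
  obtain ⟨w₁, hw₁⟩ := hθ₁.2 p
  obtain ⟨w₂, hw₂⟩ := hθ₂.2 p
  refine ⟨(a₁ p • u₁ + dirDeriv Z a₁ p • w₁) + (a₂ p • u₂ + dirDeriv Z a₂ p • w₂),
    fun T hT => ?_⟩
  obtain ⟨S₁, hS₁, hc₁, hu₁⟩ := h₁ T hT
  obtain ⟨S₂, hS₂, hc₂, hu₂⟩ := h₂ T hT
  refine ⟨fun x => a₁ x * S₁ x + a₂ x * S₂ x, (ha₁.mul hS₁).add (ha₂.mul hS₂), ?_, ?_⟩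
  · filter_upwards [hc₁, hc₂, hθ] with x h1 h2 hx hxr
    rw [hg.coInner_lin_right (hθ₁.2 x) (hθ₂.2 x) ((hlow Z T hZ hT).2 x) hx, h1 hxr, h2 hxr]
  · have hθT : θ T =ᶠ[𝓝 p] fun x => a₁ x * θ₁ T x + a₂ x * θ₂ T x := by
      filter_upwards [hθ] with x hx using hx T hT
    have hd₁ := (hθ₁.1 _ hT).mdiffAt p
    have hd₂ := (hθ₂.1 _ hT).mdiffAt p
    have hm₁ : MDifferentiableAt I 𝓘(ℝ, ℝ) (fun x => a₁ x * θ₁ T x) p := (ha₁.mdiffAt p).mul hd₁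
    have hm₂ : MDifferentiableAt I 𝓘(ℝ, ℝ) (fun x => a₂ x * θ₂ T x) p := (ha₂.mdiffAt p).mul hd₂
    rw [dirDeriv_congr rfl hθT, dirDeriv_add Z hm₁ hm₂,
      dirDeriv_mul Z (ha₁.mdiffAt p) hd₁, dirDeriv_mul Z (ha₂.mdiffAt p) hd₂, hw₁ T hT, hw₂ T hT]
    simp only [map_add, map_smul, LinearMap.add_apply, LinearMap.smul_apply, smul_eq_mul,
      ← hu₁, ← hu₂]
    ring

theorem IsCovRegularAt.lin_field (hg : IsSingularMetric g)
    (hlow : ∀ X Y : VField I M, IsSmoothField I X → IsSmoothField I Y →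
      IsRadicalAnnihilator g (koszul g X Y))
    (hθ : IsRadicalAnnihilator g θ) {Z Z₁ Z₂ : VField I M}
    (hZ₁ : IsSmoothField I Z₁) (hZ₂ : IsSmoothField I Z₂)
    {a₁ a₂ : M → ℝ} (ha₁ : ContMDiff I 𝓘(ℝ, ℝ) ∞ a₁) (ha₂ : ContMDiff I 𝓘(ℝ, ℝ) ∞ a₂)
    (hZe : Z =ᶠ[𝓝 p] (a₁ • Z₁ + a₂ • Z₂ : VField I M))
    (h₁ : IsCovRegularAt g Z₁ θ p) (h₂ : IsCovRegularAt g Z₂ θ p) : IsCovRegularAt g Z θ p := by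
  obtain ⟨u₁, h₁⟩ := h₁
  obtain ⟨u₂, h₂⟩ := h₂
  refine ⟨a₁ p • u₁ + a₂ p • u₂, fun T hT => ?_⟩
  obtain ⟨S₁, hS₁, hc₁, hu₁⟩ := h₁ T hT
  obtain ⟨S₂, hS₂, hc₂, hu₂⟩ := h₂ T hT
  refine ⟨fun x => a₁ x * S₁ x + a₂ x * S₂ x, (ha₁.mul hS₁).add (ha₂.mul hS₂), ?_, ?_⟩
  · filter_upwards [hc₁, hc₂, hZe.eventuallyEq_nhds] with x h1 h2 hx hxr
    rw [hg.coInner_lin_left ((hlow Z₁ T hZ₁ hT).2 x) ((hlow Z₂ T hZ₂ hT).2 x) (hθ.2 x)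
      (fun W hW => hg.koszul_lin_left hZ₁ hZ₂ hT hW ha₁ ha₂ hx), h1 hxr, h2 hxr]
  · rw [dirDeriv_congr hZe.self_of_nhds (Filter.EventuallyEq.refl _ _), dirDeriv_add_field,
      dirDeriv_smul_field, dirDeriv_smul_field]
    simp only [map_add, map_smul, LinearMap.add_apply, LinearMap.smul_apply, smul_eq_mul,
      ← hu₁, ← hu₂]
    ring

theorem IsCovRegularAt.zero_field (hg : IsSingularMetric g) (hθ : IsRadicalAnnihilator g θ) :
    IsCovRegularAt g 0 θ p := by
  refine ⟨0, fun T hT => ⟨fun _ => 0, contMDiff_const,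
    Filter.Eventually.of_forall fun x _ => ?_, ?_⟩⟩
  · have := hg.coInner_lin_left (θ := koszul g 0 T) (a := 0) (b := 0)
      ⟨_, isFlatAt_pairing g 0 x⟩ ⟨_, isFlatAt_pairing g 0 x⟩ (hθ.2 x)
      (fun W hW => by simp [hg.koszul_zero_left hT hW])
    simpa using this
  · have h0 : dirDeriv (0 : VField I M) (θ T) p = 0 := map_zero (mfderiv I 𝓘(ℝ, ℝ) (θ T) p)
    simp [h0]

/-- By metricity ∇_Z g(Y,·) = ∇^♭_Z Y, so the lowered field itself supplies the representative. -/
theorem isCovRegularAt_pairing (hg : IsSingularMetric g)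
    (hlow : ∀ X Y : VField I M, IsSmoothField I X → IsSmoothField I Y →
      IsRadicalAnnihilator g (koszul g X Y)) {Z Y : VField I M} (hZ : IsSmoothField I Z)
    (hY : IsSmoothField I Y) : IsCovRegularAt g Z (pairing g Y) p := by
  obtain ⟨u, hu⟩ := (hlow Z Y hZ hY).2 p
  refine ⟨u, fun T hT => ⟨koszul g Z T Y, hg.contMDiff_koszul hZ hT hY,
    Filter.Eventually.of_forall fun x _ => ?_, ?_⟩⟩
  · exact hg.coInner_pairing_right hY ((hlow Z T hZ hT).2 x)
  · rw [hg.dirDeriv_pairing, ← hu T hT]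
    ring

/-- Semi-regularity, tested on a local frame at each point. -/
theorem IsSingularMetric.isSemiRegular_of_frame (hg : IsSingularMetric g) {ι : Type*} [Fintype ι]
    (hcard : Fintype.card ι = Module.finrank ℝ E)
    (h : ∀ p : M, ∃ e : ι → VField I M, (∀ i, IsSmoothField I (e i)) ∧
      LinearIndependent ℝ (fun i => e i p) ∧
      (∀ i j, ∃ u, IsFlatAt g (koszul g (e i) (e j)) p u) ∧
      ∀ i j k, ∃ u, ∀ l, HasCovDerivAt g (e k) (koszul g (e i) (e j)) p u (e l)) :
    IsSemiRegular g := by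
  have hlow : ∀ X Y : VField I M, IsSmoothField I X → IsSmoothField I Y →
      IsRadicalAnnihilator g (koszul g X Y) := by
    intro X Y hX hY
    refine ⟨fun Z hZ => hg.contMDiff_koszul hX hY hZ, fun p => ?_⟩
    obtain ⟨e, he, hli, hflat, -⟩ := h p
    have left : ∀ {Y : VField I M}, IsSmoothField I Y →
        (∀ i, ∃ u, IsFlatAt g (koszul g (e i) Y) p u) → ∀ {X : VField I M}, IsSmoothField I X →
        ∃ u, IsFlatAt g (koszul g X Y) p u := by
      intro Y hY hb X hX
      refine smoothField_induction he hli hcard (Pr := fun X => ∃ u, IsFlatAt g (koszul g X Y) p u)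
        ?_ ⟨0, fun W hW => by simp [hg.koszul_zero_left hY hW]⟩ hb hX
      rintro X X₁ X₂ a₁ a₂ - hX₁ hX₂ ha₁ ha₂ hXe ⟨u₁, h₁⟩ ⟨u₂, h₂⟩
      exact ⟨_, h₁.lin h₂ fun W hW => hg.koszul_lin_left hX₁ hX₂ hY hW ha₁ ha₂ hXe⟩
    -- The second slot is moved to the first by torsion-freeness, at the price of the covector
    -- g([e_i,Y],·), which is always in the image of the flat map.
    refine left hY (fun i => ?_) hX
    obtain ⟨u, hu⟩ := left (he i) (fun j => hflat j i) hY
    exact ⟨_, hu.lin (a := 1) (b := 1) (isFlatAt_pairing g (VectorField.mlieBracket I (e i) Y) p)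
      fun W _ => by rw [hg.koszul_swap, one_mul, one_mul]⟩
  have hreg : ∀ X Y Z : VField I M, IsSmoothField I X → IsSmoothField I Y → IsSmoothField I Z →
      ∀ p, IsCovRegularAt g Z (koszul g X Y) p := by
    intro X Y Z hX hY hZ p
    obtain ⟨e, he, hli, -, hcov⟩ := h p
    have frame : ∀ i j k, IsCovRegularAt g (e k) (koszul g (e i) (e j)) p := by
      intro i j k
      obtain ⟨u, hu⟩ := hcov i j k
      refine ⟨u, fun T hT => ?_⟩
      refine smoothField_induction he hli hcard ?_
        (HasCovDerivAt.zero_right hg (hlow _ _ (he i) (he j)) (he k) u) hu hT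
      intro T T₁ T₂ a₁ a₂ hT hT₁ hT₂ ha₁ ha₂ hTe h₁ h₂
      exact HasCovDerivAt.lin_right hg hlow (hlow _ _ (he i) (he j)) (he k) hT hT₁ hT₂ ha₁ ha₂
        hTe h₁ h₂
    have field : ∀ i j, IsCovRegularAt g Z (koszul g (e i) (e j)) p := by
      intro i j
      have hθ := hlow _ _ (he i) (he j)
      refine smoothField_induction he hli hcard
        (Pr := fun Z => IsCovRegularAt g Z (koszul g (e i) (e j)) p) ?_
        (IsCovRegularAt.zero_field hg hθ) (frame i j) hZ
      intro Z Z₁ Z₂ a₁ a₂ _ hZ₁ hZ₂ ha₁ ha₂ hZe h₁ h₂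
      exact IsCovRegularAt.lin_field hg hlow hθ hZ₁ hZ₂ ha₁ ha₂ hZe h₁ h₂
    have hone : ContMDiff I 𝓘(ℝ, ℝ) ∞ (fun _ : M => (1 : ℝ)) := contMDiff_const
    have hzero : ContMDiff I 𝓘(ℝ, ℝ) ∞ (fun _ : M => (0 : ℝ)) := contMDiff_const
    have left : ∀ {Y : VField I M}, IsSmoothField I Y →
        (∀ i, IsCovRegularAt g Z (koszul g (e i) Y) p) → ∀ {X : VField I M}, IsSmoothField I X →
        IsCovRegularAt g Z (koszul g X Y) p := by
      intro Y hY hb X hX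
      have h0 : IsRadicalAnnihilator g (pairing g 0) :=
        hg.isRadicalAnnihilator_pairing isSmoothField_zero
      have h0' : IsCovRegularAt g Z (pairing g 0) p :=
        isCovRegularAt_pairing hg hlow hZ isSmoothField_zero
      refine smoothField_induction he hli hcard
        (Pr := fun X => IsCovRegularAt g Z (koszul g X Y) p) ?_
        -- The zero form ∇^♭_0 Y is written as 0 g(0,·) + 0 g(0,·), so that the rule for
        -- combinations of forms applies.
        (IsCovRegularAt.lin_form hg hlow h0 h0 hZ hzero hzero
          (Filter.Eventually.of_forall fun x W hW => by simp [hg.koszul_zero_left hY hW]) h0' h0')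
        hb hX
      intro X X₁ X₂ a₁ a₂ _ hX₁ hX₂ ha₁ ha₂ hXe h₁ h₂
      refine IsCovRegularAt.lin_form hg hlow (hlow _ _ hX₁ hY) (hlow _ _ hX₂ hY) hZ ha₁ ha₂ ?_ h₁ h₂
      filter_upwards [hXe.eventuallyEq_nhds] with x hx W hW
      exact hg.koszul_lin_left hX₁ hX₂ hY hW ha₁ ha₂ hx
    -- Torsion-freeness again reduces the second slot to the first; the error term g([e_i,Y],·) has
    -- a covariant derivative by metricity.
    refine left hY (fun i => ?_) hX
    have hbr := (he i).mlieBracket hY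
    refine IsCovRegularAt.lin_form hg hlow (hlow _ _ hY (he i))
      (hg.isRadicalAnnihilator_pairing hbr) hZ hone hone
      (Filter.Eventually.of_forall fun x W _ => ?_) (left (he i) (fun j => field j i) hY)
      (isCovRegularAt_pairing hg hlow hZ hbr)
    rw [hg.koszul_swap, one_mul, one_mul]
  refine ⟨hg, hlow, fun X Y Z hX hY hZ => ⟨fun T hT p => ?_, fun p => ?_⟩⟩
  · obtain ⟨u, hu⟩ := hreg X Y Z hX hY hZ p
    obtain ⟨S, hS, hc, -⟩ := hu T hT
    have hd := hZ.contMDiff_dirDeriv ((hlow X Y hX hY).1 T hT)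
    refine ((hd p).sub (hS p)).congr_of_eventuallyEq ?_
    -- Smoothness at p requires the formula at all nearby points, each of which needs its own
    -- neighbourhood to take the limit.
    filter_upwards [eventually_eventually_nhds.2 hc] with x hx
    exact hg.covDeriv_eq hd.continuous.continuousAt hS.continuous.continuousAt hx
  · obtain ⟨u, hu⟩ := hreg X Y Z hX hY hZ p
    refine ⟨u, fun T hT => ?_⟩
    obtain ⟨S, hS, hc, hu⟩ := hu T hT
    have hd := hZ.contMDiff_dirDeriv ((hlow X Y hX hY).1 T hT)
    rw [hg.covDeriv_eq hd.continuous.continuousAt hS.continuous.continuousAt hc, hu]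

end Regularity

/-! ### Comparison of the semi-symmetric non-metric derivative with the metric one. -/

section SemiSymmetric

variable {E : Type*} [NormedAddCommGroup E] [NormedSpace ℝ E] [FiniteDimensional ℝ E]
  {H : Type*} [TopologicalSpace H] {I : ModelWithCorners ℝ E H}
  {M : Type*} [TopologicalSpace M] [ChartedSpace H M] [IsManifold I ∞ M] [T2Space M]
  {g : MetricField I M}

/-- The extension of `⟪⟪∇^♭_Z T, ∇^♭_X Y⟫⟫` from the regular set of a semi-regular manifold. -/
def coInnerExt (g : MetricField I M) (Z T X Y : VField I M) : M → ℝ := fun x =>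
  dirDeriv Z (koszul g X Y T) x - covDeriv g (koszul g) Z (koszul g X Y) T x

theorem IsSemiRegular.contMDiff_coInnerExt (hg : IsSemiRegular g) {X Y Z T : VField I M}
    (hX : IsSmoothField I X) (hY : IsSmoothField I Y) (hZ : IsSmoothField I Z)
    (hT : IsSmoothField I T) : ContMDiff I 𝓘(ℝ, ℝ) ∞ (coInnerExt g Z T X Y) :=
  (hZ.contMDiff_dirDeriv ((hg.lower X Y hX hY).1 T hT)).sub ((hg.second X Y Z hX hY hZ).1 T hT)

/-- At a regular point the inner product is continuous, so the limit defining the covariant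
derivative is the value there. -/
theorem IsSemiRegular.coInner_eq_coInnerExt (hg : IsSemiRegular g) {X Y Z T : VField I M}
    (hX : IsSmoothField I X) (hY : IsSmoothField I Y) (hZ : IsSmoothField I Z)
    (hT : IsSmoothField I T) {x : M} (hx : x ∈ regularSet g) :
    coInner g (koszul g Z T) (koszul g X Y) x = coInnerExt g Z T X Y x := by
  have hs := hg.toIsSingularMetric
  have h := hs.covDeriv_eq (κ := koszul g) (θ := koszul g X Y) (Z := Z) (T := T)
    (S := coInner g (koszul g Z T) (koszul g X Y)) (x := x)
    (hZ.contMDiff_dirDeriv ((hg.lower X Y hX hY).1 T hT)).continuous.continuousAt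
    (hs.contMDiffAt_coInner (hg.lower Z T hZ hT) (hg.lower X Y hX hY) hx).continuousAt
    (Filter.Eventually.of_forall fun _ _ => rfl)
  rw [coInnerExt, h]
  ring

variable {P : VField I M}

theorem contMDiff_snmKoszul (hg : IsSingularMetric g) (hP : IsSmoothField I P)
    {X Y Z : VField I M} (hX : IsSmoothField I X) (hY : IsSmoothField I Y)
    (hZ : IsSmoothField I Z) : ContMDiff I 𝓘(ℝ, ℝ) ∞ (snmKoszul g P X Y Z) :=
  (hg.contMDiff_koszul hX hY hZ).add ((hg.smooth Y P hY hP).mul (hg.smooth X Z hX hZ))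

theorem snmKoszul_eq (X Y W : VField I M) (x : M) :
    snmKoszul g P X Y W x = 1 * koszul g X Y W x + pairing g Y P x * pairing g X W x := by
  rw [one_mul, snmKoszul]

theorem IsSemiRegular.exists_isFlatAt_snmKoszul (hg : IsSemiRegular g) {X Y : VField I M}
    (hX : IsSmoothField I X) (hY : IsSmoothField I Y) (x : M) :
    ∃ u, IsFlatAt g (snmKoszul g P X Y) x u := by
  obtain ⟨u, hu⟩ := (hg.lower X Y hX hY).2 x
  exact ⟨_, hu.lin (isFlatAt_pairing g X x) fun W _ => snmKoszul_eq X Y W x⟩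

/-- Each hatted covector is the original one plus a multiple of g(X,·) or g(Z,·), and inner products
with these are evaluations. The right-hand side is smooth on all of M, which is what the extension
needs. -/
theorem IsSemiRegular.coInner_snmKoszul (hg : IsSemiRegular g) {X Y Z T : VField I M}
    (hX : IsSmoothField I X) (hY : IsSmoothField I Y) (hZ : IsSmoothField I Z)
    (hT : IsSmoothField I T) {x : M} (hx : x ∈ regularSet g) :
    coInner g (snmKoszul g P Z T) (snmKoszul g P X Y) x =
      coInnerExt g Z T X Y x + pairing g Y P x * koszul g Z T X x +
        pairing g T P x * snmKoszul g P X Y Z x := by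
  have hs := hg.toIsSingularMetric
  have fl := hg.exists_isFlatAt_snmKoszul (P := P) hX hY x
  have f1 := (hg.lower Z T hZ hT).2 x
  rw [hs.coInner_lin_left f1 ⟨_, isFlatAt_pairing g Z x⟩ fl
      (fun W _ => snmKoszul_eq Z T W x), hs.coInner_pairing_left hZ fl,
    hs.coInner_lin_right ((hg.lower X Y hX hY).2 x) ⟨_, isFlatAt_pairing g X x⟩ f1
      (fun W _ => snmKoszul_eq X Y W x), hs.coInner_pairing_right hX f1,
    hg.coInner_eq_coInnerExt hX hY hZ hT hx]
  ring

/-- Metricity splits Z(g(X,T)) into K(Z,X,T) + K(Z,T,X), and the second term cancels against the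
inner product. -/
theorem IsSemiRegular.covDeriv_snmKoszul (hg : IsSemiRegular g) (hP : IsSmoothField I P)
    {X Y Z T : VField I M} (hX : IsSmoothField I X) (hY : IsSmoothField I Y)
    (hZ : IsSmoothField I Z) (hT : IsSmoothField I T) (x : M) :
    covDeriv g (snmKoszul g P) Z (snmKoszul g P X Y) T x =
      covDeriv g (koszul g) Z (koszul g X Y) T x + pairing g Y P x * koszul g Z X T x +
        dirDeriv Z (pairing g Y P) x * pairing g X T x -
          pairing g T P x * snmKoszul g P X Y Z x := by
  have hs := hg.toIsSingularMetric
  have hS : ContMDiff I 𝓘(ℝ, ℝ) ∞ (fun x => coInnerExt g Z T X Y x +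
      pairing g Y P x * koszul g Z T X x + pairing g T P x * snmKoszul g P X Y Z x) :=
    ((hg.contMDiff_coInnerExt hX hY hZ hT).add
      ((hs.smooth Y P hY hP).mul (hs.contMDiff_koszul hZ hT hX))).add
      ((hs.smooth T P hT hP).mul (contMDiff_snmKoszul hs hP hX hY hZ))
  have h := hs.covDeriv_eq (κ := snmKoszul g P) (θ := snmKoszul g P X Y) (Z := Z) (T := T) (x := x)
    (hZ.contMDiff_dirDeriv (contMDiff_snmKoszul hs hP hX hY hT)).continuous.continuousAt
    hS.continuous.continuousAt
    (Filter.Eventually.of_forall fun y hy => hg.coInner_snmKoszul hX hY hZ hT hy)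
  have hYP := hs.mdiffAt hY hP x
  have hXT := hs.mdiffAt hX hT x
  have hm : MDifferentiableAt I 𝓘(ℝ, ℝ) (fun x => pairing g Y P x * pairing g X T x) x :=
    hYP.mul hXT
  have hd : dirDeriv Z (snmKoszul g P X Y T) x = dirDeriv Z (koszul g X Y T) x +
      (pairing g Y P x * dirDeriv Z (pairing g X T) x +
        pairing g X T x * dirDeriv Z (pairing g Y P) x) := by
    rw [← dirDeriv_mul Z hYP hXT,
      ← dirDeriv_add Z ((hs.contMDiff_koszul hX hY hT).mdiffAt x) hm]
    rfl
  rw [h, hd, coInnerExt, hs.dirDeriv_pairing Z X T]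
  ring

/-- A semi-regular manifold is semi-symmetric non-metric semi-regular with respect to every
smooth field. -/
theorem IsSemiRegular.isSNMSemiRegular (hg : IsSemiRegular g) (hP : IsSmoothField I P) :
    IsSNMSemiRegular g P := by
  have hs := hg.toIsSingularMetric
  refine ⟨hs, fun X Y hX hY => ⟨fun Z hZ => contMDiff_snmKoszul hs hP hX hY hZ, fun x =>
    hg.exists_isFlatAt_snmKoszul hX hY x⟩, fun X Y Z hX hY hZ => ⟨fun T hT => ?_, fun x => ?_⟩⟩
  · rw [funext fun x => hg.covDeriv_snmKoszul hP hX hY hZ hT x]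
    exact ((((hg.second X Y Z hX hY hZ).1 T hT).add
      ((hs.smooth Y P hY hP).mul (hs.contMDiff_koszul hZ hX hT))).add
      ((hZ.contMDiff_dirDeriv (hs.smooth Y P hY hP)).mul (hs.smooth X T hX hT))).sub
      ((hs.smooth T P hT hP).mul (contMDiff_snmKoszul hs hP hX hY hZ))
  · obtain ⟨u, hu⟩ := (hg.second X Y Z hX hY hZ).2 x
    obtain ⟨w, hw⟩ := (hg.lower Z X hZ hX).2 x
    -- One vector for each term of `covDeriv_snmKoszul`; the last one carries P because T enters
    -- there through g(T,P).
    refine ⟨u + pairing g Y P x • w + dirDeriv Z (pairing g Y P) x • X x -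
      snmKoszul g P X Y Z x • P x, fun T hT => ?_⟩
    rw [hg.covDeriv_snmKoszul hP hX hY hZ hT, hu T hT, hw T hT, hs.pairing_comm T P]
    simp only [pairing, map_add, map_sub, map_smul, LinearMap.add_apply, LinearMap.sub_apply,
      LinearMap.smul_apply, smul_eq_mul]
    ring

/-- The curvatures of the two covariant derivatives. -/
theorem IsSemiRegular.snmCurvature_eq (hg : IsSemiRegular g) (hP : IsSmoothField I P)
    {X Y Z T : VField I M} (hX : IsSmoothField I X) (hY : IsSmoothField I Y)
    (hZ : IsSmoothField I Z) (hT : IsSmoothField I T) (x : M) :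
    snmCurvature g P X Y Z T x = curvature g X Y Z T x +
      dirDeriv X (pairing g Z P) x * pairing g Y T x -
      dirDeriv Y (pairing g Z P) x * pairing g X T x +
      pairing g T P x * (koszul g X Z Y x - koszul g Y Z X x) := by
  have hs := hg.toIsSingularMetric
  rw [snmCurvature, curvatureOf, hg.covDeriv_snmKoszul hP hY hZ hX hT,
    hg.covDeriv_snmKoszul hP hX hZ hY hT, curvature, curvatureOf]
  simp only [snmKoszul]
  -- The terms g(Z,P) K(X,Y,T) and g(Z,P) K(Y,X,T) differ by g(Z,P) g([X,Y],T), which is the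
  -- correction in the bracket term.
  rw [hs.koszul_swap X Y T, hs.pairing_comm Y X]
  ring

end SemiSymmetric

/-! ### Nondegenerate manifolds. -/

section Nondegenerate

variable {E : Type*} [NormedAddCommGroup E] [NormedSpace ℝ E] [FiniteDimensional ℝ E]
  {H : Type*} [TopologicalSpace H] {I : ModelWithCorners ℝ E H}
  {M : Type*} [TopologicalSpace M] [ChartedSpace H M] [IsManifold I ∞ M] [T2Space M]
  {g : MetricField I M}

theorem IsNondegenerateMetric.exists_apply_eq (hg : IsNondegenerateMetric g) (x : M)
    (φ : Module.Dual ℝ (TangentSpace I x)) : ∃ u, ∀ v, φ v = g x u v := by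
  have : FiniteDimensional ℝ (TangentSpace I x) := ‹FiniteDimensional ℝ E›
  refine ⟨((g x).toDual (hg.nondegenerate x)).symm φ, fun v => ?_⟩
  rw [LinearMap.BilinForm.apply_toDual_symm_apply]

theorem IsNondegenerateMetric.metricRank_eq (hg : IsNondegenerateMetric g) (x : M) :
    metricRank g x = Module.finrank ℝ E := by
  have : FiniteDimensional ℝ (TangentSpace I x) := ‹FiniteDimensional ℝ E›
  exact LinearMap.finrank_range_of_inj
    (LinearMap.ker_eq_bot.1 (LinearMap.BilinForm.Nondegenerate.ker_eq_bot (hg.nondegenerate x)))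

theorem IsNondegenerateMetric.mem_regularSet (hg : IsNondegenerateMetric g) (x : M) :
    x ∈ regularSet g :=
  Filter.Eventually.of_forall fun y => by rw [hg.metricRank_eq, hg.metricRank_eq]

theorem IsNondegenerateMetric.contMDiff_coInner (hg : IsNondegenerateMetric g)
    {θ τ : OneForm I M} (hθ : IsRadicalAnnihilator g θ) (hτ : IsRadicalAnnihilator g τ) :
    ContMDiff I 𝓘(ℝ, ℝ) ∞ (coInner g θ τ) := fun x =>
  hg.toIsSingularMetric.contMDiffAt_coInner hθ hτ (hg.mem_regularSet x)

theorem IsNondegenerateMetric.covDeriv_eq (hg : IsNondegenerateMetric g) {κ : TernaryForm I M}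
    {θ : OneForm I M} {Z T : VField I M} (hθ : IsRadicalAnnihilator g θ)
    (hκ : IsRadicalAnnihilator g (κ Z T)) (hZ : IsSmoothField I Z) (hT : IsSmoothField I T)
    (x : M) : covDeriv g κ Z θ T x = dirDeriv Z (θ T) x - coInner g (κ Z T) θ x :=
  hg.toIsSingularMetric.covDeriv_eq
    (hZ.contMDiff_dirDeriv (hθ.1 T hT)).continuous.continuousAt
    (hg.contMDiff_coInner hκ hθ).continuous.continuousAt (Filter.Eventually.of_forall fun _ _ => rfl)

theorem IsNondegenerateMetric.isRadicalAnnihilator_differential (hg : IsNondegenerateMetric g)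
    {f : M → ℝ} (hf : ContMDiff I 𝓘(ℝ, ℝ) ∞ f) : IsRadicalAnnihilator g (differential f) := by
  refine ⟨fun Z hZ => hZ.contMDiff_dirDeriv hf, fun x => ?_⟩
  obtain ⟨u, hu⟩ := hg.exists_apply_eq x (mfderiv I 𝓘(ℝ, ℝ) f x).toLinearMap
  exact ⟨u, fun Z _ => hu (Z x)⟩

/-- On a nondegenerate manifold, a covector may be prescribed on a frame. -/
theorem IsNondegenerateMetric.exists_apply_frame_eq (hg : IsNondegenerateMetric g)
    {ι : Type*} [Fintype ι] {e : ι → VField I M} {x : M}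
    (hli : LinearIndependent ℝ (fun i => e i x))
    (hcard : Fintype.card ι = Module.finrank ℝ E) (r : ι → ℝ) :
    ∃ u, ∀ i, g x u (e i x) = r i := by
  have : FiniteDimensional ℝ (TangentSpace I x) := ‹FiniteDimensional ℝ E›
  have hspan : ⊤ ≤ Submodule.span ℝ (Set.range fun i => e i x) :=
    (hli.span_eq_top_of_card_eq_finrank' hcard).ge
  let b := Module.Basis.mk hli hspan
  obtain ⟨u, hu⟩ := hg.exists_apply_eq x (b.constr ℝ r)
  refine ⟨u, fun i => ?_⟩
  have hb : b i = e i x := Module.Basis.mk_apply hli hspan i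
  rw [← hu, ← hb, Module.Basis.constr_basis]

theorem IsNondegenerateMetric.isRadicalAnnihilator_koszul (hg : IsNondegenerateMetric g)
    {X Y : VField I M} (hX : IsSmoothField I X) (hY : IsSmoothField I Y) :
    IsRadicalAnnihilator g (koszul g X Y) := by
  have hs := hg.toIsSingularMetric
  refine ⟨fun Z hZ => hs.contMDiff_koszul hX hY hZ, fun x => ?_⟩
  obtain ⟨e, he, hli⟩ := exists_isSmoothField_linearIndependent (I := I) x
  obtain ⟨u, hu⟩ := hg.exists_apply_frame_eq hli (by simp) (fun i => koszul g X Y (e i) x)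
  refine ⟨u, fun W hW => hs.isFlatAt_koszul_of_frame he hli (by simp) hX hY (fun i => ?_) W hW⟩
  exact (hu i).symm

/-- A nondegenerate manifold is semi-regular. -/
theorem IsNondegenerateMetric.isSemiRegular (hg : IsNondegenerateMetric g) : IsSemiRegular g := by
  have hs := hg.toIsSingularMetric
  refine hs.isSemiRegular_of_frame (ι := Fin (Module.finrank ℝ E)) (by simp) fun p => ?_
  obtain ⟨e, he, hli⟩ := exists_isSmoothField_linearIndependent (I := I) p
  refine ⟨e, he, hli, fun i j => (hg.isRadicalAnnihilator_koszul (he i) (he j)).2 p,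
    fun i j k => ?_⟩
  -- Nondegeneracy permits any values on a frame, in particular those of the covariant derivative.
  obtain ⟨u, hu⟩ := hg.exists_apply_frame_eq hli (by simp) (fun l =>
    dirDeriv (e k) (koszul g (e i) (e j) (e l)) p -
      coInner g (koszul g (e k) (e l)) (koszul g (e i) (e j)) p)
  exact ⟨u, fun l => ⟨coInner g (koszul g (e k) (e l)) (koszul g (e i) (e j)),
    hg.contMDiff_coInner (hg.isRadicalAnnihilator_koszul (he k) (he l))
      (hg.isRadicalAnnihilator_koszul (he i) (he j)),
    Filter.Eventually.of_forall fun _ _ => rfl, (hu l).symm⟩⟩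

theorem IsNondegenerateMetric.hessian_eq (hg : IsNondegenerateMetric g) {f : M → ℝ}
    (hf : ContMDiff I 𝓘(ℝ, ℝ) ∞ f) {X T : VField I M} (hX : IsSmoothField I X)
    (hT : IsSmoothField I T) (x : M) :
    hessian g f X T x =
      dirDeriv X (dirDeriv T f) x - coInner g (koszul g X T) (differential f) x :=
  hg.covDeriv_eq (hg.isRadicalAnnihilator_differential hf)
    (hg.isRadicalAnnihilator_koszul hX hT) hX hT x

end Nondegenerate

/-! ### Lifts to a product and their brackets. -/

section Lifts

variable {EB : Type*} [NormedAddCommGroup EB] [NormedSpace ℝ EB]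
  {HB : Type*} [TopologicalSpace HB] {IB : ModelWithCorners ℝ EB HB}
  {B : Type*} [TopologicalSpace B] [ChartedSpace HB B]
  {EF : Type*} [NormedAddCommGroup EF] [NormedSpace ℝ EF]
  {HF : Type*} [TopologicalSpace HF] {IF : ModelWithCorners ℝ EF HF}
  {F : Type*} [TopologicalSpace F] [ChartedSpace HF F]

theorem mfderiv_fst_liftBase (X : VField IB B) (p : B × F) :
    mfderiv (IB.prod IF) IB (Prod.fst : B × F → B) p (liftBase IF F X p) = X p.1 := by
  rw [mfderiv_fst, liftBase, mfderiv_prod_left]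
  rfl

theorem mfderiv_snd_liftBase (X : VField IB B) (p : B × F) :
    mfderiv (IB.prod IF) IF (Prod.snd : B × F → F) p (liftBase IF F X p) = 0 := by
  rw [mfderiv_snd, liftBase, mfderiv_prod_left]
  rfl

theorem mfderiv_fst_liftFiber (V : VField IF F) (p : B × F) :
    mfderiv (IB.prod IF) IB (Prod.fst : B × F → B) p (liftFiber IB B V p) = 0 := by
  rw [mfderiv_fst, liftFiber, mfderiv_prod_right]
  rfl

theorem mfderiv_snd_liftFiber (V : VField IF F) (p : B × F) :
    mfderiv (IB.prod IF) IF (Prod.snd : B × F → F) p (liftFiber IB B V p) = V p.2 := by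
  rw [mfderiv_snd, liftFiber, mfderiv_prod_right]
  rfl

theorem tangent_prod_ext {p : B × F} {u v : TangentSpace (IB.prod IF) p}
    (h₁ : mfderiv (IB.prod IF) IB (Prod.fst : B × F → B) p u =
      mfderiv (IB.prod IF) IB (Prod.fst : B × F → B) p v)
    (h₂ : mfderiv (IB.prod IF) IF (Prod.snd : B × F → F) p u =
      mfderiv (IB.prod IF) IF (Prod.snd : B × F → F) p v) : u = v := by
  rw [mfderiv_fst] at h₁
  rw [mfderiv_snd] at h₂
  exact Prod.ext (α := EB) (β := EF) h₁ h₂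

theorem exists_tangent_prod (p : B × F) (a : TangentSpace IB p.1) (c : TangentSpace IF p.2) :
    ∃ u : TangentSpace (IB.prod IF) p,
      mfderiv (IB.prod IF) IB (Prod.fst : B × F → B) p u = a ∧
      mfderiv (IB.prod IF) IF (Prod.snd : B × F → F) p u = c := by
  refine ⟨((a, c) : EB × EF), ?_, ?_⟩
  · rw [mfderiv_fst]; rfl
  · rw [mfderiv_snd]; rfl

theorem mfderiv_comp_fst {h : B → ℝ} {p : B × F} (hh : MDifferentiableAt IB 𝓘(ℝ, ℝ) h p.1)
    (u : TangentSpace (IB.prod IF) p) :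
    mfderiv (IB.prod IF) 𝓘(ℝ, ℝ) (fun q : B × F => h q.1) p u =
      mfderiv IB 𝓘(ℝ, ℝ) h p.1 (mfderiv (IB.prod IF) IB (Prod.fst : B × F → B) p u) :=
  congr($(mfderiv_comp p hh mdifferentiableAt_fst) u)

theorem mfderiv_comp_snd {h : F → ℝ} {p : B × F} (hh : MDifferentiableAt IF 𝓘(ℝ, ℝ) h p.2)
    (u : TangentSpace (IB.prod IF) p) :
    mfderiv (IB.prod IF) 𝓘(ℝ, ℝ) (fun q : B × F => h q.2) p u =
      mfderiv IF 𝓘(ℝ, ℝ) h p.2 (mfderiv (IB.prod IF) IF (Prod.snd : B × F → F) p u) :=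
  congr($(mfderiv_comp p hh mdifferentiableAt_snd) u)

theorem dirDeriv_liftBase_fst {h : B → ℝ} {p : B × F}
    (hh : MDifferentiableAt IB 𝓘(ℝ, ℝ) h p.1) (X : VField IB B) :
    dirDeriv (liftBase IF F X) (fun q : B × F => h q.1) p = dirDeriv X h p.1 :=
  (mfderiv_comp_fst hh _).trans
    (congrArg (mfderiv IB 𝓘(ℝ, ℝ) h p.1) (mfderiv_fst_liftBase X p))

theorem dirDeriv_liftBase_snd {h : F → ℝ} {p : B × F}
    (hh : MDifferentiableAt IF 𝓘(ℝ, ℝ) h p.2) (X : VField IB B) :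
    dirDeriv (liftBase IF F X) (fun q : B × F => h q.2) p = 0 :=
  (mfderiv_comp_snd hh _).trans
    ((congrArg (mfderiv IF 𝓘(ℝ, ℝ) h p.2) (mfderiv_snd_liftBase X p)).trans
      (map_zero (mfderiv IF 𝓘(ℝ, ℝ) h p.2)))

theorem dirDeriv_liftFiber_fst {h : B → ℝ} {p : B × F}
    (hh : MDifferentiableAt IB 𝓘(ℝ, ℝ) h p.1) (V : VField IF F) :
    dirDeriv (liftFiber IB B V) (fun q : B × F => h q.1) p = 0 :=
  (mfderiv_comp_fst hh _).trans
    ((congrArg (mfderiv IB 𝓘(ℝ, ℝ) h p.1) (mfderiv_fst_liftFiber V p)).trans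
      (map_zero (mfderiv IB 𝓘(ℝ, ℝ) h p.1)))

theorem dirDeriv_liftFiber_snd {h : F → ℝ} {p : B × F}
    (hh : MDifferentiableAt IF 𝓘(ℝ, ℝ) h p.2) (V : VField IF F) :
    dirDeriv (liftFiber IB B V) (fun q : B × F => h q.2) p = dirDeriv V h p.2 :=
  (mfderiv_comp_snd hh _).trans
    (congrArg (mfderiv IF 𝓘(ℝ, ℝ) h p.2) (mfderiv_snd_liftFiber V p))

theorem contMDiff_comp_fst {h : B → ℝ} (hh : ContMDiff IB 𝓘(ℝ, ℝ) ∞ h) :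
    ContMDiff (IB.prod IF) 𝓘(ℝ, ℝ) ∞ (fun q : B × F => h q.1) := hh.comp contMDiff_fst

theorem contMDiff_comp_snd {h : F → ℝ} (hh : ContMDiff IF 𝓘(ℝ, ℝ) ∞ h) :
    ContMDiff (IB.prod IF) 𝓘(ℝ, ℝ) ∞ (fun q : B × F => h q.2) := hh.comp contMDiff_snd

theorem dirDeriv_liftBase_mul {h : B → ℝ} {k : F → ℝ} (hh : ContMDiff IB 𝓘(ℝ, ℝ) ∞ h)
    (hk : ContMDiff IF 𝓘(ℝ, ℝ) ∞ k) (X : VField IB B) (p : B × F) :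
    dirDeriv (liftBase IF F X) (fun q : B × F => h q.1 * k q.2) p = dirDeriv X h p.1 * k p.2 := by
  rw [dirDeriv_mul _ ((contMDiff_comp_fst hh).mdiffAt p) ((contMDiff_comp_snd hk).mdiffAt p),
    dirDeriv_liftBase_fst (hh.mdiffAt _), dirDeriv_liftBase_snd (hk.mdiffAt _)]
  ring

theorem dirDeriv_liftFiber_mul {h : B → ℝ} {k : F → ℝ} (hh : ContMDiff IB 𝓘(ℝ, ℝ) ∞ h)
    (hk : ContMDiff IF 𝓘(ℝ, ℝ) ∞ k) (V : VField IF F) (p : B × F) :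
    dirDeriv (liftFiber IB B V) (fun q : B × F => h q.1 * k q.2) p = h p.1 * dirDeriv V k p.2 := by
  rw [dirDeriv_mul _ ((contMDiff_comp_fst hh).mdiffAt p) ((contMDiff_comp_snd hk).mdiffAt p),
    dirDeriv_liftFiber_fst (hh.mdiffAt _), dirDeriv_liftFiber_snd (hk.mdiffAt _)]
  ring

variable [IsManifold IB ∞ B] [IsManifold IF ∞ F]

theorem IsSmoothField.liftBase {X : VField IB B} (hX : IsSmoothField IB X) :
    IsSmoothField (IB.prod IF) (liftBase IF F X) := by
  have h1 : ContMDiff (IB.prod IF) IB.tangent ∞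
      (fun p : B × F => (⟨p.1, X p.1⟩ : TangentBundle IB B)) := ContMDiff.comp hX contMDiff_fst
  have h2 : ContMDiff (IB.prod IF) IF.tangent ∞
      (fun p : B × F => (⟨p.2, 0⟩ : TangentBundle IF F)) :=
    ContMDiff.comp isSmoothField_zero contMDiff_snd
  have h3 := (contMDiff_equivTangentBundleProd_symm (n := ∞) (I := IB) (M := B) (I' := IF)
    (M' := F)).comp (h1.prodMk h2)
  refine h3.congr fun p => ?_
  simp only [SingularGeometry.liftBase, mfderiv_prod_left]
  rfl

theorem IsSmoothField.liftFiber {V : VField IF F} (hV : IsSmoothField IF V) :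
    IsSmoothField (IB.prod IF) (liftFiber IB B V) := by
  have h1 : ContMDiff (IB.prod IF) IB.tangent ∞
      (fun p : B × F => (⟨p.1, 0⟩ : TangentBundle IB B)) :=
    ContMDiff.comp isSmoothField_zero contMDiff_fst
  have h2 : ContMDiff (IB.prod IF) IF.tangent ∞
      (fun p : B × F => (⟨p.2, V p.2⟩ : TangentBundle IF F)) := ContMDiff.comp hV contMDiff_snd
  have h3 := (contMDiff_equivTangentBundleProd_symm (n := ∞) (I := IB) (M := B) (I' := IF)
    (M' := F)).comp (h1.prodMk h2)
  refine h3.congr fun p => ?_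
  simp only [SingularGeometry.liftFiber, mfderiv_prod_right]
  rfl

variable [FiniteDimensional ℝ EB] [FiniteDimensional ℝ EF] [T2Space B] [T2Space F]

/-- Vectors on a product are determined by their action on functions of the factors. -/
theorem tangent_prod_ext_of_mfderiv {p : B × F} {u v : TangentSpace (IB.prod IF) p}
    (h₁ : ∀ k : B → ℝ, ContMDiff IB 𝓘(ℝ, ℝ) ∞ k →
      mfderiv (IB.prod IF) 𝓘(ℝ, ℝ) (fun q : B × F => k q.1) p u =
        mfderiv (IB.prod IF) 𝓘(ℝ, ℝ) (fun q : B × F => k q.1) p v)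
    (h₂ : ∀ k : F → ℝ, ContMDiff IF 𝓘(ℝ, ℝ) ∞ k →
      mfderiv (IB.prod IF) 𝓘(ℝ, ℝ) (fun q : B × F => k q.2) p u =
        mfderiv (IB.prod IF) 𝓘(ℝ, ℝ) (fun q : B × F => k q.2) p v) : u = v := by
  apply tangent_prod_ext
  · refine eq_of_forall_mfderiv_eq fun k hk => ?_
    have := h₁ k hk
    rwa [mfderiv_comp_fst (hk.mdiffAt _), mfderiv_comp_fst (hk.mdiffAt _)] at this
  · refine eq_of_forall_mfderiv_eq fun k hk => ?_
    have := h₂ k hk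
    rwa [mfderiv_comp_snd (hk.mdiffAt _), mfderiv_comp_snd (hk.mdiffAt _)] at this

/-- Both sides act as the commutator on functions pulled back from B and annihilate those pulled
back from F; such functions determine a tangent vector. -/
theorem mlieBracket_liftBase {X Y : VField IB B} (hX : IsSmoothField IB X)
    (hY : IsSmoothField IB Y) :
    VectorField.mlieBracket (IB.prod IF) (liftBase IF F X) (liftBase IF F Y) =
      liftBase IF F (VectorField.mlieBracket IB X Y) := by
  funext p
  apply tangent_prod_ext_of_mfderiv
  · intro k hk
    change dirDeriv (VectorField.mlieBracket (IB.prod IF) (liftBase IF F X) (liftBase IF F Y))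
      (fun q : B × F => k q.1) p = dirDeriv (liftBase IF F (VectorField.mlieBracket IB X Y))
      (fun q : B × F => k q.1) p
    rw [dirDeriv_mlieBracket hX.liftBase hY.liftBase (contMDiff_comp_fst hk),
      dirDeriv_liftBase_fst (hk.mdiffAt _), dirDeriv_mlieBracket hX hY hk,
      funext fun q : B × F => dirDeriv_liftBase_fst (IF := IF) (hk.mdiffAt q.1) X,
      funext fun q : B × F => dirDeriv_liftBase_fst (IF := IF) (hk.mdiffAt q.1) Y,
      dirDeriv_liftBase_fst ((hX.contMDiff_dirDeriv hk).mdiffAt _),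
      dirDeriv_liftBase_fst ((hY.contMDiff_dirDeriv hk).mdiffAt _)]
  · intro k hk
    change dirDeriv (VectorField.mlieBracket (IB.prod IF) (liftBase IF F X) (liftBase IF F Y))
      (fun q : B × F => k q.2) p = dirDeriv (liftBase IF F (VectorField.mlieBracket IB X Y))
      (fun q : B × F => k q.2) p
    rw [dirDeriv_mlieBracket hX.liftBase hY.liftBase (contMDiff_comp_snd hk),
      dirDeriv_liftBase_snd (hk.mdiffAt _),
      funext fun q : B × F => dirDeriv_liftBase_snd (IF := IF) (hk.mdiffAt q.2) X,
      funext fun q : B × F => dirDeriv_liftBase_snd (IF := IF) (hk.mdiffAt q.2) Y,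
      dirDeriv_const, dirDeriv_const, sub_zero]

theorem mlieBracket_liftFiber {U V : VField IF F} (hU : IsSmoothField IF U)
    (hV : IsSmoothField IF V) :
    VectorField.mlieBracket (IB.prod IF) (liftFiber IB B U) (liftFiber IB B V) =
      liftFiber IB B (VectorField.mlieBracket IF U V) := by
  funext p
  apply tangent_prod_ext_of_mfderiv
  · intro k hk
    change dirDeriv (VectorField.mlieBracket (IB.prod IF) (liftFiber IB B U) (liftFiber IB B V))
      (fun q : B × F => k q.1) p = dirDeriv (liftFiber IB B (VectorField.mlieBracket IF U V))
      (fun q : B × F => k q.1) p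
    rw [dirDeriv_mlieBracket hU.liftFiber hV.liftFiber (contMDiff_comp_fst hk),
      dirDeriv_liftFiber_fst (hk.mdiffAt _),
      funext fun q : B × F => dirDeriv_liftFiber_fst (IB := IB) (hk.mdiffAt q.1) U,
      funext fun q : B × F => dirDeriv_liftFiber_fst (IB := IB) (hk.mdiffAt q.1) V,
      dirDeriv_const, dirDeriv_const, sub_zero]
  · intro k hk
    change dirDeriv (VectorField.mlieBracket (IB.prod IF) (liftFiber IB B U) (liftFiber IB B V))
      (fun q : B × F => k q.2) p = dirDeriv (liftFiber IB B (VectorField.mlieBracket IF U V))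
      (fun q : B × F => k q.2) p
    rw [dirDeriv_mlieBracket hU.liftFiber hV.liftFiber (contMDiff_comp_snd hk),
      dirDeriv_liftFiber_snd (hk.mdiffAt _), dirDeriv_mlieBracket hU hV hk,
      funext fun q : B × F => dirDeriv_liftFiber_snd (IB := IB) (hk.mdiffAt q.2) U,
      funext fun q : B × F => dirDeriv_liftFiber_snd (IB := IB) (hk.mdiffAt q.2) V,
      dirDeriv_liftFiber_snd ((hU.contMDiff_dirDeriv hk).mdiffAt _),
      dirDeriv_liftFiber_snd ((hV.contMDiff_dirDeriv hk).mdiffAt _)]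

/-- Each lift preserves the functions of its own factor and kills those of the other, so both
compositions vanish on functions of either factor. -/
theorem mlieBracket_liftBase_liftFiber {X : VField IB B} {V : VField IF F}
    (hX : IsSmoothField IB X) (hV : IsSmoothField IF V) :
    VectorField.mlieBracket (IB.prod IF) (liftBase IF F X) (liftFiber IB B V) = 0 := by
  funext p
  have h0 : ∀ h : B × F → ℝ, mfderiv (IB.prod IF) 𝓘(ℝ, ℝ) h p
      ((0 : VField (IB.prod IF) (B × F)) p) = 0 := fun h =>
    map_zero (mfderiv (IB.prod IF) 𝓘(ℝ, ℝ) h p)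
  apply tangent_prod_ext_of_mfderiv
  · intro k hk
    rw [h0]
    change dirDeriv (VectorField.mlieBracket (IB.prod IF) (liftBase IF F X) (liftFiber IB B V))
      (fun q : B × F => k q.1) p = 0
    rw [dirDeriv_mlieBracket hX.liftBase hV.liftFiber (contMDiff_comp_fst hk),
      funext fun q : B × F => dirDeriv_liftFiber_fst (IB := IB) (hk.mdiffAt q.1) V,
      funext fun q : B × F => dirDeriv_liftBase_fst (IF := IF) (hk.mdiffAt q.1) X,
      dirDeriv_liftFiber_fst ((hX.contMDiff_dirDeriv hk).mdiffAt _), dirDeriv_const, sub_zero]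
  · intro k hk
    rw [h0]
    change dirDeriv (VectorField.mlieBracket (IB.prod IF) (liftBase IF F X) (liftFiber IB B V))
      (fun q : B × F => k q.2) p = 0
    rw [dirDeriv_mlieBracket hX.liftBase hV.liftFiber (contMDiff_comp_snd hk),
      funext fun q : B × F => dirDeriv_liftFiber_snd (IB := IB) (hk.mdiffAt q.2) V,
      funext fun q : B × F => dirDeriv_liftBase_snd (IF := IF) (hk.mdiffAt q.2) X,
      dirDeriv_liftBase_snd ((hV.contMDiff_dirDeriv hk).mdiffAt _), dirDeriv_const, sub_zero]

theorem mlieBracket_liftFiber_liftBase {X : VField IB B} {V : VField IF F}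
    (hX : IsSmoothField IB X) (hV : IsSmoothField IF V) :
    VectorField.mlieBracket (IB.prod IF) (liftFiber IB B V) (liftBase IF F X) = 0 := by
  rw [VectorField.mlieBracket_swap, mlieBracket_liftBase_liftFiber hX hV, neg_zero]

/-- The lifts of a frame of `B` and of a frame of `F` form a frame of `B × F`. -/
theorem linearIndependent_lifts {ι κ : Type*} {eB : ι → VField IB B} {eF : κ → VField IF F}
    {p : B × F} (hB : LinearIndependent ℝ (fun i => eB i p.1))
    (hF : LinearIndependent ℝ (fun j => eF j p.2)) :
    LinearIndependent ℝ (fun i => (Sum.elim (fun i => liftBase IF F (eB i))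
      (fun j => liftFiber IB B (eF j)) i : VField (IB.prod IF) (B × F)) p) := by
  have h : LinearIndependent ℝ (Sum.elim (LinearMap.inl ℝ EB EF ∘ fun i => eB i p.1)
      (LinearMap.inr ℝ EB EF ∘ fun j => eF j p.2)) := linearIndependent_inl_union_inr' hB hF
  convert! h using 1
  funext i
  rcases i with i | j
  · simp only [Sum.elim_inl, liftBase, mfderiv_prod_left]
    rfl
  · simp only [Sum.elim_inr, liftFiber, mfderiv_prod_right]
    rfl

end Lifts

/-! ### The warped metric on lifts. -/

section Warped

variable {EB : Type*} [NormedAddCommGroup EB] [NormedSpace ℝ EB]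
  {HB : Type*} [TopologicalSpace HB] {IB : ModelWithCorners ℝ EB HB}
  {B : Type*} [TopologicalSpace B] [ChartedSpace HB B]
  {EF : Type*} [NormedAddCommGroup EF] [NormedSpace ℝ EF]
  {HF : Type*} [TopologicalSpace HF] {IF : ModelWithCorners ℝ EF HF}
  {F : Type*} [TopologicalSpace F] [ChartedSpace HF F]
  {gB : MetricField IB B} {gF : MetricField IF F} {f : B → ℝ}

theorem warpedMetric_apply (p : B × F) (u v : TangentSpace (IB.prod IF) p) :
    warpedMetric gB gF f p u v =
      gB p.1 (mfderiv (IB.prod IF) IB (Prod.fst : B × F → B) p u)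
          (mfderiv (IB.prod IF) IB (Prod.fst : B × F → B) p v) +
        f p.1 ^ 2 * gF p.2 (mfderiv (IB.prod IF) IF (Prod.snd : B × F → F) p u)
          (mfderiv (IB.prod IF) IF (Prod.snd : B × F → F) p v) := rfl

theorem warpedMetric_liftBase (p : B × F) (u : TangentSpace (IB.prod IF) p) (T : VField IB B) :
    warpedMetric gB gF f p u (liftBase IF F T p) =
      gB p.1 (mfderiv (IB.prod IF) IB (Prod.fst : B × F → B) p u) (T p.1) := by
  rw [warpedMetric_apply, mfderiv_fst_liftBase, mfderiv_snd_liftBase, map_zero, mul_zero, add_zero]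

theorem warpedMetric_liftFiber (p : B × F) (u : TangentSpace (IB.prod IF) p) (Q : VField IF F) :
    warpedMetric gB gF f p u (liftFiber IB B Q p) =
      f p.1 ^ 2 * gF p.2 (mfderiv (IB.prod IF) IF (Prod.snd : B × F → F) p u) (Q p.2) := by
  rw [warpedMetric_apply, mfderiv_fst_liftFiber, mfderiv_snd_liftFiber, map_zero, zero_add]

theorem pairing_warped_base_base (X Y : VField IB B) :
    pairing (warpedMetric gB gF f) (liftBase IF F X) (liftBase IF F Y) =
      fun p => pairing gB X Y p.1 := by
  funext p
  simp only [pairing]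
  rw [warpedMetric_liftBase, mfderiv_fst_liftBase]

theorem pairing_warped_base_fiber (X : VField IB B) (V : VField IF F) :
    pairing (warpedMetric gB gF f) (liftBase IF F X) (liftFiber IB B V) = fun _ => 0 := by
  funext p
  simp only [pairing]
  rw [warpedMetric_liftFiber, mfderiv_snd_liftBase]
  simp

theorem pairing_warped_fiber_base (X : VField IB B) (V : VField IF F) :
    pairing (warpedMetric gB gF f) (liftFiber IB B V) (liftBase IF F X) = fun _ => 0 := by
  funext p
  simp only [pairing]
  rw [warpedMetric_liftBase, mfderiv_fst_liftFiber]
  simp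

theorem pairing_warped_fiber_fiber (V W : VField IF F) :
    pairing (warpedMetric gB gF f) (liftFiber IB B V) (liftFiber IB B W) =
      fun p => f p.1 ^ 2 * pairing gF V W p.2 := by
  funext p
  simp only [pairing]
  rw [warpedMetric_liftFiber, mfderiv_snd_liftFiber]

variable [IsManifold IB ∞ B] [IsManifold IF ∞ F] [FiniteDimensional ℝ EB]
  [FiniteDimensional ℝ EF] [T2Space B] [T2Space F]

/-- Every point of `B × F` has a frame of lifts. -/
theorem exists_frames (p : B × F) :
    ∃ (eB : Fin (Module.finrank ℝ EB) → VField IB B) (eF : Fin (Module.finrank ℝ EF) → VField IF F),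
      (∀ i, IsSmoothField IB (eB i)) ∧ (∀ j, IsSmoothField IF (eF j)) ∧
      LinearIndependent ℝ (fun i => eB i p.1) ∧
      (∀ i, IsSmoothField (IB.prod IF) (Sum.elim (fun i => liftBase IF F (eB i))
        (fun j => liftFiber IB B (eF j)) i : VField (IB.prod IF) (B × F))) ∧
      LinearIndependent ℝ (fun i => (Sum.elim (fun i => liftBase IF F (eB i))
        (fun j => liftFiber IB B (eF j)) i : VField (IB.prod IF) (B × F)) p) := by
  obtain ⟨eB, heB, hB⟩ := exists_isSmoothField_linearIndependent (I := IB) p.1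
  obtain ⟨eF, heF, hF⟩ := exists_isSmoothField_linearIndependent (I := IF) p.2
  refine ⟨eB, eF, heB, heF, hB, ?_, linearIndependent_lifts hB hF⟩
  rintro (i | j)
  · exact (heB i).liftBase
  · exact (heF j).liftFiber

theorem card_frames : Fintype.card (Fin (Module.finrank ℝ EB) ⊕ Fin (Module.finrank ℝ EF)) =
    Module.finrank ℝ (EB × EF) := by
  simp

theorem contMDiff_pairing_warped_lifts (hB : IsSingularMetric gB) (hF : IsSingularMetric gF)
    (hf : ContMDiff IB 𝓘(ℝ, ℝ) ∞ f) {ι κ : Type*} {eB : ι → VField IB B} {eF : κ → VField IF F}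
    (heB : ∀ i, IsSmoothField IB (eB i)) (heF : ∀ j, IsSmoothField IF (eF j)) (i j : ι ⊕ κ) :
    ContMDiff (IB.prod IF) 𝓘(ℝ, ℝ) ∞ (pairing (warpedMetric gB gF f)
      (Sum.elim (fun i => liftBase IF F (eB i)) (fun j => liftFiber IB B (eF j)) i)
      (Sum.elim (fun i => liftBase IF F (eB i)) (fun j => liftFiber IB B (eF j)) j)) := by
  rcases i with i | i <;> rcases j with j | j <;> simp only [Sum.elim_inl, Sum.elim_inr]
  · rw [pairing_warped_base_base]
    exact contMDiff_comp_fst (hB.smooth _ _ (heB i) (heB j))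
  · rw [pairing_warped_base_fiber]
    exact contMDiff_const
  · rw [pairing_warped_fiber_base]
    exact contMDiff_const
  · rw [pairing_warped_fiber_fiber]
    exact (contMDiff_comp_fst (hf.pow 2)).mul (contMDiff_comp_snd (hF.smooth _ _ (heF i) (heF j)))

/-- By bilinearity smoothness may be checked on a frame of lifts, one argument at a time. -/
theorem isSingularMetric_warpedMetric (hB : IsSingularMetric gB) (hF : IsSingularMetric gF)
    (hf : ContMDiff IB 𝓘(ℝ, ℝ) ∞ f) : IsSingularMetric (warpedMetric gB gF f) := by
  refine ⟨fun p u v => ?_, fun X Y hX hY p => ?_⟩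
  · rw [warpedMetric_apply, warpedMetric_apply, hB.symm, hF.symm]
  obtain ⟨eB, eF, heB, heF, -, he, hli⟩ := exists_frames (IB := IB) (IF := IF) p
  have hlin : ∀ {X X₁ X₂ Y Y₁ Y₂ : VField (IB.prod IF) (B × F)} {a₁ a₂ : B × F → ℝ},
      ContMDiff (IB.prod IF) 𝓘(ℝ, ℝ) ∞ a₁ → ContMDiff (IB.prod IF) 𝓘(ℝ, ℝ) ∞ a₂ →
      (∀ᶠ q in 𝓝 p, pairing (warpedMetric gB gF f) X Y q =
        a₁ q * pairing (warpedMetric gB gF f) X₁ Y₁ q +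
          a₂ q * pairing (warpedMetric gB gF f) X₂ Y₂ q) →
      ContMDiffAt (IB.prod IF) 𝓘(ℝ, ℝ) ∞ (pairing (warpedMetric gB gF f) X₁ Y₁) p →
      ContMDiffAt (IB.prod IF) 𝓘(ℝ, ℝ) ∞ (pairing (warpedMetric gB gF f) X₂ Y₂) p →
      ContMDiffAt (IB.prod IF) 𝓘(ℝ, ℝ) ∞ (pairing (warpedMetric gB gF f) X Y) p :=
    fun ha₁ ha₂ h h₁ h₂ => (((ha₁ p).mul h₁).add ((ha₂ p).mul h₂)).congr_of_eventuallyEq h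
  refine smoothField_induction he hli card_frames (Pr := fun X => ContMDiffAt (IB.prod IF) 𝓘(ℝ, ℝ) ∞
    (pairing (warpedMetric gB gF f) X Y) p) ?_ ?_ (fun i => ?_) hX
  · intro X X₁ X₂ a₁ a₂ _ _ _ ha₁ ha₂ hXe h₁ h₂
    refine hlin ha₁ ha₂ ?_ h₁ h₂
    filter_upwards [hXe] with q hq
    have hq' : X q = a₁ q • X₁ q + a₂ q • X₂ q := hq
    simp [pairing, hq']
  · have : pairing (warpedMetric gB gF f) 0 Y = fun _ => 0 := funext fun q => by simp [pairing]
    rw [this]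
    exact contMDiffAt_const
  refine smoothField_induction he hli card_frames (Pr := fun Y => ContMDiffAt (IB.prod IF) 𝓘(ℝ, ℝ) ∞
    (pairing (warpedMetric gB gF f) _ Y) p) ?_ ?_ (fun j => ?_) hY
  · intro Y Y₁ Y₂ a₁ a₂ _ _ _ ha₁ ha₂ hYe h₁ h₂
    refine hlin ha₁ ha₂ ?_ h₁ h₂
    filter_upwards [hYe] with q hq
    have hq' : Y q = a₁ q • Y₁ q + a₂ q • Y₂ q := hq
    simp [pairing, hq']
  · have : ∀ X, pairing (warpedMetric gB gF f) X 0 = fun _ => 0 := fun X =>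
      funext fun q => by simp [pairing]
    rw [this]
    exact contMDiffAt_const
  · exact contMDiff_pairing_warped_lifts hB hF hf heB heF i j p

/-! ### The Koszul form of the warped metric on lifts. -/

section KoszulLifts

variable {X Y Z T : VField IB B} {U V W Q : VField IF F}

theorem pairing_zero_left {E : Type*} [NormedAddCommGroup E] [NormedSpace ℝ E]
    {H : Type*} [TopologicalSpace H] {I : ModelWithCorners ℝ E H}
    {M : Type*} [TopologicalSpace M] [ChartedSpace H M] (g : MetricField I M) (Y : VField I M) :
    pairing g 0 Y = fun _ => 0 := funext fun x => by simp [pairing]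

theorem pairing_zero_right {E : Type*} [NormedAddCommGroup E] [NormedSpace ℝ E]
    {H : Type*} [TopologicalSpace H] {I : ModelWithCorners ℝ E H}
    {M : Type*} [TopologicalSpace M] [ChartedSpace H M] (g : MetricField I M) (Y : VField I M) :
    pairing g Y 0 = fun _ => 0 := funext fun x => by simp [pairing]

/-- Torsion-freeness and the vanishing of mixed brackets. -/
theorem koszul_warped_fiber_base (hB : IsSingularMetric gB) (hF : IsSingularMetric gF)
    (hf : ContMDiff IB 𝓘(ℝ, ℝ) ∞ f) (hX : IsSmoothField IB X) (hV : IsSmoothField IF V) :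
    koszul (warpedMetric gB gF f) (liftFiber IB B V) (liftBase IF F X) =
      koszul (warpedMetric gB gF f) (liftBase IF F X) (liftFiber IB B V) := by
  funext W p
  rw [(isSingularMetric_warpedMetric hB hF hf).koszul_swap, mlieBracket_liftFiber_liftBase hX hV,
    pairing_zero_left, add_zero]

theorem koszul_warped_base_base_base (hB : IsSingularMetric gB) (hX : IsSmoothField IB X)
    (hY : IsSmoothField IB Y) (hZ : IsSmoothField IB Z) :
    koszul (warpedMetric gB gF f) (liftBase IF F X) (liftBase IF F Y) (liftBase IF F Z) =
      fun p => koszul gB X Y Z p.1 := by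
  funext p
  simp only [koszul, mlieBracket_liftBase hX hY, mlieBracket_liftBase hY hZ,
    mlieBracket_liftBase hZ hX, pairing_warped_base_base]
  rw [dirDeriv_liftBase_fst (hB.mdiffAt hY hZ _), dirDeriv_liftBase_fst (hB.mdiffAt hZ hX _),
    dirDeriv_liftBase_fst (hB.mdiffAt hX hY _)]

theorem koszul_warped_base_base_fiber (hB : IsSingularMetric gB) (hX : IsSmoothField IB X)
    (hY : IsSmoothField IB Y) (hW : IsSmoothField IF W) :
    koszul (warpedMetric gB gF f) (liftBase IF F X) (liftBase IF F Y) (liftFiber IB B W) =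
      fun _ => 0 := by
  funext p
  simp only [koszul, mlieBracket_liftBase hX hY, mlieBracket_liftBase_liftFiber hY hW,
    mlieBracket_liftFiber_liftBase hX hW, pairing_warped_base_base, pairing_warped_base_fiber,
    pairing_warped_fiber_base, pairing_zero_right, dirDeriv_const]
  rw [dirDeriv_liftFiber_fst (hB.mdiffAt hX hY _)]
  simp

theorem koszul_warped_base_fiber_base (hB : IsSingularMetric gB) (hF : IsSingularMetric gF)
    (hf : ContMDiff IB 𝓘(ℝ, ℝ) ∞ f) (hX : IsSmoothField IB X)
    (hY : IsSmoothField IB Y) (hW : IsSmoothField IF W) :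
    koszul (warpedMetric gB gF f) (liftBase IF F X) (liftFiber IB B W) (liftBase IF F Y) =
      fun _ => 0 := by
  funext p
  have h := (isSingularMetric_warpedMetric hB hF hf).dirDeriv_pairing (liftBase IF F X)
    (liftFiber IB B W) (liftBase IF F Y) p
  rw [pairing_warped_fiber_base, dirDeriv_const, koszul_warped_base_base_fiber hB hX hY hW] at h
  linarith

/-- Only X(f² g_F(V,W))/2 survives: the two bracket terms in which X occurs vanish, and X is
orthogonal to [V,W]. -/
theorem koszul_warped_base_fiber_fiber (hF : IsSingularMetric gF)
    (hf : ContMDiff IB 𝓘(ℝ, ℝ) ∞ f) (hX : IsSmoothField IB X)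
    (hV : IsSmoothField IF V) (hW : IsSmoothField IF W) :
    koszul (warpedMetric gB gF f) (liftBase IF F X) (liftFiber IB B V) (liftFiber IB B W) =
      fun p => f p.1 * dirDeriv X f p.1 * pairing gF V W p.2 := by
  funext p
  have hsq : dirDeriv X (fun b => f b ^ 2) p.1 = 2 * f p.1 * dirDeriv X f p.1 := by
    simp only [pow_two]
    rw [dirDeriv_mul X (hf.mdiffAt _) (hf.mdiffAt _)]
    ring
  simp only [koszul, mlieBracket_liftFiber hV hW, mlieBracket_liftBase_liftFiber hX hV,
    mlieBracket_liftFiber_liftBase hX hW, pairing_warped_fiber_fiber, pairing_warped_base_fiber,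
    pairing_warped_fiber_base, pairing_zero_right, dirDeriv_const]
  rw [dirDeriv_liftBase_mul (h := fun b => f b ^ 2) (hf.pow 2) (hF.smooth V W hV hW), hsq]
  ring

/-- Metricity applied to the orthogonal fields W and X exchanges the last two slots with a sign. -/
theorem koszul_warped_fiber_fiber_base (hB : IsSingularMetric gB) (hF : IsSingularMetric gF)
    (hf : ContMDiff IB 𝓘(ℝ, ℝ) ∞ f) (hX : IsSmoothField IB X)
    (hV : IsSmoothField IF V) (hW : IsSmoothField IF W) :
    koszul (warpedMetric gB gF f) (liftFiber IB B V) (liftFiber IB B W) (liftBase IF F X) =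
      fun p => -(f p.1 * dirDeriv X f p.1 * pairing gF V W p.2) := by
  funext p
  have h := (isSingularMetric_warpedMetric hB hF hf).dirDeriv_pairing (liftFiber IB B V)
    (liftFiber IB B W) (liftBase IF F X) p
  rw [pairing_warped_fiber_base, dirDeriv_const, koszul_warped_fiber_base hB hF hf hX hV,
    koszul_warped_base_fiber_fiber hF hf hX hV hW] at h
  linarith

theorem koszul_warped_fiber_fiber_fiber (hF : IsSingularMetric gF)
    (hf : ContMDiff IB 𝓘(ℝ, ℝ) ∞ f) (hU : IsSmoothField IF U)
    (hV : IsSmoothField IF V) (hW : IsSmoothField IF W) :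
    koszul (warpedMetric gB gF f) (liftFiber IB B U) (liftFiber IB B V) (liftFiber IB B W) =
      fun p => f p.1 ^ 2 * koszul gF U V W p.2 := by
  funext p
  simp only [koszul, mlieBracket_liftFiber hU hV, mlieBracket_liftFiber hV hW,
    mlieBracket_liftFiber hW hU, pairing_warped_fiber_fiber]
  rw [dirDeriv_liftFiber_mul (h := fun b => f b ^ 2) (hf.pow 2) (hF.smooth V W hV hW),
    dirDeriv_liftFiber_mul (h := fun b => f b ^ 2) (hf.pow 2) (hF.smooth W U hW hU),
    dirDeriv_liftFiber_mul (h := fun b => f b ^ 2) (hf.pow 2) (hF.smooth U V hU hV)]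
  ring

end KoszulLifts

end Warped

/-! ### Rank and regular points of the warped metric. -/

section Warped

variable {EB : Type*} [NormedAddCommGroup EB] [NormedSpace ℝ EB]
  {HB : Type*} [TopologicalSpace HB] {IB : ModelWithCorners ℝ EB HB}
  {B : Type*} [TopologicalSpace B] [ChartedSpace HB B]
  {EF : Type*} [NormedAddCommGroup EF] [NormedSpace ℝ EF]
  {HF : Type*} [TopologicalSpace HF] {IF : ModelWithCorners ℝ EF HF}
  {F : Type*} [TopologicalSpace F] [ChartedSpace HF F]
  {gB : MetricField IB B} {gF : MetricField IF F} {f : B → ℝ}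
  [IsManifold IB ∞ B] [IsManifold IF ∞ F] [FiniteDimensional ℝ EB]
  [FiniteDimensional ℝ EF] [T2Space B] [T2Space F]

/-- Since g_B is nondegenerate, the radical consists of the fiber vectors in the kernel of f² g_F;
the rank follows by rank-nullity. -/
theorem metricRank_warped (hB : IsNondegenerateMetric gB) (p : B × F) :
    metricRank (warpedMetric gB gF f) p =
      Module.finrank ℝ EB + Module.finrank ℝ (LinearMap.range (f p.1 ^ 2 • gF p.2)) := by
  have hfd : FiniteDimensional ℝ (TangentSpace (IB.prod IF) p) :=
    inferInstanceAs (FiniteDimensional ℝ (EB × EF))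
  have hfdF : FiniteDimensional ℝ (TangentSpace IF p.2) := ‹FiniteDimensional ℝ EF›
  let J : TangentSpace IF p.2 →ₗ[ℝ] TangentSpace (IB.prod IF) p := LinearMap.inr ℝ EB EF
  have hJ₁ : ∀ c, mfderiv (IB.prod IF) IB (Prod.fst : B × F → B) p (J c) = 0 := fun c => by
    rw [mfderiv_fst]; rfl
  have hJ₂ : ∀ c, mfderiv (IB.prod IF) IF (Prod.snd : B × F → F) p (J c) = c := fun c => by
    rw [mfderiv_snd]; rfl
  have hJ : Function.Injective J := fun c d h => by rw [← hJ₂ c, h, hJ₂]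
  have hker : LinearMap.ker (warpedMetric gB gF f p) =
      (LinearMap.ker (f p.1 ^ 2 • gF p.2)).map J := by
    ext u
    constructor
    · intro hu
      have hu' : ∀ v, warpedMetric gB gF f p u v = 0 := fun v => by
        rw [LinearMap.mem_ker.1 hu, LinearMap.zero_apply]
      have h₁ : mfderiv (IB.prod IF) IB (Prod.fst : B × F → B) p u = 0 := by
        refine (hB.nondegenerate p.1).1 _ fun a => ?_
        obtain ⟨v, hv₁, hv₂⟩ := exists_tangent_prod p a (0 : TangentSpace IF p.2)
        have := hu' v
        rwa [warpedMetric_apply, hv₁, hv₂, map_zero, mul_zero, add_zero] at this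
      refine ⟨mfderiv (IB.prod IF) IF (Prod.snd : B × F → F) p u, ?_, ?_⟩
      · refine LinearMap.mem_ker.2 (LinearMap.ext fun c => ?_)
        have := hu' (J c)
        rwa [warpedMetric_apply, hJ₁, hJ₂, map_zero, zero_add] at this
      · exact tangent_prod_ext (by rw [hJ₁, h₁]) (by rw [hJ₂])
    · rintro ⟨c, hc, rfl⟩
      refine LinearMap.mem_ker.2 (LinearMap.ext fun v => ?_)
      have h := LinearMap.congr_fun (LinearMap.mem_ker.1 hc)
        (mfderiv (IB.prod IF) IF (Prod.snd : B × F → F) p v)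
      rw [warpedMetric_apply, hJ₁, hJ₂, map_zero, LinearMap.zero_apply, zero_add]
      exact h
  have h₁ := LinearMap.finrank_range_add_finrank_ker (warpedMetric gB gF f p)
  have h₂ := LinearMap.finrank_range_add_finrank_ker (f p.1 ^ 2 • gF p.2)
  rw [hker, ← (Submodule.equivMapOfInjective J hJ _).finrank_eq] at h₁
  have h₃ : Module.finrank ℝ (TangentSpace (IB.prod IF) p) =
      Module.finrank ℝ EB + Module.finrank ℝ EF := Module.finrank_prod
  have h₄ : Module.finrank ℝ (TangentSpace IF p.2) = Module.finrank ℝ EF := rfl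
  rw [metricRank]
  omega

theorem metricRank_warped_of_ne (hB : IsNondegenerateMetric gB) {p : B × F} (hp : f p.1 ≠ 0) :
    metricRank (warpedMetric gB gF f) p = Module.finrank ℝ EB + metricRank gF p.2 := by
  rw [metricRank_warped hB, LinearMap.range_smul _ _ (pow_ne_zero 2 hp), metricRank]

theorem metricRank_warped_of_eq_zero (hB : IsNondegenerateMetric gB) {p : B × F}
    (hp : f p.1 = 0) : metricRank (warpedMetric gB gF f) p = Module.finrank ℝ EB := by
  rw [metricRank_warped hB, hp, zero_pow two_ne_zero, zero_smul, LinearMap.range_zero,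
    finrank_bot, add_zero]

/-- On the slice through p tangent to the fiber, f is a nonzero constant, so the rank is that of g_F
up to the constant dim B. -/
theorem mem_regularSet_fiber (hB : IsNondegenerateMetric gB) {p : B × F}
    (hp : p ∈ regularSet (warpedMetric gB gF f)) (h : f p.1 ≠ 0) : p.2 ∈ regularSet gF := by
  have hc : Filter.Tendsto (fun t : F => (p.1, t)) (𝓝 p.2) (𝓝 p) :=
    (continuous_const.prodMk continuous_id).continuousAt (x := p.2)
  refine (hc.eventually hp).mono fun t ht => ?_
  rw [metricRank_warped_of_ne hB h, metricRank_warped_of_ne (p := (p.1, t)) hB h] at ht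
  exact Nat.add_left_cancel ht

/-- If g_F is nonzero at the fiber point and f vanishes at the base point but not near it, the rank
jumps along the slice parallel to B, against regularity. So g_F vanishes there, or f vanishes nearby
and X(f) = 0. -/
theorem dirDeriv_mul_pairing_eq_zero (hB : IsNondegenerateMetric gB) {p : B × F}
    (hp : p ∈ regularSet (warpedMetric gB gF f)) (h : f p.1 = 0) (X : VField IB B)
    (V W : VField IF F) : dirDeriv X f p.1 * pairing gF V W p.2 = 0 := by
  by_cases h0 : gF p.2 = 0
  · simp [pairing, h0]
  have hfdF : FiniteDimensional ℝ (TangentSpace IF p.2) := ‹FiniteDimensional ℝ EF›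
  have hc : Filter.Tendsto (fun b : B => (b, p.2)) (𝓝 p.1) (𝓝 p) :=
    (continuous_id.prodMk continuous_const).continuousAt (x := p.1)
  have hf0 : ∀ᶠ b in 𝓝 p.1, f b = 0 := by
    refine (hc.eventually hp).mono fun b hb => ?_
    by_contra hne
    rw [metricRank_warped_of_eq_zero hB h, metricRank_warped_of_ne (p := (b, p.2)) hB hne] at hb
    have h1 : Module.finrank ℝ (LinearMap.range (gF p.2)) = 0 := Nat.add_eq_left.1 hb
    exact h0 (LinearMap.range_eq_bot.1 (Submodule.finrank_eq_zero.1 h1))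
  rw [dirDeriv_congr rfl hf0, dirDeriv_const, zero_mul]

end Warped

/-! ### Representatives and inner products of the lowered derivatives of lifts. -/

section Warped

variable {EB : Type*} [NormedAddCommGroup EB] [NormedSpace ℝ EB]
  {HB : Type*} [TopologicalSpace HB] {IB : ModelWithCorners ℝ EB HB}
  {B : Type*} [TopologicalSpace B] [ChartedSpace HB B]
  {EF : Type*} [NormedAddCommGroup EF] [NormedSpace ℝ EF]
  {HF : Type*} [TopologicalSpace HF] {IF : ModelWithCorners ℝ EF HF}
  {F : Type*} [TopologicalSpace F] [ChartedSpace HF F]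
  {gB : MetricField IB B} {gF : MetricField IF F} {f : B → ℝ}
  [IsManifold IB ∞ B] [IsManifold IF ∞ F] [FiniteDimensional ℝ EB]
  [FiniteDimensional ℝ EF] [T2Space B] [T2Space F]

variable {X Y Z T : VField IB B} {U V W Q : VField IF F} {p : B × F}

theorem isFlatAt_koszul_warped (hB : IsSingularMetric gB) (hF : IsSingularMetric gF)
    (hf : ContMDiff IB 𝓘(ℝ, ℝ) ∞ f) {A C : VField (IB.prod IF) (B × F)}
    (hA : IsSmoothField (IB.prod IF) A) (hC : IsSmoothField (IB.prod IF) C)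
    {u : TangentSpace (IB.prod IF) p}
    (hb : ∀ T : VField IB B, IsSmoothField IB T →
      koszul (warpedMetric gB gF f) A C (liftBase IF F T) p =
        gB p.1 (mfderiv (IB.prod IF) IB (Prod.fst : B × F → B) p u) (T p.1))
    (hv : ∀ Q : VField IF F, IsSmoothField IF Q →
      koszul (warpedMetric gB gF f) A C (liftFiber IB B Q) p =
        f p.1 ^ 2 * gF p.2 (mfderiv (IB.prod IF) IF (Prod.snd : B × F → F) p u) (Q p.2)) :
    IsFlatAt (warpedMetric gB gF f) (koszul (warpedMetric gB gF f) A C) p u := by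
  obtain ⟨eB, eF, heB, heF, -, he, hli⟩ := exists_frames (IB := IB) (IF := IF) p
  refine (isSingularMetric_warpedMetric hB hF hf).isFlatAt_koszul_of_frame he hli card_frames
    hA hC fun i => ?_
  rcases i with i | j <;> simp only [Sum.elim_inl, Sum.elim_inr]
  · rw [hb _ (heB i), warpedMetric_liftBase]
  · rw [hv _ (heF j), warpedMetric_liftFiber]

theorem exists_isFlatAt_base_base (hB : IsSingularMetric gB) (hF : IsSingularMetric gF)
    (hf : ContMDiff IB 𝓘(ℝ, ℝ) ∞ f) (hX : IsSmoothField IB X) (hY : IsSmoothField IB Y)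
    {α : TangentSpace IB p.1} (hα : IsFlatAt gB (koszul gB X Y) p.1 α) :
    ∃ u, IsFlatAt (warpedMetric gB gF f)
        (koszul (warpedMetric gB gF f) (liftBase IF F X) (liftBase IF F Y)) p u ∧
      mfderiv (IB.prod IF) IB (Prod.fst : B × F → B) p u = α ∧
      mfderiv (IB.prod IF) IF (Prod.snd : B × F → F) p u = 0 := by
  obtain ⟨u, hu₁, hu₂⟩ := exists_tangent_prod p α (0 : TangentSpace IF p.2)
  refine ⟨u, isFlatAt_koszul_warped hB hF hf hX.liftBase hY.liftBase (fun T hT => ?_)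
    fun Q hQ => ?_, hu₁, hu₂⟩
  · rw [koszul_warped_base_base_base hB hX hY hT, hu₁]
    exact hα T hT
  · rw [koszul_warped_base_base_fiber hB hX hY hQ, hu₂]
    simp

/-- Division by f is compensated by f² g_F. Where f = 0 the covector vanishes and the quotient is
zero by convention, so the formula stays valid. -/
theorem exists_isFlatAt_base_fiber (hB : IsSingularMetric gB) (hF : IsSingularMetric gF)
    (hf : ContMDiff IB 𝓘(ℝ, ℝ) ∞ f) (hX : IsSmoothField IB X) (hV : IsSmoothField IF V)
    (p : B × F) :
    ∃ u, IsFlatAt (warpedMetric gB gF f)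
        (koszul (warpedMetric gB gF f) (liftBase IF F X) (liftFiber IB B V)) p u ∧
      mfderiv (IB.prod IF) IB (Prod.fst : B × F → B) p u = 0 ∧
      mfderiv (IB.prod IF) IF (Prod.snd : B × F → F) p u =
        (dirDeriv X f p.1 / f p.1) • V p.2 := by
  obtain ⟨u, hu₁, hu₂⟩ := exists_tangent_prod p (0 : TangentSpace IB p.1)
    ((dirDeriv X f p.1 / f p.1) • V p.2)
  refine ⟨u, isFlatAt_koszul_warped hB hF hf hX.liftBase hV.liftFiber (fun T hT => ?_)
    fun Q hQ => ?_, hu₁, hu₂⟩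
  · rw [koszul_warped_base_fiber_base hB hF hf hX hT hV, hu₁]
    simp
  · rw [koszul_warped_base_fiber_fiber hF hf hX hV hQ, hu₂, map_smul, LinearMap.smul_apply,
      smul_eq_mul]
    simp only [pairing]
    rcases eq_or_ne (f p.1) 0 with h | h
    · simp [h]
    · field_simp

/-- The base part is a multiple of the gradient γ of f; the fiber part is inherited from F because
both the covector and the metric scale by f². -/
theorem exists_isFlatAt_fiber_fiber (hB : IsSingularMetric gB) (hF : IsSingularMetric gF)
    (hf : ContMDiff IB 𝓘(ℝ, ℝ) ∞ f) (hV : IsSmoothField IF V) (hW : IsSmoothField IF W)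
    {γ : TangentSpace IB p.1} (hγ : IsFlatAt gB (differential f) p.1 γ)
    {ξ : TangentSpace IF p.2} (hξ : IsFlatAt gF (koszul gF V W) p.2 ξ) :
    ∃ u, IsFlatAt (warpedMetric gB gF f)
        (koszul (warpedMetric gB gF f) (liftFiber IB B V) (liftFiber IB B W)) p u ∧
      mfderiv (IB.prod IF) IB (Prod.fst : B × F → B) p u =
        (-(f p.1 * pairing gF V W p.2)) • γ ∧
      mfderiv (IB.prod IF) IF (Prod.snd : B × F → F) p u = ξ := by
  obtain ⟨u, hu₁, hu₂⟩ := exists_tangent_prod p ((-(f p.1 * pairing gF V W p.2)) • γ) ξ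
  refine ⟨u, isFlatAt_koszul_warped hB hF hf hV.liftFiber hW.liftFiber (fun T hT => ?_)
    fun Q hQ => ?_, hu₁, hu₂⟩
  · have h : dirDeriv T f p.1 = gB p.1 γ (T p.1) := hγ T hT
    rw [koszul_warped_fiber_fiber_base hB hF hf hT hV hW, hu₁, map_smul, LinearMap.smul_apply,
      smul_eq_mul, ← h]
    ring
  · rw [koszul_warped_fiber_fiber_fiber hF hf hV hW hQ, hu₂, ← hξ Q hQ]

theorem coInner_warped_base_base_base_base (hB : IsNondegenerateMetric gB)
    (hF : IsSingularMetric gF) (hf : ContMDiff IB 𝓘(ℝ, ℝ) ∞ f) (hX : IsSmoothField IB X)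
    (hY : IsSmoothField IB Y) (hZ : IsSmoothField IB Z) (hT : IsSmoothField IB T) (p : B × F) :
    coInner (warpedMetric gB gF f)
      (koszul (warpedMetric gB gF f) (liftBase IF F Z) (liftBase IF F T))
      (koszul (warpedMetric gB gF f) (liftBase IF F X) (liftBase IF F Y)) p =
        coInner gB (koszul gB Z T) (koszul gB X Y) p.1 := by
  have hs := hB.toIsSingularMetric
  obtain ⟨α, hα⟩ := (hB.isRadicalAnnihilator_koszul hZ hT).2 p.1
  obtain ⟨β, hβ⟩ := (hB.isRadicalAnnihilator_koszul hX hY).2 p.1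
  obtain ⟨u, hu, hu₁, hu₂⟩ := exists_isFlatAt_base_base hs hF hf hZ hT hα
  obtain ⟨v, hv, hv₁, hv₂⟩ := exists_isFlatAt_base_base hs hF hf hX hY hβ
  rw [(isSingularMetric_warpedMetric hs hF hf).coInner_eq hu hv, warpedMetric_apply, hu₁, hu₂,
    hv₁, hv₂, hs.coInner_eq hα hβ]
  simp

theorem coInner_warped_base_fiber_base_base (hB : IsNondegenerateMetric gB)
    (hF : IsSingularMetric gF) (hf : ContMDiff IB 𝓘(ℝ, ℝ) ∞ f) (hX : IsSmoothField IB X)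
    (hY : IsSmoothField IB Y) (hZ : IsSmoothField IB Z) (hQ : IsSmoothField IF Q) (p : B × F) :
    coInner (warpedMetric gB gF f)
      (koszul (warpedMetric gB gF f) (liftBase IF F Z) (liftFiber IB B Q))
      (koszul (warpedMetric gB gF f) (liftBase IF F X) (liftBase IF F Y)) p = 0 := by
  have hs := hB.toIsSingularMetric
  obtain ⟨β, hβ⟩ := (hB.isRadicalAnnihilator_koszul hX hY).2 p.1
  obtain ⟨u, hu, hu₁, hu₂⟩ := exists_isFlatAt_base_fiber hs hF hf hZ hQ p
  obtain ⟨v, hv, hv₁, hv₂⟩ := exists_isFlatAt_base_base hs hF hf hX hY hβ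
  rw [(isSingularMetric_warpedMetric hs hF hf).coInner_eq hu hv, warpedMetric_apply, hu₁, hv₂]
  simp

theorem coInner_warped_base_base_base_fiber (hB : IsNondegenerateMetric gB)
    (hF : IsSingularMetric gF) (hf : ContMDiff IB 𝓘(ℝ, ℝ) ∞ f) (hX : IsSmoothField IB X)
    (hV : IsSmoothField IF V) (hZ : IsSmoothField IB Z) (hT : IsSmoothField IB T) (p : B × F) :
    coInner (warpedMetric gB gF f)
      (koszul (warpedMetric gB gF f) (liftBase IF F Z) (liftBase IF F T))
      (koszul (warpedMetric gB gF f) (liftBase IF F X) (liftFiber IB B V)) p = 0 := by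
  have hs := hB.toIsSingularMetric
  obtain ⟨β, hβ⟩ := (hB.isRadicalAnnihilator_koszul hZ hT).2 p.1
  obtain ⟨u, hu, hu₁, hu₂⟩ := exists_isFlatAt_base_base hs hF hf hZ hT hβ
  obtain ⟨v, hv, hv₁, hv₂⟩ := exists_isFlatAt_base_fiber hs hF hf hX hV p
  rw [(isSingularMetric_warpedMetric hs hF hf).coInner_eq hu hv, warpedMetric_apply, hu₂, hv₁]
  simp

theorem coInner_warped_base_base_fiber_fiber (hB : IsNondegenerateMetric gB)
    (hF : IsSemiRegular gF) (hf : ContMDiff IB 𝓘(ℝ, ℝ) ∞ f) (hX : IsSmoothField IB X)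
    (hY : IsSmoothField IB Y) (hV : IsSmoothField IF V) (hW : IsSmoothField IF W) (p : B × F) :
    coInner (warpedMetric gB gF f)
      (koszul (warpedMetric gB gF f) (liftBase IF F X) (liftBase IF F Y))
      (koszul (warpedMetric gB gF f) (liftFiber IB B V) (liftFiber IB B W)) p =
        -(f p.1 * coInner gB (koszul gB X Y) (differential f) p.1 * pairing gF V W p.2) := by
  have hs := hB.toIsSingularMetric
  have hsF := hF.toIsSingularMetric
  obtain ⟨α, hα⟩ := (hB.isRadicalAnnihilator_koszul hX hY).2 p.1
  obtain ⟨γ, hγ⟩ := (hB.isRadicalAnnihilator_differential hf).2 p.1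
  obtain ⟨ξ, hξ⟩ := (hF.lower V W hV hW).2 p.2
  obtain ⟨u, hu, hu₁, hu₂⟩ := exists_isFlatAt_base_base hs hsF hf hX hY hα
  obtain ⟨v, hv, hv₁, hv₂⟩ := exists_isFlatAt_fiber_fiber hs hsF hf hV hW hγ hξ
  rw [(isSingularMetric_warpedMetric hs hsF hf).coInner_eq hu hv, warpedMetric_apply, hu₁, hu₂,
    hv₁, hs.coInner_eq hα hγ, map_smul, map_zero, LinearMap.zero_apply, smul_eq_mul]
  ring

theorem coInner_warped_fiber_fiber_base_base (hB : IsNondegenerateMetric gB)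
    (hF : IsSemiRegular gF) (hf : ContMDiff IB 𝓘(ℝ, ℝ) ∞ f) (hX : IsSmoothField IB X)
    (hY : IsSmoothField IB Y) (hV : IsSmoothField IF V) (hW : IsSmoothField IF W) (p : B × F) :
    coInner (warpedMetric gB gF f)
      (koszul (warpedMetric gB gF f) (liftFiber IB B V) (liftFiber IB B W))
      (koszul (warpedMetric gB gF f) (liftBase IF F X) (liftBase IF F Y)) p =
        -(f p.1 * coInner gB (koszul gB X Y) (differential f) p.1 * pairing gF V W p.2) := by
  have hs := hB.toIsSingularMetric
  have hsF := hF.toIsSingularMetric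
  obtain ⟨α, hα⟩ := (hB.isRadicalAnnihilator_koszul hX hY).2 p.1
  obtain ⟨γ, hγ⟩ := (hB.isRadicalAnnihilator_differential hf).2 p.1
  obtain ⟨ξ, hξ⟩ := (hF.lower V W hV hW).2 p.2
  obtain ⟨u, hu, -, -⟩ := exists_isFlatAt_base_base hs hsF hf hX hY hα
  obtain ⟨v, hv, -, -⟩ := exists_isFlatAt_fiber_fiber hs hsF hf hV hW hγ hξ
  rw [(isSingularMetric_warpedMetric hs hsF hf).coInner_comm ⟨v, hv⟩ ⟨u, hu⟩,
    coInner_warped_base_base_fiber_fiber hB hF hf hX hY hV hW]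

/-- Away from zeros of f this is f² (Zf/f)(Xf/f) g_F(V,Q). At a zero of f the left side is 0, and
regularity is needed for the right side to vanish too. -/
theorem coInner_warped_base_fiber_base_fiber (hB : IsNondegenerateMetric gB)
    (hF : IsSingularMetric gF) (hf : ContMDiff IB 𝓘(ℝ, ℝ) ∞ f) (hX : IsSmoothField IB X)
    (hV : IsSmoothField IF V) (hZ : IsSmoothField IB Z) (hQ : IsSmoothField IF Q)
    (hp : p ∈ regularSet (warpedMetric gB gF f)) :
    coInner (warpedMetric gB gF f)
      (koszul (warpedMetric gB gF f) (liftBase IF F Z) (liftFiber IB B Q))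
      (koszul (warpedMetric gB gF f) (liftBase IF F X) (liftFiber IB B V)) p =
        dirDeriv Z f p.1 * dirDeriv X f p.1 * pairing gF V Q p.2 := by
  have hs := hB.toIsSingularMetric
  obtain ⟨u, hu, hu₁, hu₂⟩ := exists_isFlatAt_base_fiber hs hF hf hZ hQ p
  obtain ⟨v, hv, hv₁, hv₂⟩ := exists_isFlatAt_base_fiber hs hF hf hX hV p
  rw [(isSingularMetric_warpedMetric hs hF hf).coInner_eq hu hv, warpedMetric_apply, hu₁, hu₂,
    hv₁, hv₂]
  simp only [map_zero, zero_add, map_smul, LinearMap.smul_apply, smul_eq_mul]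
  rw [hF.symm p.2 (Q p.2)]
  rcases eq_or_ne (f p.1) 0 with h | h
  · have := dirDeriv_mul_pairing_eq_zero hB hp h X V Q
    rw [mul_assoc, this, h]
    simp
  · rw [pairing]
    field_simp

theorem coInner_warped_base_fiber_fiber_fiber (hB : IsNondegenerateMetric gB)
    (hF : IsSemiRegular gF) (hf : ContMDiff IB 𝓘(ℝ, ℝ) ∞ f) (hX : IsSmoothField IB X)
    (hU : IsSmoothField IF U) (hV : IsSmoothField IF V) (hW : IsSmoothField IF W) (p : B × F) :
    coInner (warpedMetric gB gF f)
      (koszul (warpedMetric gB gF f) (liftBase IF F X) (liftFiber IB B U))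
      (koszul (warpedMetric gB gF f) (liftFiber IB B V) (liftFiber IB B W)) p =
        f p.1 * dirDeriv X f p.1 * koszul gF V W U p.2 := by
  have hs := hB.toIsSingularMetric
  have hsF := hF.toIsSingularMetric
  obtain ⟨γ, hγ⟩ := (hB.isRadicalAnnihilator_differential hf).2 p.1
  obtain ⟨ξ, hξ⟩ := (hF.lower V W hV hW).2 p.2
  obtain ⟨u, hu, hu₁, hu₂⟩ := exists_isFlatAt_base_fiber hs hsF hf hX hU p
  obtain ⟨v, hv, hv₁, hv₂⟩ := exists_isFlatAt_fiber_fiber hs hsF hf hV hW hγ hξ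
  rw [(isSingularMetric_warpedMetric hs hsF hf).coInner_eq hu hv, warpedMetric_apply, hu₁, hu₂,
    hv₂, hξ U hU, hsF.symm p.2 ξ]
  simp only [map_zero, zero_add, map_smul, LinearMap.smul_apply, LinearMap.zero_apply, smul_eq_mul]
  rcases eq_or_ne (f p.1) 0 with h | h
  · simp [h]
  · field_simp

theorem coInner_warped_fiber_fiber_base_fiber (hB : IsNondegenerateMetric gB)
    (hF : IsSemiRegular gF) (hf : ContMDiff IB 𝓘(ℝ, ℝ) ∞ f) (hX : IsSmoothField IB X)
    (hU : IsSmoothField IF U) (hV : IsSmoothField IF V) (hW : IsSmoothField IF W) (p : B × F) :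
    coInner (warpedMetric gB gF f)
      (koszul (warpedMetric gB gF f) (liftFiber IB B V) (liftFiber IB B W))
      (koszul (warpedMetric gB gF f) (liftBase IF F X) (liftFiber IB B U)) p =
        f p.1 * dirDeriv X f p.1 * koszul gF V W U p.2 := by
  have hs := hB.toIsSingularMetric
  have hsF := hF.toIsSingularMetric
  obtain ⟨γ, hγ⟩ := (hB.isRadicalAnnihilator_differential hf).2 p.1
  obtain ⟨ξ, hξ⟩ := (hF.lower V W hV hW).2 p.2
  obtain ⟨u, hu, -, -⟩ := exists_isFlatAt_base_fiber hs hsF hf hX hU p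
  obtain ⟨v, hv, -, -⟩ := exists_isFlatAt_fiber_fiber hs hsF hf hV hW hγ hξ
  rw [(isSingularMetric_warpedMetric hs hsF hf).coInner_comm ⟨v, hv⟩ ⟨u, hu⟩,
    coInner_warped_base_fiber_fiber_fiber hB hF hf hX hU hV hW]

/-- The gradient parts give the first term. The fiber parts give f² times an inner product on F,
which agrees with its smooth extension at regular points of F. -/
theorem coInner_warped_fiber_fiber_fiber_fiber (hB : IsNondegenerateMetric gB)
    (hF : IsSemiRegular gF) (hf : ContMDiff IB 𝓘(ℝ, ℝ) ∞ f) (hU : IsSmoothField IF U)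
    (hQ : IsSmoothField IF Q) (hV : IsSmoothField IF V) (hW : IsSmoothField IF W)
    (hp : p ∈ regularSet (warpedMetric gB gF f)) :
    coInner (warpedMetric gB gF f)
      (koszul (warpedMetric gB gF f) (liftFiber IB B U) (liftFiber IB B Q))
      (koszul (warpedMetric gB gF f) (liftFiber IB B V) (liftFiber IB B W)) p =
        f p.1 ^ 2 * coInner gB (differential f) (differential f) p.1 *
            (pairing gF U Q p.2 * pairing gF V W p.2) +
          f p.1 ^ 2 * coInnerExt gF U Q V W p.2 := by
  have hs := hB.toIsSingularMetric
  have hsF := hF.toIsSingularMetric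
  obtain ⟨γ, hγ⟩ := (hB.isRadicalAnnihilator_differential hf).2 p.1
  obtain ⟨η, hη⟩ := (hF.lower U Q hU hQ).2 p.2
  obtain ⟨ξ, hξ⟩ := (hF.lower V W hV hW).2 p.2
  obtain ⟨u, hu, hu₁, hu₂⟩ := exists_isFlatAt_fiber_fiber hs hsF hf hU hQ hγ hη
  obtain ⟨v, hv, hv₁, hv₂⟩ := exists_isFlatAt_fiber_fiber hs hsF hf hV hW hγ hξ
  rw [(isSingularMetric_warpedMetric hs hsF hf).coInner_eq hu hv, warpedMetric_apply, hu₁, hu₂,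
    hv₁, hv₂, hs.coInner_eq hγ hγ]
  simp only [map_smul, LinearMap.smul_apply, smul_eq_mul]
  -- Where f = 0, regularity of the fiber point is unknown, but both sides vanish by their powers of
  -- f.
  rcases eq_or_ne (f p.1) 0 with h | h
  · simp [h]
  · rw [← hF.coInner_eq_coInnerExt hV hW hU hQ (mem_regularSet_fiber hB hp h),
      hsF.coInner_eq hη hξ]
    ring

end Warped

/-! ### Covariant derivatives with an explicit smooth extension. -/

section HasCovDeriv

variable {E : Type*} [NormedAddCommGroup E] [NormedSpace ℝ E] [FiniteDimensional ℝ E]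
  {H : Type*} [TopologicalSpace H] {I : ModelWithCorners ℝ E H}
  {M : Type*} [TopologicalSpace M] [ChartedSpace H M] [IsManifold I ∞ M] [T2Space M]
  {g : MetricField I M}

/-- The inner product `⟪⟪∇^♭_Z T, ∇^♭_X Y⟫⟫` extends smoothly from the regular set, and the
resulting function `(∇_Z ∇^♭_X Y)(T)` is `r`. -/
def HasCovDeriv (g : MetricField I M) (Z X Y T : VField I M) (r : M → ℝ) : Prop :=
  ∃ S : M → ℝ, ContMDiff I 𝓘(ℝ, ℝ) ∞ S ∧
    (∀ x ∈ regularSet g, coInner g (koszul g Z T) (koszul g X Y) x = S x) ∧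
    ∀ x, dirDeriv Z (koszul g X Y T) x - S x = r x

theorem HasCovDeriv.covDeriv_eq {Z X Y T : VField I M} {r : M → ℝ} (h : HasCovDeriv g Z X Y T r)
    (hg : IsSingularMetric g) (hX : IsSmoothField I X) (hY : IsSmoothField I Y)
    (hZ : IsSmoothField I Z) (hT : IsSmoothField I T) (x : M) :
    covDeriv g (koszul g) Z (koszul g X Y) T x = r x := by
  obtain ⟨S, hS, hc, hr⟩ := h
  rw [← hr, hg.covDeriv_eq
    (hZ.contMDiff_dirDeriv (hg.contMDiff_koszul hX hY hT)).continuous.continuousAt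
    hS.continuous.continuousAt (Filter.Eventually.of_forall hc)]

theorem HasCovDeriv.hasCovDerivAt {Z X Y T : VField I M} {r : M → ℝ}
    (h : HasCovDeriv g Z X Y T r) {x : M} {u : TangentSpace I x} (hu : r x = g x u (T x)) :
    HasCovDerivAt g Z (koszul g X Y) x u T := by
  obtain ⟨S, hS, hc, hr⟩ := h
  exact ⟨S, hS, Filter.Eventually.of_forall hc, (hr x).trans hu⟩

theorem HasCovDeriv.congr {Z X Y X' Y' T : VField I M} {r : M → ℝ}
    (h : HasCovDeriv g Z X Y T r) (hK : koszul g X' Y' = koszul g X Y) :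
    HasCovDeriv g Z X' Y' T r := by
  rwa [HasCovDeriv, hK]

theorem IsSemiRegular.snmCurvature_eq_of_hasCovDeriv (hg : IsSemiRegular g) {P X Y Z T : VField I M}
    (hP : IsSmoothField I P) (hX : IsSmoothField I X) (hY : IsSmoothField I Y)
    (hZ : IsSmoothField I Z) (hT : IsSmoothField I T) {r s : M → ℝ}
    (hr : HasCovDeriv g X Y Z T r) (hs : HasCovDeriv g Y X Z T s) (x : M) :
    snmCurvature g P X Y Z T x = r x - s x - koszul g (VectorField.mlieBracket I X Y) Z T x +
      dirDeriv X (pairing g Z P) x * pairing g Y T x -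
      dirDeriv Y (pairing g Z P) x * pairing g X T x +
      pairing g T P x * (koszul g X Z Y x - koszul g Y Z X x) := by
  rw [hg.snmCurvature_eq hP hX hY hZ hT, curvature, curvatureOf,
    hr.covDeriv_eq hg.toIsSingularMetric hY hZ hX hT,
    hs.covDeriv_eq hg.toIsSingularMetric hX hZ hY hT]

end HasCovDeriv

/-! ### Second covariant derivatives of lifts. -/

section Warped

variable {EB : Type*} [NormedAddCommGroup EB] [NormedSpace ℝ EB]
  {HB : Type*} [TopologicalSpace HB] {IB : ModelWithCorners ℝ EB HB}
  {B : Type*} [TopologicalSpace B] [ChartedSpace HB B]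
  {EF : Type*} [NormedAddCommGroup EF] [NormedSpace ℝ EF]
  {HF : Type*} [TopologicalSpace HF] {IF : ModelWithCorners ℝ EF HF}
  {F : Type*} [TopologicalSpace F] [ChartedSpace HF F]
  {gB : MetricField IB B} {gF : MetricField IF F} {f : B → ℝ}
  [IsManifold IB ∞ B] [IsManifold IF ∞ F] [FiniteDimensional ℝ EB]
  [FiniteDimensional ℝ EF] [T2Space B] [T2Space F]

variable {X Y Z T : VField IB B} {U V W Q : VField IF F}

theorem hasCovDeriv_base_base_base_base (hB : IsNondegenerateMetric gB) (hF : IsSingularMetric gF)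
    (hf : ContMDiff IB 𝓘(ℝ, ℝ) ∞ f) (hX : IsSmoothField IB X) (hY : IsSmoothField IB Y)
    (hZ : IsSmoothField IB Z) (hT : IsSmoothField IB T) :
    HasCovDeriv (warpedMetric gB gF f) (liftBase IF F Z) (liftBase IF F X) (liftBase IF F Y)
      (liftBase IF F T) fun p => covDeriv gB (koszul gB) Z (koszul gB X Y) T p.1 := by
  have hs := hB.toIsSingularMetric
  have hK := hB.isRadicalAnnihilator_koszul hX hY
  have hK' := hB.isRadicalAnnihilator_koszul hZ hT
  refine ⟨_, contMDiff_comp_fst (hB.contMDiff_coInner hK' hK), fun p _ =>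
    coInner_warped_base_base_base_base hB hF hf hX hY hZ hT p, fun p => ?_⟩
  rw [koszul_warped_base_base_base hs hX hY hT,
    dirDeriv_liftBase_fst ((hs.contMDiff_koszul hX hY hT).mdiffAt _),
    ← hB.covDeriv_eq hK hK' hZ hT]

theorem hasCovDeriv_base_base_base_fiber (hB : IsNondegenerateMetric gB) (hF : IsSingularMetric gF)
    (hf : ContMDiff IB 𝓘(ℝ, ℝ) ∞ f) (hX : IsSmoothField IB X) (hY : IsSmoothField IB Y)
    (hZ : IsSmoothField IB Z) (hQ : IsSmoothField IF Q) :
    HasCovDeriv (warpedMetric gB gF f) (liftBase IF F Z) (liftBase IF F X) (liftBase IF F Y)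
      (liftFiber IB B Q) fun _ => 0 := by
  refine ⟨_, contMDiff_const, fun p _ =>
    coInner_warped_base_fiber_base_base hB hF hf hX hY hZ hQ p, fun p => ?_⟩
  rw [koszul_warped_base_base_fiber hB.toIsSingularMetric hX hY hQ, dirDeriv_const, sub_zero]

theorem hasCovDeriv_base_base_fiber_base (hB : IsNondegenerateMetric gB) (hF : IsSingularMetric gF)
    (hf : ContMDiff IB 𝓘(ℝ, ℝ) ∞ f) (hX : IsSmoothField IB X) (hV : IsSmoothField IF V)
    (hZ : IsSmoothField IB Z) (hT : IsSmoothField IB T) :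
    HasCovDeriv (warpedMetric gB gF f) (liftBase IF F Z) (liftBase IF F X) (liftFiber IB B V)
      (liftBase IF F T) fun _ => 0 := by
  refine ⟨_, contMDiff_const, fun p _ =>
    coInner_warped_base_base_base_fiber hB hF hf hX hV hZ hT p, fun p => ?_⟩
  rw [koszul_warped_base_fiber_base hB.toIsSingularMetric hF hf hX hT hV, dirDeriv_const, sub_zero]

/-- The inner product Z(f) X(f) g_F(V,Q) removes one of the two terms of Z(f X(f)); the factor f
left over keeps the value representable at zeros of f. -/
theorem hasCovDeriv_base_base_fiber_fiber (hB : IsNondegenerateMetric gB)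
    (hF : IsSingularMetric gF) (hf : ContMDiff IB 𝓘(ℝ, ℝ) ∞ f) (hX : IsSmoothField IB X)
    (hV : IsSmoothField IF V) (hZ : IsSmoothField IB Z) (hQ : IsSmoothField IF Q) :
    HasCovDeriv (warpedMetric gB gF f) (liftBase IF F Z) (liftBase IF F X) (liftFiber IB B V)
      (liftFiber IB B Q) fun p => f p.1 * dirDeriv Z (dirDeriv X f) p.1 * pairing gF V Q p.2 := by
  have hXf := hX.contMDiff_dirDeriv hf
  have hVQ := hF.smooth V Q hV hQ
  refine ⟨_, (contMDiff_comp_fst ((hZ.contMDiff_dirDeriv hf).mul hXf)).mul (contMDiff_comp_snd hVQ),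
    fun p hp => coInner_warped_base_fiber_base_fiber hB hF hf hX hV hZ hQ hp, fun p => ?_⟩
  rw [koszul_warped_base_fiber_fiber hF hf hX hV hQ,
    dirDeriv_liftBase_mul (h := fun b => f b * dirDeriv X f b) (hf.mul hXf) hVQ,
    dirDeriv_mul Z (hf.mdiffAt _) (hXf.mdiffAt _)]
  simp only [Pi.mul_apply]
  ring

/-- The inner product of ∇^♭_Z T with df turns Z(T(f)) into the Hessian. -/
theorem hasCovDeriv_base_fiber_fiber_base (hB : IsNondegenerateMetric gB)
    (hF : IsSemiRegular gF) (hf : ContMDiff IB 𝓘(ℝ, ℝ) ∞ f) (hV : IsSmoothField IF V)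
    (hW : IsSmoothField IF W) (hZ : IsSmoothField IB Z) (hT : IsSmoothField IB T) :
    HasCovDeriv (warpedMetric gB gF f) (liftBase IF F Z) (liftFiber IB B V) (liftFiber IB B W)
      (liftBase IF F T) fun p => -((dirDeriv Z f p.1 * dirDeriv T f p.1 +
        f p.1 * hessian gB f Z T p.1) * pairing gF V W p.2) := by
  have hsF := hF.toIsSingularMetric
  have hTf := hT.contMDiff_dirDeriv hf
  have hVW := hsF.smooth V W hV hW
  have hc := hB.contMDiff_coInner (hB.isRadicalAnnihilator_koszul hZ hT)
    (hB.isRadicalAnnihilator_differential hf)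
  refine ⟨_, ((contMDiff_comp_fst (hf.mul hc)).mul (contMDiff_comp_snd hVW)).neg,
    fun p _ => coInner_warped_base_base_fiber_fiber hB hF hf hZ hT hV hW p, fun p => ?_⟩
  rw [koszul_warped_fiber_fiber_base hB.toIsSingularMetric hsF hf hT hV hW, dirDeriv_neg,
    dirDeriv_liftBase_mul (h := fun b => f b * dirDeriv T f b) (hf.mul hTf) hVW,
    dirDeriv_mul Z (hf.mdiffAt _) (hTf.mdiffAt _)]
  simp only [Pi.mul_apply, hB.hessian_eq hf hZ hT]
  ring

theorem hasCovDeriv_base_fiber_fiber_fiber (hB : IsNondegenerateMetric gB)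
    (hF : IsSemiRegular gF) (hf : ContMDiff IB 𝓘(ℝ, ℝ) ∞ f) (hV : IsSmoothField IF V)
    (hW : IsSmoothField IF W) (hZ : IsSmoothField IB Z) (hQ : IsSmoothField IF Q) :
    HasCovDeriv (warpedMetric gB gF f) (liftBase IF F Z) (liftFiber IB B V) (liftFiber IB B W)
      (liftFiber IB B Q) fun p => f p.1 * dirDeriv Z f p.1 * koszul gF V W Q p.2 := by
  have hsF := hF.toIsSingularMetric
  have hZf := hZ.contMDiff_dirDeriv hf
  have hK := hsF.contMDiff_koszul hV hW hQ
  refine ⟨_, (contMDiff_comp_fst (hf.mul hZf)).mul (contMDiff_comp_snd hK),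
    fun p _ => coInner_warped_base_fiber_fiber_fiber hB hF hf hZ hQ hV hW p, fun p => ?_⟩
  rw [koszul_warped_fiber_fiber_fiber hsF hf hV hW hQ]
  simp only [pow_two]
  rw [dirDeriv_liftBase_mul (h := fun b => f b * f b) (hf.mul hf) hK,
    dirDeriv_mul Z (hf.mdiffAt _) (hf.mdiffAt _)]
  simp only [Pi.mul_apply]
  ring

theorem hasCovDeriv_fiber_base_base_base (hB : IsNondegenerateMetric gB) (hF : IsSingularMetric gF)
    (hf : ContMDiff IB 𝓘(ℝ, ℝ) ∞ f) (hX : IsSmoothField IB X) (hY : IsSmoothField IB Y)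
    (hU : IsSmoothField IF U) (hT : IsSmoothField IB T) :
    HasCovDeriv (warpedMetric gB gF f) (liftFiber IB B U) (liftBase IF F X) (liftBase IF F Y)
      (liftBase IF F T) fun _ => 0 := by
  have hs := hB.toIsSingularMetric
  refine ⟨fun _ => 0, contMDiff_const, fun p _ => ?_, fun p => ?_⟩
  · rw [koszul_warped_fiber_base hs hF hf hT hU]
    exact coInner_warped_base_fiber_base_base hB hF hf hX hY hT hU p
  · rw [koszul_warped_base_base_base hs hX hY hT,
      dirDeriv_liftFiber_fst ((hs.contMDiff_koszul hX hY hT).mdiffAt _), sub_zero]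

theorem hasCovDeriv_fiber_base_base_fiber (hB : IsNondegenerateMetric gB) (hF : IsSemiRegular gF)
    (hf : ContMDiff IB 𝓘(ℝ, ℝ) ∞ f) (hX : IsSmoothField IB X) (hY : IsSmoothField IB Y)
    (hU : IsSmoothField IF U) (hQ : IsSmoothField IF Q) :
    HasCovDeriv (warpedMetric gB gF f) (liftFiber IB B U) (liftBase IF F X) (liftBase IF F Y)
      (liftFiber IB B Q) fun p =>
        f p.1 * coInner gB (koszul gB X Y) (differential f) p.1 * pairing gF U Q p.2 := by
  have hsF := hF.toIsSingularMetric
  have hc := hB.contMDiff_coInner (hB.isRadicalAnnihilator_koszul hX hY)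
    (hB.isRadicalAnnihilator_differential hf)
  refine ⟨_, ((contMDiff_comp_fst (hf.mul hc)).mul
    (contMDiff_comp_snd (hsF.smooth U Q hU hQ))).neg,
    fun p _ => coInner_warped_fiber_fiber_base_base hB hF hf hX hY hU hQ p, fun p => ?_⟩
  rw [koszul_warped_base_base_fiber hB.toIsSingularMetric hX hY hQ, dirDeriv_const]
  simp only [Pi.mul_apply]
  ring

theorem hasCovDeriv_fiber_base_fiber_base (hB : IsNondegenerateMetric gB)
    (hF : IsSingularMetric gF) (hf : ContMDiff IB 𝓘(ℝ, ℝ) ∞ f) (hX : IsSmoothField IB X)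
    (hV : IsSmoothField IF V) (hU : IsSmoothField IF U) (hT : IsSmoothField IB T) :
    HasCovDeriv (warpedMetric gB gF f) (liftFiber IB B U) (liftBase IF F X) (liftFiber IB B V)
      (liftBase IF F T) fun p =>
        -(dirDeriv T f p.1 * dirDeriv X f p.1 * pairing gF V U p.2) := by
  have hs := hB.toIsSingularMetric
  refine ⟨_, (contMDiff_comp_fst ((hT.contMDiff_dirDeriv hf).mul (hX.contMDiff_dirDeriv hf))).mul
    (contMDiff_comp_snd (hF.smooth V U hV hU)), fun p hp => ?_, fun p => ?_⟩
  · rw [koszul_warped_fiber_base hs hF hf hT hU]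
    exact coInner_warped_base_fiber_base_fiber hB hF hf hX hV hT hU hp
  · rw [koszul_warped_base_fiber_base hs hF hf hX hT hV, dirDeriv_const]
    simp only [Pi.mul_apply]
    ring

/-- Metricity on F splits U(g_F(V,Q)), and the inner product cancels K_F(U,Q,V). -/
theorem hasCovDeriv_fiber_base_fiber_fiber (hB : IsNondegenerateMetric gB)
    (hF : IsSemiRegular gF) (hf : ContMDiff IB 𝓘(ℝ, ℝ) ∞ f) (hX : IsSmoothField IB X)
    (hV : IsSmoothField IF V) (hU : IsSmoothField IF U) (hQ : IsSmoothField IF Q) :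
    HasCovDeriv (warpedMetric gB gF f) (liftFiber IB B U) (liftBase IF F X) (liftFiber IB B V)
      (liftFiber IB B Q) fun p => f p.1 * dirDeriv X f p.1 * koszul gF U V Q p.2 := by
  have hsF := hF.toIsSingularMetric
  have hXf := hf.mul (hX.contMDiff_dirDeriv hf)
  refine ⟨_, (contMDiff_comp_fst hXf).mul (contMDiff_comp_snd (hsF.contMDiff_koszul hU hQ hV)),
    fun p _ => coInner_warped_fiber_fiber_base_fiber hB hF hf hX hV hU hQ p, fun p => ?_⟩
  rw [koszul_warped_base_fiber_fiber hsF hf hX hV hQ,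
    dirDeriv_liftFiber_mul (h := fun b => f b * dirDeriv X f b) hXf (hsF.smooth V Q hV hQ),
    hsF.dirDeriv_pairing U V Q]
  simp only [Pi.mul_apply]
  ring

theorem hasCovDeriv_fiber_fiber_fiber_base (hB : IsNondegenerateMetric gB)
    (hF : IsSemiRegular gF) (hf : ContMDiff IB 𝓘(ℝ, ℝ) ∞ f) (hV : IsSmoothField IF V)
    (hW : IsSmoothField IF W) (hU : IsSmoothField IF U) (hT : IsSmoothField IB T) :
    HasCovDeriv (warpedMetric gB gF f) (liftFiber IB B U) (liftFiber IB B V) (liftFiber IB B W)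
      (liftBase IF F T) fun p => -(f p.1 * dirDeriv T f p.1 *
        (dirDeriv U (pairing gF V W) p.2 + koszul gF V W U p.2)) := by
  have hs := hB.toIsSingularMetric
  have hsF := hF.toIsSingularMetric
  have hTf := hf.mul (hT.contMDiff_dirDeriv hf)
  refine ⟨_, (contMDiff_comp_fst hTf).mul (contMDiff_comp_snd (hsF.contMDiff_koszul hV hW hU)),
    fun p _ => ?_, fun p => ?_⟩
  · rw [koszul_warped_fiber_base hs hsF hf hT hU]
    exact coInner_warped_base_fiber_fiber_fiber hB hF hf hT hU hV hW p
  · rw [koszul_warped_fiber_fiber_base hs hsF hf hT hV hW, dirDeriv_neg,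
      dirDeriv_liftFiber_mul (h := fun b => f b * dirDeriv T f b) hTf (hsF.smooth V W hV hW)]
    simp only [Pi.mul_apply]
    ring

theorem hasCovDeriv_fiber_fiber_fiber_fiber (hB : IsNondegenerateMetric gB)
    (hF : IsSemiRegular gF) (hf : ContMDiff IB 𝓘(ℝ, ℝ) ∞ f) (hV : IsSmoothField IF V)
    (hW : IsSmoothField IF W) (hU : IsSmoothField IF U) (hQ : IsSmoothField IF Q) :
    HasCovDeriv (warpedMetric gB gF f) (liftFiber IB B U) (liftFiber IB B V) (liftFiber IB B W)
      (liftFiber IB B Q) fun p =>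
        f p.1 ^ 2 * (covDeriv gF (koszul gF) U (koszul gF V W) Q p.2 -
          coInner gB (differential f) (differential f) p.1 *
            (pairing gF U Q p.2 * pairing gF V W p.2)) := by
  have hsF := hF.toIsSingularMetric
  have hdf := hB.isRadicalAnnihilator_differential hf
  refine ⟨_, ((contMDiff_comp_fst ((hf.pow 2).mul (hB.contMDiff_coInner hdf hdf))).mul
      ((contMDiff_comp_snd (hsF.smooth U Q hU hQ)).mul
        (contMDiff_comp_snd (hsF.smooth V W hV hW)))).add
      ((contMDiff_comp_fst (hf.pow 2)).mul
        (contMDiff_comp_snd (hF.contMDiff_coInnerExt hV hW hU hQ))),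
    fun p hp => coInner_warped_fiber_fiber_fiber_fiber hB hF hf hU hQ hV hW hp, fun p => ?_⟩
  rw [koszul_warped_fiber_fiber_fiber hsF hf hV hW hQ,
    dirDeriv_liftFiber_mul (h := fun b => f b ^ 2) (hf.pow 2) (hsF.contMDiff_koszul hV hW hQ)]
  simp only [Pi.mul_apply, Pi.add_apply, coInnerExt]
  ring

end Warped

/-! ### Semi-regularity of the warped product. -/

section Warped

variable {EB : Type*} [NormedAddCommGroup EB] [NormedSpace ℝ EB]
  {HB : Type*} [TopologicalSpace HB] {IB : ModelWithCorners ℝ EB HB}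
  {B : Type*} [TopologicalSpace B] [ChartedSpace HB B]
  {EF : Type*} [NormedAddCommGroup EF] [NormedSpace ℝ EF]
  {HF : Type*} [TopologicalSpace HF] {IF : ModelWithCorners ℝ EF HF}
  {F : Type*} [TopologicalSpace F] [ChartedSpace HF F]
  {gB : MetricField IB B} {gF : MetricField IF F} {f : B → ℝ}
  [IsManifold IB ∞ B] [IsManifold IF ∞ F] [FiniteDimensional ℝ EB]
  [FiniteDimensional ℝ EF] [T2Space B] [T2Space F]

/-- Nondegeneracy of g_B makes the base component of the representative available for any values;
only the fiber component must be exhibited, as a vector ξ common to all frame fields. -/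
theorem exists_hasCovDerivAt (hB : IsNondegenerateMetric gB) {p : B × F}
    {D A C : VField (IB.prod IF) (B × F)}
    {eB : Fin (Module.finrank ℝ EB) → VField IB B} {κ : Type*} {eF : κ → VField IF F}
    (hliB : LinearIndependent ℝ (fun i => eB i p.1))
    (hb : ∀ i, ∃ r, HasCovDeriv (warpedMetric gB gF f) D A C (liftBase IF F (eB i)) r)
    (hv : ∃ ξ : TangentSpace IF p.2, ∀ j, ∃ r,
      HasCovDeriv (warpedMetric gB gF f) D A C (liftFiber IB B (eF j)) r ∧
        r p = f p.1 ^ 2 * gF p.2 ξ (eF j p.2)) :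
    ∃ u, ∀ l, HasCovDerivAt (warpedMetric gB gF f) D (koszul (warpedMetric gB gF f) A C) p u
      (Sum.elim (fun i => liftBase IF F (eB i)) (fun j => liftFiber IB B (eF j)) l) := by
  choose r hr using hb
  obtain ⟨ξ, hξ⟩ := hv
  obtain ⟨a, ha⟩ := hB.exists_apply_frame_eq hliB (by simp) (fun i => r i p)
  obtain ⟨u, hu₁, hu₂⟩ := exists_tangent_prod p a ξ
  refine ⟨u, ?_⟩
  rintro (i | j)
  · refine (hr i).hasCovDerivAt ?_
    rw [warpedMetric_liftBase, hu₁, ha]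
  · obtain ⟨s, hs, hsp⟩ := hξ j
    refine hs.hasCovDerivAt ?_
    rw [warpedMetric_liftFiber, hu₂, hsp]

/-- One factor f in a value suffices for it to be of the form f² g_F(ξ,·): ξ carries the quotient by
f, which is zero by convention when f = 0. -/
theorem mul_mul_eq_sq_mul_div_mul (x a c : ℝ) : x * a * c = x ^ 2 * (a / x * c) := by
  rcases eq_or_ne x 0 with h | h
  · simp [h]
  · field_simp

/-- A warped product of a nondegenerate base and a semi-regular fiber is semi-regular. -/
theorem isSemiRegular_warpedMetric (hB : IsNondegenerateMetric gB) (hF : IsSemiRegular gF)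
    (hf : ContMDiff IB 𝓘(ℝ, ℝ) ∞ f) : IsSemiRegular (warpedMetric gB gF f) := by
  have hs := hB.toIsSingularMetric
  have hsF := hF.toIsSingularMetric
  refine (isSingularMetric_warpedMetric hs hsF hf).isSemiRegular_of_frame card_frames fun p => ?_
  obtain ⟨eB, eF, heB, heF, hliB, he, hli⟩ := exists_frames (IB := IB) (IF := IF) p
  refine ⟨_, he, hli, fun i j => ?_, fun i j k => ?_⟩
  · rcases i with i | i <;> rcases j with j | j <;> simp only [Sum.elim_inl, Sum.elim_inr]
    · obtain ⟨α, hα⟩ := (hB.isRadicalAnnihilator_koszul (heB i) (heB j)).2 p.1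
      obtain ⟨u, hu, -⟩ := exists_isFlatAt_base_base hs hsF hf (heB i) (heB j) hα
      exact ⟨u, hu⟩
    · obtain ⟨u, hu, -⟩ := exists_isFlatAt_base_fiber hs hsF hf (heB i) (heF j) p
      exact ⟨u, hu⟩
    · obtain ⟨u, hu, -⟩ := exists_isFlatAt_base_fiber hs hsF hf (heB j) (heF i) p
      rw [koszul_warped_fiber_base hs hsF hf (heB j) (heF i)]
      exact ⟨u, hu⟩
    · obtain ⟨γ, hγ⟩ := (hB.isRadicalAnnihilator_differential hf).2 p.1
      obtain ⟨ξ, hξ⟩ := (hF.lower _ _ (heF i) (heF j)).2 p.2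
      obtain ⟨u, hu, -⟩ := exists_isFlatAt_fiber_fiber hs hsF hf (heF i) (heF j) hγ hξ
      exact ⟨u, hu⟩
  -- This covers both orders of the base and the fiber field, since their lowered derivatives
  -- coincide.
  · have mixed : ∀ k i j, ∃ u, ∀ l, HasCovDerivAt (warpedMetric gB gF f)
        (Sum.elim (fun i => liftBase IF F (eB i)) (fun j => liftFiber IB B (eF j)) k)
        (koszul (warpedMetric gB gF f) (liftBase IF F (eB i)) (liftFiber IB B (eF j))) p u
        (Sum.elim (fun i => liftBase IF F (eB i)) (fun j => liftFiber IB B (eF j)) l) := by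
      rintro (k | k) i j
      · refine exists_hasCovDerivAt hB hliB (fun l => ⟨_, hasCovDeriv_base_base_fiber_base hB hsF hf
          (heB i) (heF j) (heB k) (heB l)⟩)
          ⟨(dirDeriv (eB k) (dirDeriv (eB i) f) p.1 / f p.1) • eF j p.2, fun l => ⟨_,
          hasCovDeriv_base_base_fiber_fiber hB hsF hf (heB i) (heF j) (heB k) (heF l), ?_⟩⟩
        rw [map_smul, LinearMap.smul_apply, smul_eq_mul, ← mul_mul_eq_sq_mul_div_mul]
        rfl
      · obtain ⟨ξ, hξ⟩ := (hF.lower _ _ (heF k) (heF j)).2 p.2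
        refine exists_hasCovDerivAt hB hliB (fun l => ⟨_, hasCovDeriv_fiber_base_fiber_base hB hsF
          hf (heB i) (heF j) (heF k) (heB l)⟩) ⟨(dirDeriv (eB i) f p.1 / f p.1) • ξ, fun l => ⟨_,
          hasCovDeriv_fiber_base_fiber_fiber hB hF hf (heB i) (heF j) (heF k) (heF l), ?_⟩⟩
        rw [map_smul, LinearMap.smul_apply, smul_eq_mul, ← mul_mul_eq_sq_mul_div_mul,
          ← hξ _ (heF l)]
    rcases i with i | i <;> rcases j with j | j <;> simp only [Sum.elim_inl, Sum.elim_inr]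
    · rcases k with k | k
      · exact exists_hasCovDerivAt hB hliB (fun l => ⟨_, hasCovDeriv_base_base_base_base hB hsF hf
          (heB i) (heB j) (heB k) (heB l)⟩) ⟨0, fun l => ⟨_, hasCovDeriv_base_base_base_fiber hB
          hsF hf (heB i) (heB j) (heB k) (heF l), by simp⟩⟩
      · refine exists_hasCovDerivAt hB hliB (fun l => ⟨_, hasCovDeriv_fiber_base_base_base hB hsF
          hf (heB i) (heB j) (heF k) (heB l)⟩)
          ⟨(coInner gB (koszul gB (eB i) (eB j)) (differential f) p.1 / f p.1) • eF k p.2,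
          fun l => ⟨_, hasCovDeriv_fiber_base_base_fiber hB hF hf (heB i) (heB j) (heF k) (heF l),
          ?_⟩⟩
        rw [map_smul, LinearMap.smul_apply, smul_eq_mul, ← mul_mul_eq_sq_mul_div_mul]
        rfl
    · exact mixed k i j
    · rw [koszul_warped_fiber_base hs hsF hf (heB j) (heF i)]
      exact mixed k j i
    · rcases k with k | k
      · obtain ⟨ξ, hξ⟩ := (hF.lower _ _ (heF i) (heF j)).2 p.2
        refine exists_hasCovDerivAt hB hliB (fun l => ⟨_, hasCovDeriv_base_fiber_fiber_base hB hF
          hf (heF i) (heF j) (heB k) (heB l)⟩) ⟨(dirDeriv (eB k) f p.1 / f p.1) • ξ, fun l => ⟨_,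
          hasCovDeriv_base_fiber_fiber_fiber hB hF hf (heF i) (heF j) (heB k) (heF l), ?_⟩⟩
        rw [map_smul, LinearMap.smul_apply, smul_eq_mul, ← mul_mul_eq_sq_mul_div_mul,
          ← hξ _ (heF l)]
      · obtain ⟨ξ, hξ⟩ := (hF.second _ _ _ (heF i) (heF j) (heF k)).2 p.2
        refine exists_hasCovDerivAt hB hliB (fun l => ⟨_, hasCovDeriv_fiber_fiber_fiber_base hB hF
          hf (heF i) (heF j) (heF k) (heB l)⟩)
          -- The first term represents the second derivative on F; the second accounts for
          -- g_B^*(df,df) g_F(V,W) g_F(U,·).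
          ⟨ξ - (coInner gB (differential f) (differential f) p.1 *
            pairing gF (eF i) (eF j) p.2) • eF k p.2, fun l => ⟨_,
          hasCovDeriv_fiber_fiber_fiber_fiber hB hF hf (heF i) (heF j) (heF k) (heF l), ?_⟩⟩
        rw [map_sub, LinearMap.sub_apply, map_smul, LinearMap.smul_apply, smul_eq_mul,
          ← hξ _ (heF l)]
        simp only [pairing]
        ring

end Warped

end SingularGeometry

end

/-! ### The curvature of the warped product. -/

open SingularGeometry in
theorem theorem3p15
    {EB : Type*} [NormedAddCommGroup EB] [NormedSpace ℝ EB] [FiniteDimensional ℝ EB]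
    {HB : Type*} [TopologicalSpace HB] (IB : ModelWithCorners ℝ EB HB)
    {B : Type*} [TopologicalSpace B] [ChartedSpace HB B] [IsManifold IB ∞ B]
    [BoundarylessManifold IB B] [T2Space B] [SecondCountableTopology B]
    {EF : Type*} [NormedAddCommGroup EF] [NormedSpace ℝ EF] [FiniteDimensional ℝ EF]
    {HF : Type*} [TopologicalSpace HF] (IF : ModelWithCorners ℝ EF HF)
    {F : Type*} [TopologicalSpace F] [ChartedSpace HF F] [IsManifold IF ∞ F]
    [BoundarylessManifold IF F] [T2Space F] [SecondCountableTopology F]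
    (gB : MetricField IB B) (hB : IsNondegenerateMetric gB)
    (gF : MetricField IF F) (hF : IsSemiRegular gF)
    (f : B → ℝ) (hf : ContMDiff IB 𝓘(ℝ, ℝ) ∞ f)
    (P : VField IB B) (hP : IsSmoothField IB P) :
    IsSemiRegular (warpedMetric gB gF f) ∧
    IsSNMSemiRegular (warpedMetric gB gF f) (liftBase IF F P) ∧
    ∀ (X Y Z T : VField IB B) (U V W Q : VField IF F),
      IsSmoothField IB X → IsSmoothField IB Y → IsSmoothField IB Z → IsSmoothField IB T →
      IsSmoothField IF U → IsSmoothField IF V → IsSmoothField IF W → IsSmoothField IF Q →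
      ∀ p : B × F,
        let R := fun A₁ A₂ A₃ A₄ : VField (IB.prod IF) (B × F) =>
          snmCurvature (warpedMetric gB gF f) (liftBase IF F P) A₁ A₂ A₃ A₄ p
        let b := fun A : VField IB B => liftBase IF F A
        let v := fun A : VField IF F => liftFiber IB B A
        -- (1)
        R (b X) (b Y) (b Z) (b T) = snmCurvature gB P X Y Z T p.1 ∧
        -- (2)
        (R (b X) (b Y) (b Z) (v Q) = 0 ∧ R (b Z) (v Q) (b X) (b Y) = 0 ∧
          R (b X) (b Y) (v Q) (b Z) = 0) ∧
        -- (3)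
        (R (b X) (b Y) (v W) (v Q) = 0 ∧ R (v W) (v Q) (b X) (b Y) = 0) ∧
        -- (4)
        R (b X) (v V) (v W) (b T) =
          -(f p.1) * hessian gB f X T p.1 * pairing gF V W p.2
            + 2 * f p.1 * dirDeriv X f p.1 * pairing gF V W p.2 * pairing gB P T p.1 ∧
        -- (5)
        R (b X) (v V) (b T) (v W) =
          f p.1 * hessian gB f X T p.1 * pairing gF V W p.2
            + (f p.1) ^ 2 * pairing gF V W p.2 * dirDeriv X (pairing gB P T) p.1 ∧
        -- (6)
        (R (v U) (v V) (b Z) (v Q) = 0 ∧ R (b Z) (v Q) (v U) (v V) = 0) ∧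
        -- (7)
        R (v U) (v V) (v Q) (b Z) =
          (f p.1) ^ 2 * pairing gB P Z p.1 * (koszul gF U Q V p.2 - koszul gF V Q U p.2) ∧
        -- (8)
        R (v U) (v V) (v W) (v Q) =
          (f p.1) ^ 2 * curvature gF U V W Q p.2
            + (f p.1) ^ 2 * coInner gB (differential f) (differential f) p.1
              * (pairing gF U W p.2 * pairing gF V Q p.2
                - pairing gF V W p.2 * pairing gF U Q p.2) := by
  have hs := hB.toIsSingularMetric
  have hsF := hF.toIsSingularMetric
  have hg := isSemiRegular_warpedMetric hB hF hf
  have hsg := hg.toIsSingularMetric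
  refine ⟨hg, hg.isSNMSemiRegular hP.liftBase, ?_⟩
  intro X Y Z T U V W Q hX hY hZ hT hU hV hW hQ p R b v
  have hPl : IsSmoothField (IB.prod IF) (liftBase IF F P) := hP.liftBase
  have swap : ∀ {A : VField IB B} {C : VField IF F}, IsSmoothField IB A → IsSmoothField IF C →
      koszul (warpedMetric gB gF f) (liftFiber IB B C) (liftBase IF F A) =
        koszul (warpedMetric gB gF f) (liftBase IF F A) (liftFiber IB B C) := fun hA hC =>
    koszul_warped_fiber_base hs hsF hf hA hC
  -- This disposes of the bracket term whenever the first two arguments are a base and a fiber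
  -- field.
  have zero : ∀ {A C : VField (IB.prod IF) (B × F)}, IsSmoothField (IB.prod IF) A →
      IsSmoothField (IB.prod IF) C → koszul (warpedMetric gB gF f) 0 A C p = 0 := fun hA hC =>
    hsg.koszul_zero_left hA hC p
  refine ⟨?_, ⟨?_, ?_, ?_⟩, ⟨?_, ?_⟩, ?_, ?_, ⟨?_, ?_⟩, ?_, ?_⟩
  · refine (hg.snmCurvature_eq_of_hasCovDeriv hPl hX.liftBase hY.liftBase hZ.liftBase hT.liftBase
      (hasCovDeriv_base_base_base_base hB hsF hf hY hZ hX hT)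
      (hasCovDeriv_base_base_base_base hB hsF hf hX hZ hY hT) p).trans ?_
    rw [hB.isSemiRegular.snmCurvature_eq hP hX hY hZ hT, curvature, curvatureOf,
      mlieBracket_liftBase hX hY, koszul_warped_base_base_base hs (hX.mlieBracket hY) hZ hT,
      koszul_warped_base_base_base hs hX hZ hY, koszul_warped_base_base_base hs hY hZ hX]
    simp only [pairing_warped_base_base]
    rw [dirDeriv_liftBase_fst (hs.mdiffAt hZ hP _), dirDeriv_liftBase_fst (hs.mdiffAt hZ hP _)]
  · refine (hg.snmCurvature_eq_of_hasCovDeriv hPl hX.liftBase hY.liftBase hZ.liftBase hQ.liftFiber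
      (hasCovDeriv_base_base_base_fiber hB hsF hf hY hZ hX hQ)
      (hasCovDeriv_base_base_base_fiber hB hsF hf hX hZ hY hQ) p).trans ?_
    rw [mlieBracket_liftBase hX hY, koszul_warped_base_base_fiber hs (hX.mlieBracket hY) hZ hQ]
    simp only [pairing_warped_base_fiber, pairing_warped_fiber_base]
    ring
  · refine (hg.snmCurvature_eq_of_hasCovDeriv hPl hZ.liftBase hQ.liftFiber hX.liftBase hY.liftBase
      ((hasCovDeriv_base_base_fiber_base hB hsF hf hX hQ hZ hY).congr (swap hX hQ))
      (hasCovDeriv_fiber_base_base_base hB hsF hf hZ hX hQ hY) p).trans ?_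
    rw [mlieBracket_liftBase_liftFiber hZ hQ, zero hX.liftBase hY.liftBase,
      koszul_warped_base_base_fiber hs hZ hX hQ, swap hX hQ,
      koszul_warped_base_fiber_base hs hsF hf hX hZ hQ]
    simp only [pairing_warped_base_base, pairing_warped_fiber_base]
    rw [dirDeriv_liftFiber_fst (hs.mdiffAt hX hP _)]
    ring
  · refine (hg.snmCurvature_eq_of_hasCovDeriv hPl hX.liftBase hY.liftBase hQ.liftFiber hZ.liftBase
      (hasCovDeriv_base_base_fiber_base hB hsF hf hY hQ hX hZ)
      (hasCovDeriv_base_base_fiber_base hB hsF hf hX hQ hY hZ) p).trans ?_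
    rw [mlieBracket_liftBase hX hY,
      koszul_warped_base_fiber_base hs hsF hf (hX.mlieBracket hY) hZ hQ,
      koszul_warped_base_fiber_base hs hsF hf hX hY hQ,
      koszul_warped_base_fiber_base hs hsF hf hY hX hQ]
    simp only [pairing_warped_fiber_base, dirDeriv_const]
    ring
  -- The commutator of X and Y on f cancels the bracket term f [X,Y](f) g_F(W,Q).
  · refine (hg.snmCurvature_eq_of_hasCovDeriv hPl hX.liftBase hY.liftBase hW.liftFiber hQ.liftFiber
      (hasCovDeriv_base_base_fiber_fiber hB hsF hf hY hW hX hQ)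
      (hasCovDeriv_base_base_fiber_fiber hB hsF hf hX hW hY hQ) p).trans ?_
    rw [mlieBracket_liftBase hX hY,
      koszul_warped_base_fiber_fiber hsF hf (hX.mlieBracket hY) hW hQ]
    simp only [pairing_warped_fiber_base, pairing_warped_base_fiber, dirDeriv_mlieBracket hX hY hf]
    ring
  · refine (hg.snmCurvature_eq_of_hasCovDeriv hPl hW.liftFiber hQ.liftFiber hX.liftBase hY.liftBase
      ((hasCovDeriv_fiber_base_fiber_base hB hsF hf hX hQ hW hY).congr (swap hX hQ))
      ((hasCovDeriv_fiber_base_fiber_base hB hsF hf hX hW hQ hY).congr (swap hX hW)) p).trans ?_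
    rw [mlieBracket_liftFiber hW hQ, swap hX (hW.mlieBracket hQ), swap hX hW, swap hX hQ,
      koszul_warped_base_fiber_base hs hsF hf hX hY (hW.mlieBracket hQ),
      koszul_warped_base_fiber_fiber hsF hf hX hW hQ,
      koszul_warped_base_fiber_fiber hsF hf hX hQ hW, hsF.pairing_comm Q W]
    simp only [pairing_warped_fiber_base]
    ring
  -- The products X(f) T(f) cancel, leaving the Hessian. The coefficient 2 arises because K(X,W,V)
  -- and K(V,W,X) are opposite.
  · refine (hg.snmCurvature_eq_of_hasCovDeriv hPl hX.liftBase hV.liftFiber hW.liftFiber hT.liftBase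
      (hasCovDeriv_base_fiber_fiber_base hB hF hf hV hW hX hT)
      (hasCovDeriv_fiber_base_fiber_base hB hsF hf hX hW hV hT) p).trans ?_
    rw [mlieBracket_liftBase_liftFiber hX hV, zero hW.liftFiber hT.liftBase,
      koszul_warped_base_fiber_fiber hsF hf hX hW hV,
      koszul_warped_fiber_fiber_base hs hsF hf hX hV hW, hsF.pairing_comm W V]
    simp only [pairing_warped_fiber_base, pairing_warped_base_base, dirDeriv_const,
      hs.pairing_comm T P]
    ring
  -- The first derivative contributes X(T(f)), the second the inner product of ∇^♭_X T with df;
  -- their difference is the Hessian.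
  · refine (hg.snmCurvature_eq_of_hasCovDeriv hPl hX.liftBase hV.liftFiber hT.liftBase hW.liftFiber
      ((hasCovDeriv_base_base_fiber_fiber hB hsF hf hT hV hX hW).congr (swap hT hV))
      (hasCovDeriv_fiber_base_base_fiber hB hF hf hX hT hV hW) p).trans ?_
    rw [mlieBracket_liftBase_liftFiber hX hV, zero hT.liftBase hW.liftFiber,
      hB.hessian_eq hf hX hT, hs.pairing_comm P T]
    simp only [pairing_warped_fiber_base, pairing_warped_base_fiber, pairing_warped_base_base,
      pairing_warped_fiber_fiber]
    rw [dirDeriv_liftBase_fst (hs.mdiffAt hT hP _)]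
    ring
  · refine (hg.snmCurvature_eq_of_hasCovDeriv hPl hU.liftFiber hV.liftFiber hZ.liftBase hQ.liftFiber
      ((hasCovDeriv_fiber_base_fiber_fiber hB hF hf hZ hV hU hQ).congr (swap hZ hV))
      ((hasCovDeriv_fiber_base_fiber_fiber hB hF hf hZ hU hV hQ).congr (swap hZ hU)) p).trans ?_
    rw [mlieBracket_liftFiber hU hV, swap hZ (hU.mlieBracket hV),
      koszul_warped_base_fiber_fiber hsF hf hZ (hU.mlieBracket hV) hQ]
    simp only [pairing_warped_fiber_base, pairing_warped_base_base]
    rw [dirDeriv_liftFiber_fst (hs.mdiffAt hZ hP _), dirDeriv_liftFiber_fst (hs.mdiffAt hZ hP _),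
      hsF.koszul_swap U V Q]
    ring
  · refine (hg.snmCurvature_eq_of_hasCovDeriv hPl hZ.liftBase hQ.liftFiber hU.liftFiber hV.liftFiber
      (hasCovDeriv_base_fiber_fiber_fiber hB hF hf hQ hU hZ hV)
      (hasCovDeriv_fiber_base_fiber_fiber hB hF hf hZ hU hQ hV) p).trans ?_
    rw [mlieBracket_liftBase_liftFiber hZ hQ, zero hU.liftFiber hV.liftFiber]
    simp only [pairing_warped_fiber_base, dirDeriv_const]
    ring
  · refine (hg.snmCurvature_eq_of_hasCovDeriv hPl hU.liftFiber hV.liftFiber hQ.liftFiber hZ.liftBase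
      (hasCovDeriv_fiber_fiber_fiber_base hB hF hf hV hQ hU hZ)
      (hasCovDeriv_fiber_fiber_fiber_base hB hF hf hU hQ hV hZ) p).trans ?_
    rw [mlieBracket_liftFiber hU hV,
      koszul_warped_fiber_fiber_base hs hsF hf hZ (hU.mlieBracket hV) hQ,
      koszul_warped_fiber_fiber_fiber hsF hf hU hQ hV,
      koszul_warped_fiber_fiber_fiber hsF hf hV hQ hU, hs.pairing_comm P Z]
    simp only [pairing_warped_fiber_base, pairing_warped_base_base]
    -- Metricity and torsion-freeness on F make the ordinary curvature term vanish; only the term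
    -- with g_B(P,Z) remains.
    rw [hsF.dirDeriv_pairing U V Q, hsF.dirDeriv_pairing V U Q, hsF.koszul_swap U V Q]
    ring
  -- P is orthogonal to every fiber field, so all corrections vanish; antisymmetrizing the gradient
  -- terms gives the quadratic expression in g_F.
  · refine (hg.snmCurvature_eq_of_hasCovDeriv hPl hU.liftFiber hV.liftFiber hW.liftFiber
      hQ.liftFiber (hasCovDeriv_fiber_fiber_fiber_fiber hB hF hf hV hW hU hQ)
      (hasCovDeriv_fiber_fiber_fiber_fiber hB hF hf hU hW hV hQ) p).trans ?_
    rw [mlieBracket_liftFiber hU hV,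
      koszul_warped_fiber_fiber_fiber hsF hf (hU.mlieBracket hV) hW hQ, curvature, curvatureOf]
    simp only [pairing_warped_fiber_base, dirDeriv_const]
    ring
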